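/- **Setting.** $\lambda$ is the security parameter; all objects below are families indexed by $\lambda$. "Negligible" means smaller than every inverse polynomial in $\lambda$. A *random oracle* is a uniformly random function $O:\{0,1\}^{a(\lambda)}\to\{0,1\}^{b(\lambda)}$, accessible through the unitary $|x,y\rangle\mapsto|x,y\oplus O(x)\rangle$. *Efficient* honest algorithms are families of quantum circuits over $\{H,T,\mathrm{CNOT},O\}$ with polynomially many gates and ancilla wires, with $a,b$ polynomially bounded. *Query-bounded* adversarial algorithms are arbitrary (non-uniform, of unbounded running time, finite-dimensional) quantum algorithms that make at most $q(\lambda)$ oracle queries, $q$ a polynomial. **Unclonable encryption (UE).** A scheme $(\mathsf{KeyGen},\mathsf{Enc},\mathsf{Dec})$ with classical keys in $\{0,1\}^{\ell(\lambda)}$, classical messages of a fixed length $\mu(\lambda)$ (for example one bit) and quantum ciphertexts, whose algorithms $\mathsf{Enc},\mathsf{Dec}$ are efficient and may use a random oracle $G$ (the plain model, without oracle, being a special case). It is *correct* if $\Pr[\mathsf{Dec}(sk,\mathsf{Enc}(sk,m))=m]\ge 1-\mathsf{negl}(\lambda)$ for all $m$. It is *IND-secure* if for all query-bounded $(\mathcal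 A,\mathcal B,\mathcal C)$ and messages $m_0,m_1$ chosen by them, in the game where $\mathcal A$ maps $\mathsf{Enc}(sk,m_c)$, $c\leftarrow\{0,1\}$ uniform, to a bipartite state on registers $\mathbf X,\mathbf Y$, and $\mathcal B$ (given $\mathbf X,sk$) and $\mathcal C$ (given $\mathbf Y,sk$) output bits, the probability that both bits equal $c$ is at most $\frac12+\mathsf{negl}(\lambda)$. **$n$-party unclonable secret sharing (USS) in the quantum random oracle model.** Efficient oracle algorithms $\mathsf{Share}(m)\to\rho$, a state on $n$ registers (the shares), and $\mathsf{Reconstruct}$. *Correctness*: all $n$ shares of $m$ together reconstruct $m$ with probability at least $1-\mathsf{negl}(\lambda)$. *Indistinguishability-based security* ($\mathsf{USS}_d$): for all query-bounded $\mathcal A_1,\dots,\mathcal A_n,\mathcal B,\mathcal C$, all secrets $m_0,m_1$ chosen by them, and every state $\xi$ on registers $\mathbf{Aux}_1,\dots,\mathbf{Aux}_n$, of any finite dimension and independent of the oracle, whose entanglement graph has at least $d$ connected components, the following holds. Choose $c\leftarrow\{0,1\}$; each $\mathcal A_i$ receives the $i$-th share of $m_c$ and $\mathbf{Aux}_i$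 and, without communication with the others, outputs registers $\mathbf X_i,\mathbf Y_i$; $\mathcal B$ receives $\mathbf X_1,\dots,\mathbf X_n$, $\mathcal C$ receives $\mathbf Y_1,\dots,\mathbf Y_n$, and each outputs a bit. Then both bits equal $c$ with probability at most $\frac12+\mathsf{negl}(\lambda)$. (The entanglement graph has vertices $1,\dots,n$, and $u\neq v$ are adjacent iff the reduced state on $\mathbf{Aux}_u\mathbf{Aux}_v$ is not a product state. For $d=1$ there is no restriction on $\xi$.) **Theorem.** Let $(\mathsf{KeyGen},\mathsf{Enc},\mathsf{Dec})$ be a correct, IND-secure UE scheme as above, whose key is statistically close to uniform on $\{0,1\}^{\ell(\lambda)}$. Let $k(\lambda)$ be polynomially bounded with $2^{-k(\lambda)}$ negligible. Then for every $n\ge 2$ there is an $n$-party USS scheme in the quantum random oracle model, for secrets of $\mu(\lambda)$ bits, that is efficient, correct and $\mathsf{USS}_1$-secure, that is, secure against query-bounded adversaries that share an arbitrary amount of entanglement. It is the following scheme. A single random oracle is used as two independent ones by domain separation: the oracle $G$ of the UE scheme (inputs with first bit $0$) and $H:\{0,1\}^{kn}\to\{0,1\}^{\ell}$ (inputs with first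 bit $1$). - $\mathsf{Share}(m)$: sample uniform $y_1,\dots,y_n\in\{0,1\}^{k}$, put $sk=H(y_1,\dots,y_n)$, and output the shares $\rho_1=(\mathsf{Enc}(sk,m),y_1)$, $\rho_2=y_2$, …, $\rho_n=y_n$. - $\mathsf{Reconstruct}(\rho_1,\dots,\rho_n)$: measure $y_1,\dots,y_n$, compute $sk=H(y_1,\dots,y_n)$ and output $\mathsf{Dec}(sk,\cdot)$ of the ciphertext. -/

import Mathlib

open scoped Matrix ComplexOrder

noncomputable section

namespace QROM

/-! ### Asymptotics -/

/-- `f` is bounded by a polynomial in the security parameter. -/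
def PolyBounded (f : ℕ → ℕ) : Prop :=
  ∃ p : Polynomial ℕ, ∀ lam, f lam ≤ p.eval lam

/-- `ε` is a negligible function of the security parameter. -/
def Negligible (ε : ℕ → ℝ) : Prop :=
  Asymptotics.SuperpolynomialDecay Filter.atTop (fun lam : ℕ => (lam : ℝ)) ε

/-- The average of `f` over a uniformly random element. -/
def avg {α : Type} [Fintype α] (f : α → ℝ) : ℝ :=
  (∑ x, f x) / Fintype.card α

/-! ### Bit strings and oracles -/

/-- Bit strings of length `m`; also the computational basis of `m` qubits. -/
abbrev BitStr (m : ℕ) : Type := Fin m → Bool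

/-- Functions `{0,1}^a → {0,1}^b`. A random oracle is a uniformly random element of this type. -/
abbrev Oracle (a b : ℕ) : Type := BitStr a → BitStr b

/-- The `j`-th bit of a string (`0` beyond its end). -/
def bit {m : ℕ} (s : BitStr m) (j : ℕ) : Bool :=
  if h : j < m then s ⟨j, h⟩ else false

/-- Truncate a string to length `m'`, or pad it with zeros to length `m'`. -/
def resize {m : ℕ} (m' : ℕ) (s : BitStr m) : BitStr m' := fun j => bit s j

/-- Bitwise exclusive or. -/
def bxor {m : ℕ} (s t : BitStr m) : BitStr m := fun j => xor (s j) (t j)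

/-! ### Quantum channels -/

/-- The density matrix `|x⟩⟨x|` of a basis state. -/
def ket {A : Type} [DecidableEq A] (x : A) : Matrix A A ℂ := Matrix.single x x 1

/-- A density matrix on the space with orthonormal basis `A`. -/
def IsState {A : Type} [Fintype A] (ρ : Matrix A A ℂ) : Prop :=
  ρ.PosSemidef ∧ ρ.trace = 1

/-- A finite family of Kraus operators, from the space with basis `A` to that with basis `B`. -/
structure Kraus (A B : Type) where
  ι : Type
  [fintypeι : Fintype ι]
  op : ι → Matrix B A ℂ

attribute [instance] Kraus.fintypeι

namespace Kraus

variable {A B C A' B' : Type}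

/-- The Kraus operators define a quantum channel (a completely positive trace preserving map). -/
def IsChannel [DecidableEq A] [Fintype B] (K : Kraus A B) : Prop :=
  ∑ i, (K.op i)ᴴ * K.op i = 1

/-- The action `ρ ↦ ∑ᵢ Kᵢ ρ Kᵢ†`. -/
def apply [Fintype A] (K : Kraus A B) (ρ : Matrix A A ℂ) : Matrix B B ℂ :=
  ∑ i, K.op i * ρ * (K.op i)ᴴ

/-- First `K`, then `L`. -/
def comp [Fintype B] (L : Kraus B C) (K : Kraus A B) : Kraus A C where
  ι := L.ι × K.ι
  op p := L.op p.1 * K.op p.2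

/-- Two maps acting in parallel on two registers. -/
def prod (K : Kraus A B) (L : Kraus A' B') : Kraus (A × A') (B × B') where
  ι := K.ι × L.ι
  op p := Matrix.kroneckerMap (· * ·) (K.op p.1) (L.op p.2)

/-- `n` maps acting in parallel on `n` registers. -/
def pi {n : ℕ} {A B : Fin n → Type} (K : ∀ i, Kraus (A i) (B i)) :
    Kraus (∀ i, A i) (∀ i, B i) where
  ι := ∀ i, (K i).ι
  op c := Matrix.of fun v u => ∏ i, (K i).op (c i) (v i) (u i)

end Kraus

/-! ### Query algorithms (adversaries)

There is no restriction on a query algorithm except for the number of its oracle queries. -/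

/-- The unitary `|x, y, z⟩ ↦ |x, y ⊕ O(x), z⟩`. -/
def queryKraus {a b : ℕ} (O : Oracle a b) (Z : Type) [DecidableEq Z] :
    Kraus (BitStr a × BitStr b × Z) (BitStr a × BitStr b × Z) where
  ι := Unit
  op _ := Matrix.of fun v u => if v = (u.1, bxor u.2.1 (O u.1), u.2.2) then 1 else 0

/-- A quantum algorithm with superposition access to an oracle `{0,1}^a → {0,1}^b`. It has a query
register, an answer register and a private register with basis `Z`. It first applies the channel
`init` to its input; then, for `j = 0, …, queries - 1`, it makes a query and applies the channel
`step j`; at last it applies the channel `final` to produce its output. -/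
structure OracleAlg (a b : ℕ) (A B : Type) [Fintype A] [DecidableEq A] [Fintype B] where
  Z : Type
  [fintypeZ : Fintype Z]
  [decEqZ : DecidableEq Z]
  queries : ℕ
  init : Kraus A (BitStr a × BitStr b × Z)
  step : ℕ → Kraus (BitStr a × BitStr b × Z) (BitStr a × BitStr b × Z)
  final : Kraus (BitStr a × BitStr b × Z) B
  init_isChannel : init.IsChannel
  step_isChannel : ∀ j, (step j).IsChannel
  final_isChannel : final.IsChannel

attribute [instance] OracleAlg.fintypeZ OracleAlg.decEqZ

namespace OracleAlg

variable {a b : ℕ} {A B : Type} [Fintype A] [DecidableEq A] [Fintype B]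

/-- The map performed up to and including the `j`-th query and the step that follows it. -/
def after (M : OracleAlg a b A B) (O : Oracle a b) : ℕ → Kraus A (BitStr a × BitStr b × M.Z)
  | 0 => M.init
  | j + 1 => (M.step j).comp ((queryKraus O M.Z).comp (M.after O j))

/-- The map from inputs to outputs when the oracle is `O`. -/
def run (M : OracleAlg a b A B) (O : Oracle a b) : Kraus A B :=
  M.final.comp (M.after O M.queries)

end OracleAlg

/-! ### Quantum circuits with oracle gates (honest algorithms) -/

/-- Elementary gates on a set `W` of qubits: Hadamard, `T = diag(1, e^{iπ/4})`, controlled not, and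
a query to an oracle `{0,1}^a → {0,1}^b` with its input on the wires `x` and its output added to
the wires `y`. -/
inductive Gate (a b : ℕ) (W : Type) where
  | hadamard (w : W) : Gate a b W
  | phaseT (w : W) : Gate a b W
  | cnot (c t : W) (h : c ≠ t) : Gate a b W
  | query (x : Fin a ↪ W) (y : Fin b ↪ W) (h : ∀ i j, x i ≠ y j) : Gate a b W

/-- The unitary of a gate, in the computational basis `W → Bool`. -/
def Gate.unitary {a b : ℕ} {W : Type} [Fintype W] [DecidableEq W] (O : Oracle a b) :
    Gate a b W → Matrix (W → Bool) (W → Bool) ℂ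
  | .hadamard w => Matrix.of fun f g =>
      if ∀ v, v ≠ w → f v = g v then
        (if f w && g w then -1 else 1) / (Real.sqrt 2 : ℂ) else 0
  | .phaseT w => Matrix.diagonal fun g =>
      if g w then Complex.exp (Complex.I * Real.pi / 4) else 1
  | .cnot c t _ => Matrix.of fun f g =>
      if f = Function.update g t (xor (g t) (g c)) then 1 else 0
  | .query x y _ => Matrix.of fun f g =>
      if f = fun w => xor (g w) (decide (∃ j, y j = w ∧ O (fun i => g (x i)) j = true))
      then 1 else 0

/-- A quantum circuit with oracle gates, with input qubits `α` and output qubits `β`. The wires that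
carry no input start in `|0⟩`; after the gates have been applied in the order of the list, the
wires that carry no output are traced out. -/
structure Circuit (a b : ℕ) (α β : Type) where
  W : Type
  [fintypeW : Fintype W]
  [decEqW : DecidableEq W]
  inp : α ↪ W
  out : β ↪ W
  gates : List (Gate a b W)

attribute [instance] Circuit.fintypeW Circuit.decEqW

namespace Circuit

variable {a b : ℕ} {α β : Type} [Fintype α] [DecidableEq α] [Fintype β] [DecidableEq β]

/-- The number of wires plus the number of gates. -/
def size (C : Circuit a b α β) : ℕ := Fintype.card C.W + C.gates.length

/-- The isometry that puts the input on its wires and `|0⟩` on all the others. -/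
def embed (C : Circuit a b α β) : Matrix (C.W → Bool) (α → Bool) ℂ :=
  Matrix.of fun g s =>
    if (∀ i, g (C.inp i) = s i) ∧ ∀ w, (∀ i, C.inp i ≠ w) → g w = false then 1 else 0

/-- The product of the gates; the head of the list is applied first. -/
def unitary (C : Circuit a b α β) (O : Oracle a b) : Matrix (C.W → Bool) (C.W → Bool) ℂ :=
  C.gates.foldl (fun U g => g.unitary O * U) 1

/-- The output state of the circuit on the input state `ρ`, when the oracle is `O`. -/
def eval (C : Circuit a b α β) (O : Oracle a b) (ρ : Matrix (α → Bool) (α → Bool) ℂ) :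
    Matrix (β → Bool) (β → Bool) ℂ :=
  Matrix.of fun s t => ∑ f : C.W → Bool, ∑ g : C.W → Bool,
    if (∀ j, f (C.out j) = s j) ∧ (∀ j, g (C.out j) = t j) ∧
        ∀ w, (∀ j, C.out j ≠ w) → f w = g w
    then ((C.unitary O * C.embed) * ρ * (C.unitary O * C.embed)ᴴ) f g else 0

end Circuit

/-! ### Unclonable encryption -/

/-- The syntax of an encryption scheme with classical messages and keys and quantum ciphertexts,
whose algorithms may query a random oracle `{0,1}^oIn → {0,1}^oOut`. (A scheme in the plain model
is the case `oIn = oOut = 0`, where there is only one oracle and a query does nothing.) -/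
structure UEScheme where
  msgLen : ℕ → ℕ
  keyLen : ℕ → ℕ
  ctLen : ℕ → ℕ
  oIn : ℕ → ℕ
  oOut : ℕ → ℕ
  keyGen : ∀ lam, PMF (BitStr (keyLen lam))
  enc : ∀ lam, Circuit (oIn lam) (oOut lam) (Fin (keyLen lam) ⊕ Fin (msgLen lam)) (Fin (ctLen lam))
  dec : ∀ lam, Circuit (oIn lam) (oOut lam) (Fin (keyLen lam) ⊕ Fin (ctLen lam)) (Fin (msgLen lam))

namespace UEScheme

variable (E : UEScheme)

/-- The ciphertext `Enc(sk, m)`. -/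
def encState (lam : ℕ) (O : Oracle (E.oIn lam) (E.oOut lam)) (sk : BitStr (E.keyLen lam))
    (m : BitStr (E.msgLen lam)) : Matrix (BitStr (E.ctLen lam)) (BitStr (E.ctLen lam)) ℂ :=
  (E.enc lam).eval O (ket (Sum.elim sk m))

/-- The output state of `Dec(sk, ρ)`; its diagonal holds the probabilities of the decrypted
messages. -/
def decState (lam : ℕ) (O : Oracle (E.oIn lam) (E.oOut lam)) (sk : BitStr (E.keyLen lam))
    (ρ : Matrix (BitStr (E.ctLen lam)) (BitStr (E.ctLen lam)) ℂ) :
    Matrix (BitStr (E.msgLen lam)) (BitStr (E.msgLen lam)) ℂ :=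
  (E.dec lam).eval O (Matrix.of fun u v =>
    if (fun i => u (Sum.inl i)) = sk ∧ (fun i => v (Sum.inl i)) = sk then
      ρ (fun i => u (Sum.inr i)) (fun i => v (Sum.inr i)) else 0)

/-- Encryption and decryption are performed by circuits of polynomial size (so that all message,
key and ciphertext lengths are polynomial), with an oracle of polynomial input and output length. -/
def IsEfficient : Prop :=
  PolyBounded E.oIn ∧ PolyBounded E.oOut ∧
  PolyBounded (fun lam => (E.enc lam).size) ∧ PolyBounded (fun lam => (E.dec lam).size)

/-- The key is statistically close to uniform. -/
def HasNearUniformKey : Prop :=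
  Negligible fun lam =>
    (1 / 2) * ∑ sk, |(E.keyGen lam sk).toReal - 1 / Fintype.card (BitStr (E.keyLen lam))|

/-- Every message is decrypted correctly with probability at least `1 - negl`. -/
def IsCorrect : Prop :=
  ∃ ε : ℕ → ℝ, Negligible ε ∧ ∀ lam (m : BitStr (E.msgLen lam)),
    1 - ε lam ≤ avg fun O : Oracle (E.oIn lam) (E.oOut lam) =>
      ∑ sk, (E.keyGen lam sk).toReal * (E.decState lam O sk (E.encState lam O sk m) m m).re

/-- A cloning adversary for a fixed security parameter. It chooses two messages; `split` maps the
ciphertext to a register for Bob and one for Charlie, who are then both given the key. -/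
structure Adversary (lam : ℕ) where
  m : Bool → BitStr (E.msgLen lam)
  X : Type
  Y : Type
  [fintypeX : Fintype X]
  [decEqX : DecidableEq X]
  [fintypeY : Fintype Y]
  [decEqY : DecidableEq Y]
  split : OracleAlg (E.oIn lam) (E.oOut lam) (BitStr (E.ctLen lam)) (X × Y)
  bob : BitStr (E.keyLen lam) → OracleAlg (E.oIn lam) (E.oOut lam) X Bool
  charlie : BitStr (E.keyLen lam) → OracleAlg (E.oIn lam) (E.oOut lam) Y Bool

attribute [instance] Adversary.fintypeX Adversary.decEqX Adversary.fintypeY Adversary.decEqY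

variable {E}

/-- Each algorithm of the adversary makes at most `q` queries. -/
def Adversary.QueryBound {lam : ℕ} (𝒜 : E.Adversary lam) (q : ℕ) : Prop :=
  𝒜.split.queries ≤ q ∧ ∀ sk, (𝒜.bob sk).queries ≤ q ∧ (𝒜.charlie sk).queries ≤ q

/-- The probability that both Bob and Charlie guess the uniformly random challenge bit `c`. -/
def Adversary.winProb {lam : ℕ} (𝒜 : E.Adversary lam) : ℝ :=
  avg fun O : Oracle (E.oIn lam) (E.oOut lam) =>
    ∑ sk, (E.keyGen lam sk).toReal * avg fun c : Bool =>
      ((((𝒜.bob sk).run O).prod ((𝒜.charlie sk).run O)).apply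
        ((𝒜.split.run O).apply (E.encState lam O sk (𝒜.m c))) (c, c) (c, c)).re

variable (E)

/-- Unclonable indistinguishability against (non-uniform) adversaries that are bounded only in the
number of their queries. -/
def IsSecure : Prop :=
  ∀ 𝒜 : ∀ lam, E.Adversary lam,
    (∃ q, PolyBounded q ∧ ∀ lam, (𝒜 lam).QueryBound (q lam)) →
    ∃ ε : ℕ → ℝ, Negligible ε ∧ ∀ lam, (𝒜 lam).winProb ≤ 1 / 2 + ε lam

end UEScheme

/-! ### Entanglement graphs -/

/-- The reduced state `ρ[u, v]` of an `n`-partite state on the registers `u ≠ v`. -/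
def reducedPair {n : ℕ} {A : Fin n → Type} [∀ i, Fintype (A i)] [∀ i, DecidableEq (A i)]
    (ρ : Matrix (∀ i, A i) (∀ i, A i) ℂ) (u v : Fin n) : Matrix (A u × A v) (A u × A v) ℂ :=
  Matrix.of fun p p' => ∑ f : ∀ i, A i,
    if f u = p.1 ∧ f v = p.2 then
      ρ f (Function.update (Function.update f u p'.1) v p'.2) else 0

/-- The entanglement graph: distinct `u`, `v` are adjacent iff `ρ[u, v]` is not a product. -/
def entanglementGraph {n : ℕ} {A : Fin n → Type} [∀ i, Fintype (A i)] [∀ i, DecidableEq (A i)]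
    (ρ : Matrix (∀ i, A i) (∀ i, A i) ℂ) : SimpleGraph (Fin n) :=
  SimpleGraph.fromRel fun u v =>
    ¬ ∃ (σ : Matrix (A u) (A u) ℂ) (τ : Matrix (A v) (A v) ℂ), IsState σ ∧ IsState τ ∧
      reducedPair ρ u v = Matrix.kroneckerMap (· * ·) σ τ

/-! ### Unclonable secret sharing -/

/-- The syntax of an `n`-out-of-`n` secret sharing scheme with classical secrets of `msgLen` bits,
where share `i` consists of `shareLen lam i` qubits and the algorithms have access to a random
oracle `{0,1}^oIn → {0,1}^oOut`. -/
structure USSScheme (n : ℕ) (msgLen : ℕ → ℕ) (shareLen : ℕ → Fin n → ℕ) (oIn oOut : ℕ → ℕ) where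
  share : ∀ lam, Circuit (oIn lam) (oOut lam) (Fin (msgLen lam)) (Σ i, Fin (shareLen lam i))
  reconstruct : ∀ lam, Circuit (oIn lam) (oOut lam) (Σ i, Fin (shareLen lam i)) (Fin (msgLen lam))

namespace USSScheme

variable {n : ℕ} {msgLen : ℕ → ℕ} {shareLen : ℕ → Fin n → ℕ} {oIn oOut : ℕ → ℕ}

/-- The joint state of the `n` shares of the secret `m`. -/
def shareState (S : USSScheme n msgLen shareLen oIn oOut) (lam : ℕ)
    (O : Oracle (oIn lam) (oOut lam)) (m : BitStr (msgLen lam)) :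
    Matrix (∀ i, BitStr (shareLen lam i)) (∀ i, BitStr (shareLen lam i)) ℂ :=
  Matrix.of fun s t => (S.share lam).eval O (ket m) (fun p => s p.1 p.2) (fun p => t p.1 p.2)

/-- The output state of `Reconstruct` on the joint state `ρ` of `n` shares; its diagonal holds the
probabilities of the reconstructed secrets. -/
def reconstructState (S : USSScheme n msgLen shareLen oIn oOut) (lam : ℕ)
    (O : Oracle (oIn lam) (oOut lam))
    (ρ : Matrix (∀ i, BitStr (shareLen lam i)) (∀ i, BitStr (shareLen lam i)) ℂ) :
    Matrix (BitStr (msgLen lam)) (BitStr (msgLen lam)) ℂ :=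
  (S.reconstruct lam).eval O
    (Matrix.of fun u v => ρ (fun i j => u ⟨i, j⟩) (fun i j => v ⟨i, j⟩))

/-- Sharing and reconstruction are performed by circuits of polynomial size. -/
def IsEfficient (S : USSScheme n msgLen shareLen oIn oOut) : Prop :=
  PolyBounded oIn ∧ PolyBounded oOut ∧
  PolyBounded (fun lam => (S.share lam).size) ∧ PolyBounded (fun lam => (S.reconstruct lam).size)

/-- Every secret is reconstructed from all its shares with probability at least `1 - negl`. -/
def IsCorrect (S : USSScheme n msgLen shareLen oIn oOut) : Prop :=
  ∃ ε : ℕ → ℝ, Negligible ε ∧ ∀ lam (m : BitStr (msgLen lam)),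
    1 - ε lam ≤ avg fun O : Oracle (oIn lam) (oOut lam) =>
      (S.reconstructState lam O (S.shareState lam O m) m m).re

/-- An adversary for a fixed security parameter: two secrets, a pre-shared state `ξ` on registers
`Aux i`, shareholders `party i` that map their share and auxiliary register to a register `X i`
for Bob and a register `Y i` for Charlie, and the two recovering parties. -/
structure Adversary {n : ℕ} (msgLen : ℕ) (shareLen : Fin n → ℕ) (oIn oOut : ℕ) where
  m : Bool → BitStr msgLen
  Aux : Fin n → Type
  X : Fin n → Type
  Y : Fin n → Type
  [fintypeAux : ∀ i, Fintype (Aux i)]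
  [decEqAux : ∀ i, DecidableEq (Aux i)]
  [fintypeX : ∀ i, Fintype (X i)]
  [decEqX : ∀ i, DecidableEq (X i)]
  [fintypeY : ∀ i, Fintype (Y i)]
  [decEqY : ∀ i, DecidableEq (Y i)]
  ξ : Matrix (∀ i, Aux i) (∀ i, Aux i) ℂ
  ξ_isState : IsState ξ
  party : ∀ i, OracleAlg oIn oOut (BitStr (shareLen i) × Aux i) (X i × Y i)
  bob : OracleAlg oIn oOut (∀ i, X i) Bool
  charlie : OracleAlg oIn oOut (∀ i, Y i) Bool

attribute [instance] Adversary.fintypeAux Adversary.decEqAux Adversary.fintypeX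
  Adversary.decEqX Adversary.fintypeY Adversary.decEqY

/-- Each shareholder and each recovering party makes at most `q` queries. -/
def Adversary.QueryBound {msgLen : ℕ} {shareLen : Fin n → ℕ} {oIn oOut : ℕ}
    (𝒜 : Adversary msgLen shareLen oIn oOut) (q : ℕ) : Prop :=
  (∀ i, (𝒜.party i).queries ≤ q) ∧ 𝒜.bob.queries ≤ q ∧ 𝒜.charlie.queries ≤ q

/-- The joint state of the registers of Bob and Charlie after the shareholders with pre-shared
state `ξ` have processed the shares `ρ`. -/
def Adversary.cloned {msgLen : ℕ} {shareLen : Fin n → ℕ} {oIn oOut : ℕ}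
    (𝒜 : Adversary msgLen shareLen oIn oOut) (O : Oracle oIn oOut)
    (ρ : Matrix (∀ i, BitStr (shareLen i)) (∀ i, BitStr (shareLen i)) ℂ) :
    Matrix ((∀ i, 𝒜.X i) × (∀ i, 𝒜.Y i)) ((∀ i, 𝒜.X i) × (∀ i, 𝒜.Y i)) ℂ :=
  ((Kraus.pi fun i => (𝒜.party i).run O).apply
    (Matrix.of fun u v =>
      ρ (fun i => (u i).1) (fun i => (v i).1) * 𝒜.ξ (fun i => (u i).2) (fun i => (v i).2))).submatrix
    (fun p i => (p.1 i, p.2 i)) (fun p i => (p.1 i, p.2 i))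

/-- The probability that both Bob and Charlie guess the uniformly random challenge bit `c`. -/
def winProb (S : USSScheme n msgLen shareLen oIn oOut) (lam : ℕ)
    (𝒜 : Adversary (msgLen lam) (shareLen lam) (oIn lam) (oOut lam)) : ℝ :=
  avg fun O : Oracle (oIn lam) (oOut lam) => avg fun c : Bool =>
    (((𝒜.bob.run O).prod (𝒜.charlie.run O)).apply
      (𝒜.cloned O (S.shareState lam O (𝒜.m c))) (c, c) (c, c)).re

/-- Indistinguishability-based security in the quantum random oracle model (`USS_d`), against
(non-uniform) adversaries that make polynomially many queries, are otherwise unbounded, and share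
an arbitrary state whose entanglement graph has at least `d` connected components. -/
def IsUSS (d : ℕ) (S : USSScheme n msgLen shareLen oIn oOut) : Prop :=
  ∀ 𝒜 : ∀ lam, Adversary (msgLen lam) (shareLen lam) (oIn lam) (oOut lam),
    (∃ q, PolyBounded q ∧ ∀ lam, (𝒜 lam).QueryBound (q lam)) →
    (∀ lam, d ≤ Nat.card (entanglementGraph (𝒜 lam).ξ).ConnectedComponent) →
    ∃ ε : ℕ → ℝ, Negligible ε ∧ ∀ lam, S.winProb lam (𝒜 lam) ≤ 1 / 2 + ε lam

end USSScheme

/-! ### The construction -/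

section Construction

/-- One random oracle serves as two independent ones: the oracle of the encryption scheme is read
off from the inputs that begin with `0`. -/
def encOracle {N M : ℕ} (a b : ℕ) (O : Oracle (N + 1) M) : Oracle a b :=
  fun x => resize b (O (Fin.cons false (resize N x)))

/-- The hash function `H` is read off from the inputs that begin with `1`. -/
def hashOracle {N M : ℕ} (a b : ℕ) (O : Oracle (N + 1) M) : Oracle a b :=
  fun x => resize b (O (Fin.cons true (resize N x)))

/-- The concatenation `y₁ ‖ ⋯ ‖ yₙ`. -/
def concat {n k : ℕ} (y : Fin n → BitStr k) : BitStr (n * k) :=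
  fun j => y (finProdFinEquiv.symm j).1 (finProdFinEquiv.symm j).2

/-- The first share consists of the ciphertext and `y₁`, the `i`-th share of `yᵢ` for `i > 1`. -/
def hashShareLen (n ct k : ℕ) (i : Fin n) : ℕ := (if i.val = 0 then ct else 0) + k

/-- The basis state of the shares with `c` in the ciphertext register. -/
def joinShares {n ct k : ℕ} (c : BitStr ct) (y : Fin n → BitStr k) :
    ∀ i, BitStr (hashShareLen n ct k i) :=
  fun i => Fin.append (fun j => bit c j) (y i)

variable (E : UEScheme) (k : ℕ → ℕ) (n : ℕ)

/-- The input length of the random oracle, long enough for `encOracle` and `hashOracle`. -/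
def hashIn (lam : ℕ) : ℕ := max (E.oIn lam) (n * k lam) + 1

/-- The output length of the random oracle, long enough for `encOracle` and `hashOracle`. -/
def hashOut (lam : ℕ) : ℕ := max (E.oOut lam) (E.keyLen lam)

/-- The key `sk = H(y₁, …, yₙ)`. -/
def hashKey (lam : ℕ) (O : Oracle (hashIn E k n lam) (hashOut E lam))
    (y : Fin n → BitStr (k lam)) : BitStr (E.keyLen lam) :=
  hashOracle (n * k lam) (E.keyLen lam) O (concat y)

/-- `S` is the hash-based scheme for the encryption scheme `E`. Sharing `m`: choose `y₁, …, yₙ`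
uniformly from `{0,1}^k`, put `sk = H(y₁, …, yₙ)`, and let the shares be
`(Enc(sk, m), y₁), y₂, …, yₙ`. Reconstruction: measure `y₁, …, yₙ` and decrypt with the key
`H(y₁, …, yₙ)`. -/
def IsHashScheme
    (S : USSScheme n E.msgLen (fun lam => hashShareLen n (E.ctLen lam) (k lam))
      (hashIn E k n) (hashOut E)) : Prop :=
  ∀ lam (O : Oracle (hashIn E k n lam) (hashOut E lam)),
    (∀ m, S.shareState lam O m =
      ∑ y : Fin n → BitStr (k lam), ∑ c, ∑ c',
        Matrix.single (joinShares c y) (joinShares c' y)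
          ((1 / 2 : ℂ) ^ (n * k lam) *
            E.encState lam (encOracle _ _ O) (hashKey E k n lam O y) m c c')) ∧
    (∀ ρ, S.reconstructState lam O ρ =
      ∑ y : Fin n → BitStr (k lam),
        E.decState lam (encOracle _ _ O) (hashKey E k n lam O y)
          (ρ.submatrix (fun c => joinShares c y) (fun c => joinShares c y)))

end Construction

end QROM

end

/-! Security rests on the fact that shareholder `i` sees only its own block `yᵢ`. As `n ≥ 2`, some
other block stays uniform from its point of view, and shared entanglement cannot change this: the
probability that a party's queries hit a given point depends on its reduced state alone, and the
reduced state of share `i` with `Aux i` is the same for all values of the other blocks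
(`reducedOne_prepare_congr`). Hence, on average over `y`, each of its queries hits the point `y₁ ‖ ⋯
‖ yₙ` with probability at most `2⁻ᵏ` (`avg_queryWeight_le`).

The value of `H` at that point can therefore be decoupled from the key for the shareholders, while
Bob and Charlie keep the value `sk`. The shareholders are switched one at a time (`apply_pi_le`).
For the one being switched, the channels of the others and the measurement of Bob and Charlie are
absorbed into a quadratic form in its Kraus operators, which is dominated by the trace against its
reduced state (`isDominatedForm_insertOp`). A query-by-query comparison in the style of Bennett,
Bernstein, Brassard and Vazirani (`OracleAlg.sum_after_le`) then bounds the loss, in total by `9 n q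
2^(-k/2)` (`USSScheme.Adversary.avg_guess_le`).

What remains is a cloning attack on the encryption scheme. The splitter creates the pre-shared
state, has `y` built in and runs all shareholders on the ciphertext; Bob and Charlie receive `sk`
and program it into their oracle at the point (`USSScheme.Adversary.exists_simulation`). The string
`y` and the part of the oracle outside `G` are fixed by averaging, which non-uniform adversaries
permit. Each query to the large oracle costs two queries to `G`; the predicate `Realizes` does the
bookkeeping of query numbers.

Correctness is simpler: for fixed `y` the key `H(y)` is uniform and independent of `G`. Efficiency
needs explicit circuits over the given gate set, whose action is computed in `choi_shareCircuit` and
`choi_reconstructCircuit`. -/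

noncomputable section

namespace QROM

/-! ### Averages -/

section Avg

variable {α β : Type} [Fintype α] [Fintype β]

theorem avg_comm (f : α → β → ℝ) :
    avg (fun x => avg fun y => f x y) = avg fun y => avg fun x => f x y := by
  simp only [avg, ← Finset.sum_div]
  rw [Finset.sum_comm, div_right_comm]

theorem avg_mono {f g : α → ℝ} (h : ∀ x, f x ≤ g x) : avg f ≤ avg g := by
  unfold avg
  gcongr with x
  exact h x

theorem avg_add (f g : α → ℝ) : avg (fun x => f x + g x) = avg f + avg g := by
  simp only [avg, Finset.sum_add_distrib, add_div]

theorem avg_const [Nonempty α] (c : ℝ) : avg (fun _ : α => c) = c := by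
  simp [avg]

theorem avg_mul_left (c : ℝ) (f : α → ℝ) : avg (fun x => c * f x) = c * avg f := by
  simp only [avg, ← Finset.mul_sum, mul_div_assoc]

theorem avg_sum {γ : Type} (s : Finset γ) (f : γ → α → ℝ) :
    avg (fun x => ∑ i ∈ s, f i x) = ∑ i ∈ s, avg (f i) := by
  simp only [avg, ← Finset.sum_div]
  rw [Finset.sum_comm]

theorem avg_le [Nonempty α] {f : α → ℝ} {c : ℝ} (h : ∀ x, f x ≤ c) : avg f ≤ c :=
  (avg_mono h).trans_eq (avg_const c)

theorem avg_nonneg {f : α → ℝ} (h : ∀ x, 0 ≤ f x) : 0 ≤ avg f :=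
  div_nonneg (Finset.sum_nonneg fun x _ => h x) (Nat.cast_nonneg _)

theorem exists_avg_le [Nonempty α] (f : α → ℝ) : ∃ x, avg f ≤ f x := by
  obtain ⟨x, hx⟩ := Finite.exists_max f
  exact ⟨x, avg_le hx⟩

/-- Resampling a component of a uniformly random element does not change the distribution. -/
theorem avg_overwrite [Nonempty β] (ow : α → β → α) (rd : α → β)
    (h1 : ∀ x g, rd (ow x g) = g) (h2 : ∀ x g, ow (ow x g) (rd x) = x) (f : α → ℝ) :
    avg f = avg fun x => avg fun g => f (ow x g) := by
  -- Exchanging the component of `x` with `g` is an involution of the pairs, so it preserves their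
  -- uniform distribution.
  have hinv : Function.Involutive fun p : α × β => (ow p.1 p.2, rd p.1) := by
    rintro ⟨x, g⟩
    simp [h1, h2]
  have key : ∑ x, ∑ g, f (ow x g) = ∑ x, ∑ _g : β, f x := by
    rw [← Fintype.sum_prod_type', ← Fintype.sum_prod_type']
    exact Equiv.sum_comp hinv.toPerm (fun p : α × β => f p.1)
  simp only [avg, ← Finset.sum_div, key]
  simp only [Finset.sum_const, Finset.card_univ, nsmul_eq_mul, ← Finset.mul_sum]
  field_simp

end Avg

/-! ### Asymptotics -/

theorem Negligible.add {f g : ℕ → ℝ} (hf : Negligible f) (hg : Negligible g) :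
    Negligible fun lam => f lam + g lam :=
  Asymptotics.SuperpolynomialDecay.add hf hg

theorem Negligible.const_mul {f : ℕ → ℝ} (hf : Negligible f) (c : ℝ) :
    Negligible fun lam => c * f lam :=
  Asymptotics.SuperpolynomialDecay.const_mul hf c

theorem Negligible.polyBounded_mul {f : ℕ → ℝ} (hf : Negligible f) {q : ℕ → ℕ}
    (hq : PolyBounded q) : Negligible fun lam => (q lam : ℝ) * f lam := by
  obtain ⟨p, hp⟩ := hq
  have h1 : Negligible fun lam => (p.map (Nat.castRingHom ℝ)).eval (lam : ℝ) * f lam :=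
    Asymptotics.SuperpolynomialDecay.polynomial_mul hf _
  refine Asymptotics.SuperpolynomialDecay.trans_abs_le h1 fun lam => ?_
  have h2 : (p.map (Nat.castRingHom ℝ)).eval (lam : ℝ) = ((p.eval lam : ℕ) : ℝ) := by
    simp
  rw [abs_mul, abs_mul, h2, Nat.abs_cast, Nat.abs_cast]
  gcongr
  exact hp lam

/-- Decay of the root against `lam ^ z` is decay of `f` against `lam ^ (2 * z)`. It is needed
because the loss in the security proof is of order `2^(-k/2)`. -/
theorem Negligible.sqrt {f : ℕ → ℝ} (hf : Negligible f) : Negligible fun lam => √(f lam) := by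
  intro z
  have h := (hf (2 * z)).sqrt
  rw [Real.sqrt_zero] at h
  refine h.congr fun lam => ?_
  rw [Real.sqrt_mul (by positivity), mul_comm 2 z, pow_mul, Real.sqrt_sq (by positivity)]

theorem PolyBounded.of_le {f g : ℕ → ℕ} (hg : PolyBounded g) (h : ∀ lam, f lam ≤ g lam) :
    PolyBounded f := by
  obtain ⟨p, hp⟩ := hg
  exact ⟨p, fun lam => (h lam).trans (hp lam)⟩

theorem PolyBounded.add {f g : ℕ → ℕ} (hf : PolyBounded f) (hg : PolyBounded g) :
    PolyBounded fun lam => f lam + g lam := by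
  obtain ⟨p, hp⟩ := hf
  obtain ⟨p', hp'⟩ := hg
  refine ⟨p + p', fun lam => ?_⟩
  rw [Polynomial.eval_add]
  exact add_le_add (hp lam) (hp' lam)

theorem polyBounded_const (c : ℕ) : PolyBounded fun _ => c :=
  ⟨Polynomial.C c, fun lam => by simp⟩

theorem PolyBounded.const_mul {f : ℕ → ℕ} (c : ℕ) (hf : PolyBounded f) :
    PolyBounded fun lam => c * f lam := by
  obtain ⟨p, hp⟩ := hf
  refine ⟨Polynomial.C c * p, fun lam => ?_⟩
  rw [Polynomial.eval_mul, Polynomial.eval_C]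
  exact Nat.mul_le_mul_left c (hp lam)

theorem PolyBounded.max {f g : ℕ → ℕ} (hf : PolyBounded f) (hg : PolyBounded g) :
    PolyBounded fun lam => Max.max (f lam) (g lam) :=
  (hf.add hg).of_le fun _ => max_le (Nat.le_add_right _ _) (Nat.le_add_left _ _)

/-! ### Calculus of channels -/

namespace Kraus

variable {A B C D A' B' : Type}

/-- The matrix elements of the map defined by a family of Kraus operators. Families with the same
matrix elements define the same map. -/
def choi (K : Kraus A B) (a c : A) (b d : B) : ℂ :=
  ∑ i, K.op i b a * star (K.op i d c)

theorem apply_apply [Fintype A] (K : Kraus A B) (ρ : Matrix A A ℂ) (b d : B) :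
    K.apply ρ b d = ∑ a, ∑ c, ρ a c * K.choi a c b d := by
  simp only [apply, Matrix.sum_apply, Matrix.mul_apply, Matrix.conjTranspose_apply, choi,
    Finset.mul_sum, Finset.sum_mul]
  rw [← Finset.sum_comm_cycle, Finset.sum_comm]
  refine Finset.sum_congr rfl fun a _ => Finset.sum_congr rfl fun c _ =>
    Finset.sum_congr rfl fun i _ => ?_
  ring

/-- Kraus families of the same map need not even have the same index type. Identities between
algorithms are therefore proved for `choi` and transferred to states here. -/
theorem apply_congr [Fintype A] {K L : Kraus A B} (h : K.choi = L.choi) (ρ : Matrix A A ℂ) :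
    K.apply ρ = L.apply ρ := by
  ext b d
  simp only [apply_apply, h]

theorem apply_comp [Fintype A] [Fintype B] (L : Kraus B C) (K : Kraus A B) (ρ : Matrix A A ℂ) :
    (L.comp K).apply ρ = L.apply (K.apply ρ) := by
  change ∑ i : L.ι × K.ι, L.op i.1 * K.op i.2 * ρ * (L.op i.1 * K.op i.2)ᴴ = _
  simp only [apply, Fintype.sum_prod_type, Matrix.conjTranspose_mul, Matrix.mul_sum,
    Matrix.sum_mul, Matrix.mul_assoc]

theorem apply_add [Fintype A] (K : Kraus A B) (ρ σ : Matrix A A ℂ) :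
    K.apply (ρ + σ) = K.apply ρ + K.apply σ := by
  simp only [apply, Matrix.mul_add, Matrix.add_mul, Finset.sum_add_distrib]

theorem apply_smul [Fintype A] (K : Kraus A B) (r : ℂ) (ρ : Matrix A A ℂ) :
    K.apply (r • ρ) = r • K.apply ρ := by
  simp only [apply, Matrix.mul_smul, Matrix.smul_mul, Finset.smul_sum]

theorem apply_posSemidef [Fintype A] [Fintype B] (K : Kraus A B) {ρ : Matrix A A ℂ}
    (hρ : ρ.PosSemidef) : (K.apply ρ).PosSemidef :=
  Matrix.posSemidef_sum _ fun i _ => hρ.mul_mul_conjTranspose_same (K.op i)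

theorem isChannel_iff [DecidableEq A] [Fintype B] {K : Kraus A B} :
    K.IsChannel ↔ ∀ a c, ∑ b, K.choi a c b b = if a = c then 1 else 0 := by
  unfold IsChannel
  rw [← Matrix.ext_iff, forall_comm]
  refine forall₂_congr fun a c => ?_
  simp only [Matrix.sum_apply, Matrix.mul_apply, Matrix.conjTranspose_apply, Matrix.one_apply,
    choi]
  rw [Finset.sum_comm]
  simp only [mul_comm, eq_comm (a := a)]

theorem IsChannel.congr [DecidableEq A] [Fintype B] {K L : Kraus A B} (hK : K.IsChannel)
    (h : L.choi = K.choi) : L.IsChannel := by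
  rw [isChannel_iff] at hK ⊢
  rwa [h]

theorem IsChannel.trace_apply [Fintype A] [DecidableEq A] [Fintype B] {K : Kraus A B}
    (hK : K.IsChannel) (ρ : Matrix A A ℂ) : (K.apply ρ).trace = ρ.trace := by
  rw [isChannel_iff] at hK
  simp only [Matrix.trace, Matrix.diag_apply, apply_apply]
  rw [Finset.sum_comm]
  refine Finset.sum_congr rfl fun a _ => ?_
  rw [Finset.sum_comm]
  simp only [← Finset.mul_sum, hK]
  simp

theorem IsChannel.isState [Fintype A] [DecidableEq A] [Fintype B] {K : Kraus A B}
    (hK : K.IsChannel) {ρ : Matrix A A ℂ} (hρ : IsState ρ) : IsState (K.apply ρ) :=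
  ⟨K.apply_posSemidef hρ.1, (hK.trace_apply ρ).trans hρ.2⟩

theorem choi_comp [Fintype B] (L : Kraus B C) (K : Kraus A B) (a c : A) (b d : C) :
    (L.comp K).choi a c b d = ∑ x, ∑ y, K.choi a c x y * L.choi x y b d := by
  change ∑ i : L.ι × K.ι, (L.op i.1 * K.op i.2) b a * star ((L.op i.1 * K.op i.2) d c) = _
  simp only [choi, Fintype.sum_prod_type, Matrix.mul_apply, star_sum, star_mul',
    Finset.sum_mul_sum]
  rw [Finset.sum_congr rfl fun _ _ => Finset.sum_comm, Finset.sum_comm]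
  refine Finset.sum_congr rfl fun x _ => ?_
  rw [Finset.sum_congr rfl fun _ _ => Finset.sum_comm, Finset.sum_comm]
  refine Finset.sum_congr rfl fun y _ => ?_
  rw [Finset.sum_comm]
  refine Finset.sum_congr rfl fun i _ => Finset.sum_congr rfl fun j _ => ?_
  ring

theorem choi_prod (K : Kraus A B) (L : Kraus A' B') (a c : A × A') (b d : B × B') :
    (K.prod L).choi a c b d = K.choi a.1 c.1 b.1 d.1 * L.choi a.2 c.2 b.2 d.2 := by
  change ∑ i : K.ι × L.ι, K.op i.1 b.1 a.1 * L.op i.2 b.2 a.2 *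
    star (K.op i.1 d.1 c.1 * L.op i.2 d.2 c.2) = _
  simp only [choi, Fintype.sum_prod_type, star_mul', Finset.sum_mul_sum]
  refine Finset.sum_congr rfl fun i _ => Finset.sum_congr rfl fun j _ => ?_
  ring

theorem choi_pi {n : ℕ} {A B : Fin n → Type} (K : ∀ i, Kraus (A i) (B i)) (a c : ∀ i, A i)
    (b d : ∀ i, B i) : (Kraus.pi K).choi a c b d = ∏ i, (K i).choi (a i) (c i) (b i) (d i) := by
  change ∑ i : ∀ j, (K j).ι, (∏ j, (K j).op (i j) (b j) (a j)) *
    star (∏ j, (K j).op (i j) (d j) (c j)) = _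
  simp only [choi, Finset.prod_univ_sum, Fintype.piFinset_univ, star_prod,
    Finset.prod_mul_distrib]

theorem choi_comp_congr [Fintype B] {L L' : Kraus B C} {K K' : Kraus A B} (hL : L.choi = L'.choi)
    (hK : K.choi = K'.choi) : (L.comp K).choi = (L'.comp K').choi := by
  funext a c b d
  simp only [choi_comp, hL, hK]

theorem choi_prod_congr {K K' : Kraus A B} {L L' : Kraus A' B'} (hK : K.choi = K'.choi)
    (hL : L.choi = L'.choi) : (K.prod L).choi = (K'.prod L').choi := by
  funext a c b d
  simp only [choi_prod, hL, hK]

theorem choi_comp_assoc [Fintype B] [Fintype C] (M : Kraus C D) (L : Kraus B C) (K : Kraus A B) :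
    ((M.comp L).comp K).choi = (M.comp (L.comp K)).choi := by
  funext a c b d
  change ∑ i : (M.ι × L.ι) × K.ι, (M.op i.1.1 * L.op i.1.2 * K.op i.2) b a *
      star ((M.op i.1.1 * L.op i.1.2 * K.op i.2) d c) =
    ∑ i : M.ι × L.ι × K.ι, (M.op i.1 * (L.op i.2.1 * K.op i.2.2)) b a *
      star ((M.op i.1 * (L.op i.2.1 * K.op i.2.2)) d c)
  rw [← Equiv.sum_comp (Equiv.prodAssoc M.ι L.ι K.ι)]
  simp [Matrix.mul_assoc]

theorem choi_prod_comp [Fintype B] [Fintype B'] {C' : Type} (L : Kraus B C) (K : Kraus A B)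
    (L' : Kraus B' C') (K' : Kraus A' B') :
    ((L.comp K).prod (L'.comp K')).choi = ((L.prod L').comp (K.prod K')).choi := by
  funext a c b d
  simp only [choi_prod, choi_comp, Fintype.sum_prod_type, Finset.sum_mul_sum]
  refine Finset.sum_congr rfl fun x _ => Finset.sum_congr rfl fun x' _ => ?_
  refine Finset.sum_congr rfl fun y _ => Finset.sum_congr rfl fun y' _ => ?_
  ring

theorem IsChannel.comp [DecidableEq A] [DecidableEq B] [Fintype B] [Fintype C] {L : Kraus B C}
    {K : Kraus A B} (hL : L.IsChannel) (hK : K.IsChannel) : (L.comp K).IsChannel := by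
  rw [isChannel_iff] at *
  intro a c
  simp only [choi_comp]
  rw [Finset.sum_comm]
  rw [← hK]
  refine Finset.sum_congr rfl fun x _ => ?_
  rw [Finset.sum_comm]
  simp [← Finset.mul_sum, hL]

theorem IsChannel.prod [DecidableEq A] [Fintype B] [DecidableEq A'] [Fintype B'] {K : Kraus A B}
    {L : Kraus A' B'} (hK : K.IsChannel) (hL : L.IsChannel) : (K.prod L).IsChannel := by
  rw [isChannel_iff] at *
  intro a c
  simp only [choi_prod, Fintype.sum_prod_type, ← Finset.mul_sum, ← Finset.sum_mul, hK, hL,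
    Prod.ext_iff]
  split_ifs <;> simp_all

/-- The map that sends the basis state `u` to the basis state `f u` and discards `t u`. -/
def ofFunDiscard {T : Type} [Fintype T] [DecidableEq T] [DecidableEq B] (f : A → B) (t : A → T) :
    Kraus A B where
  ι := T
  op s := Matrix.of fun v u => if v = f u ∧ t u = s then 1 else 0

theorem choi_ofFunDiscard {T : Type} [Fintype T] [DecidableEq T] [DecidableEq B] (f : A → B)
    (t : A → T) (a c : A) (b d : B) : (ofFunDiscard f t).choi a c b d =
      if b = f a ∧ d = f c ∧ t a = t c then 1 else 0 := by
  unfold choi ofFunDiscard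
  simp only [Matrix.of_apply]
  rw [Finset.sum_eq_single (t a)]
  · by_cases h1 : b = f a <;> by_cases h2 : d = f c <;> by_cases h3 : t a = t c <;>
      simp [h1, h2, h3, eq_comm]
  · intro s _ hs
    simp [hs.symm]
  · simp

/-- Kept and discarded data together determine the basis state, so this is an isometry followed by a
partial trace. -/
theorem ofFunDiscard_isChannel {T : Type} [Fintype T] [DecidableEq T] [DecidableEq A]
    [DecidableEq B] [Fintype B] {f : A → B} {t : A → T}
    (h : ∀ a c, f a = f c → t a = t c → a = c) : (ofFunDiscard f t).IsChannel := by
  rw [isChannel_iff]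
  intro a c
  simp only [choi_ofFunDiscard]
  rw [Finset.sum_eq_single (f a)]
  · refine if_congr ⟨fun hh => h a c hh.2.1 hh.2.2, ?_⟩ rfl rfl
    rintro rfl
    simp
  · intro b _ hb
    simp [hb]
  · simp

/-- The map that sends the basis state `u` to the basis state `f u`. -/
def ofFun [DecidableEq B] (f : A → B) : Kraus A B where
  ι := Unit
  op _ := Matrix.of fun v u => if v = f u then 1 else 0

theorem choi_ofFun [DecidableEq B] (f : A → B) (a c : A) (b d : B) :
    (ofFun f).choi a c b d = if b = f a ∧ d = f c then 1 else 0 := by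
  change ∑ _i : Unit, (if b = f a then (1 : ℂ) else 0) * star (if d = f c then 1 else 0) = _
  by_cases h1 : b = f a <;> by_cases h2 : d = f c <;> simp [h1, h2]

theorem ofFun_isChannel [DecidableEq A] [DecidableEq B] [Fintype B] {f : A → B}
    (hf : f.Injective) : (ofFun f).IsChannel := by
  rw [isChannel_iff]
  intro a c
  simp only [choi_ofFun]
  rw [Finset.sum_eq_single (f a)]
  · simp [hf.eq_iff]
  · intro b _ hb
    simp [hb]
  · simp

theorem choi_comp_ofFun [DecidableEq B] [Fintype B] (L : Kraus B C) (f : A → B) (a c : A)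
    (b d : C) : (L.comp (ofFun f)).choi a c b d = L.choi (f a) (f c) b d := by
  rw [choi_comp, Finset.sum_eq_single (f a), Finset.sum_eq_single (f c)]
  · simp [choi_ofFun]
  · intro y _ hy
    simp [choi_ofFun, hy]
  · simp
  · intro x _ hx
    simp [choi_ofFun, hx]
  · simp

theorem choi_ofFun_comp [DecidableEq C] [Fintype B] (e : B ≃ C) (K : Kraus A B) (a c : A)
    (b d : C) : ((ofFun e).comp K).choi a c b d = K.choi a c (e.symm b) (e.symm d) := by
  rw [choi_comp, Finset.sum_eq_single (e.symm b), Finset.sum_eq_single (e.symm d)]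
  · simp [choi_ofFun]
  · intro y _ hy
    have : d ≠ e y := fun h => hy (by simp [h])
    simp [choi_ofFun, this]
  · simp
  · intro x _ hx
    have : b ≠ e x := fun h => hx (by simp [h])
    simp [choi_ofFun, this]
  · simp

/-- Renaming the basis states of the input and of the output. -/
def reindex (K : Kraus A B) (f : A' → A) (g : B' → B) : Kraus A' B' where
  ι := K.ι
  op i := (K.op i).submatrix g f

theorem choi_reindex (K : Kraus A B) (f : A' → A) (g : B' → B) (a c : A') (b d : B') :
    (K.reindex f g).choi a c b d = K.choi (f a) (f c) (g b) (g d) := rfl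

theorem choi_ofFun_id_comp [DecidableEq B] [Fintype B] (K : Kraus A B) :
    ((ofFun (id : B → B)).comp K).choi = K.choi := by
  funext a c b d
  exact choi_ofFun_comp (Equiv.refl B) K a c b d

theorem choi_comp_ofFun_id [DecidableEq A] [Fintype A] (K : Kraus A B) :
    (K.comp (ofFun (id : A → A))).choi = K.choi := by
  funext a c b d
  exact choi_comp_ofFun K id a c b d

/-- A map between two registers, made into a map from a space that contains both of them to
itself; the orthogonal complement of the first register is left alone. -/
def extend [Fintype A] [Fintype B] [DecidableEq C] (f : A → C) (g : B → C) (K : Kraus A B) :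
    Kraus C C where
  ι := Option K.ι
  op
    | some i => (ofFun g).op () * K.op i * ((ofFun f).op ())ᴴ
    | none => 1 - (ofFun f).op () * ((ofFun f).op ())ᴴ

theorem ofFun_conjTranspose_mul_self [DecidableEq A] [DecidableEq B] [Fintype B] {f : A → B}
    (hf : f.Injective) : ((ofFun f).op ())ᴴ * (ofFun f).op () = 1 := by
  have h := ofFun_isChannel hf
  unfold IsChannel at h
  rw [← h]
  exact (Fintype.sum_unique fun i : Unit => ((ofFun f).op i)ᴴ * (ofFun f).op i).symm

/-- For the isometries `V`, `W` given by `f`, `g`, the operators `W Kᵢ Vᴴ` contribute the projector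
`V Vᴴ` to the sum, and the extra operator `1 - V Vᴴ` supplies its complement. -/
theorem extend_isChannel [Fintype A] [Fintype B] [DecidableEq A] [DecidableEq B] [DecidableEq C]
    [Fintype C] {f : A → C} {g : B → C} (hf : f.Injective) (hg : g.Injective) {K : Kraus A B}
    (hK : K.IsChannel) : (extend f g K).IsChannel := by
  have h1 := ofFun_conjTranspose_mul_self hf
  have h2 := ofFun_conjTranspose_mul_self hg
  unfold IsChannel at hK ⊢
  change ∑ i : Option K.ι, ((extend f g K).op i)ᴴ * (extend f g K).op i = 1
  rw [Fintype.sum_option]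
  simp only [extend]
  set V := (ofFun f).op ()
  set W := (ofFun g).op ()
  have h3 : ∀ i, (W * K.op i * Vᴴ)ᴴ * (W * K.op i * Vᴴ) = V * ((K.op i)ᴴ * K.op i) * Vᴴ := by
    intro i
    calc _ = V * ((K.op i)ᴴ * (Wᴴ * W) * K.op i) * Vᴴ := by
          simp only [Matrix.conjTranspose_mul, Matrix.conjTranspose_conjTranspose,
            Matrix.mul_assoc]
      _ = _ := by rw [h2, Matrix.mul_one]
  simp only [h3, ← Matrix.mul_sum, ← Matrix.sum_mul, hK, Matrix.mul_one]
  have h4 : (V * Vᴴ) * (V * Vᴴ) = V * Vᴴ := by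
    rw [Matrix.mul_assoc, ← Matrix.mul_assoc Vᴴ, h1, Matrix.one_mul]
  simp only [Matrix.conjTranspose_sub, Matrix.conjTranspose_one, Matrix.conjTranspose_mul,
    Matrix.conjTranspose_conjTranspose, Matrix.sub_mul, Matrix.mul_sub, Matrix.one_mul,
    Matrix.mul_one, h4]
  abel

/-- The extra operator `1 - V Vᴴ` annihilates the range of `V`. -/
theorem choi_extend_comp_ofFun [Fintype A] [Fintype B] [DecidableEq A] [DecidableEq C]
    [Fintype C] {f : A → C} (g : B → C) (hf : f.Injective) (K : Kraus A B) :
    ((extend f g K).comp (ofFun f)).choi = ((ofFun g).comp K).choi := by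
  have h1 := ofFun_conjTranspose_mul_self hf
  funext a c b d
  change ∑ i : Option K.ι × Unit, ((extend f g K).op i.1 * (ofFun f).op i.2) b a *
      star (((extend f g K).op i.1 * (ofFun f).op i.2) d c) =
    ∑ i : Unit × K.ι, ((ofFun g).op i.1 * K.op i.2) b a * star (((ofFun g).op i.1 * K.op i.2) d c)
  simp only [Fintype.sum_prod_type, Fintype.sum_option, Fintype.sum_unique]
  simp only [extend, Matrix.mul_assoc, Matrix.sub_mul, h1]
  simp

end Kraus

theorem choi_queryKraus {a b : ℕ} (O : Oracle a b) (Z : Type) [DecidableEq Z] :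
    (queryKraus O Z).choi = (Kraus.ofFun fun u : BitStr a × BitStr b × Z =>
      (u.1, bxor u.2.1 (O u.1), u.2.2)).choi := rfl

theorem bxor_bxor_cancel {m : ℕ} (s t : BitStr m) : bxor (bxor s t) t = s := by
  funext j
  simp [bxor]

theorem bxor_right_injective {m : ℕ} (t : BitStr m) :
    Function.Injective fun s : BitStr m => bxor s t := fun s s' h => by
  simpa [bxor_bxor_cancel] using congrArg (bxor · t) h

theorem queryKraus_isChannel {a b : ℕ} (O : Oracle a b) (Z : Type) [Fintype Z] [DecidableEq Z] :
    (queryKraus O Z).IsChannel := by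
  refine Kraus.IsChannel.congr (Kraus.ofFun_isChannel ?_) (choi_queryKraus O Z)
  rintro ⟨x, y, z⟩ ⟨x', y', z'⟩ h
  simp only [Prod.mk.injEq] at h
  obtain ⟨rfl, h, rfl⟩ := h
  rw [bxor_right_injective _ h]

theorem OracleAlg.after_isChannel {a b : ℕ} {A B : Type} [Fintype A] [DecidableEq A] [Fintype B]
    (M : OracleAlg a b A B) (O : Oracle a b) (j : ℕ) : (M.after O j).IsChannel := by
  induction j with
  | zero => exact M.init_isChannel
  | succ j ih => exact (M.step_isChannel j).comp ((queryKraus_isChannel O M.Z).comp ih)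

theorem OracleAlg.run_isChannel {a b : ℕ} {A B : Type} [Fintype A] [DecidableEq A] [Fintype B]
    (M : OracleAlg a b A B) (O : Oracle a b) : (M.run O).IsChannel :=
  M.final_isChannel.comp (M.after_isChannel O _)

/-! ### Families of channels that are performed with a bounded number of queries -/

/-- The channels `F O` are performed with `q` queries to `O`. -/
def Realizes {a b : ℕ} {B : Type} [Fintype B] :
    ℕ → ∀ {A : Type} [Fintype A] [DecidableEq A], (Oracle a b → Kraus A B) → Prop
  | 0, A, _, _, F => ∃ K : Kraus A B, K.IsChannel ∧ ∀ O, (F O).choi = K.choi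
  | q + 1, A, _, _, F => ∃ (Z : Type) (_ : Fintype Z) (_ : DecidableEq Z)
      (K : Kraus A (BitStr a × BitStr b × Z))
      (F' : Oracle a b → Kraus (BitStr a × BitStr b × Z) B),
      K.IsChannel ∧ Realizes q F' ∧
        ∀ O, (F O).choi = ((F' O).comp ((queryKraus O Z).comp K)).choi

namespace Realizes

variable {a b : ℕ} {A B C A' B' : Type} [Fintype A] [DecidableEq A] [Fintype B]
  [Fintype C] [Fintype A'] [DecidableEq A'] [Fintype B']

theorem congr {q : ℕ} {F F' : Oracle a b → Kraus A B} (hF : Realizes q F)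
    (h : ∀ O, (F' O).choi = (F O).choi) : Realizes q F' := by
  cases q with
  | zero =>
    obtain ⟨K, hK, hF⟩ := hF
    exact ⟨K, hK, fun O => (h O).trans (hF O)⟩
  | succ q =>
    obtain ⟨Z, _, _, K, G, hK, hG, hF⟩ := hF
    exact ⟨Z, _, _, K, G, hK, hG, fun O => (h O).trans (hF O)⟩

theorem channel {K : Kraus A B} (hK : K.IsChannel) :
    Realizes 0 (fun _ : Oracle a b => K) := ⟨K, hK, fun _ => rfl⟩

theorem precomp [DecidableEq B] {q : ℕ} {F : Oracle a b → Kraus B C} (hF : Realizes q F)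
    {K₀ : Kraus A B}
    (hK₀ : K₀.IsChannel) : Realizes q fun O => (F O).comp K₀ := by
  cases q with
  | zero =>
    obtain ⟨K, hK, hF⟩ := hF
    exact ⟨K.comp K₀, hK.comp hK₀, fun O => Kraus.choi_comp_congr (hF O) rfl⟩
  | succ q =>
    obtain ⟨Z, _, _, K, G, hK, hG, hF⟩ := hF
    refine ⟨Z, _, _, K.comp K₀, G, hK.comp hK₀, hG, fun O => ?_⟩
    rw [Kraus.choi_comp_congr (hF O) rfl, Kraus.choi_comp_assoc,
      Kraus.choi_comp_congr rfl (Kraus.choi_comp_assoc _ _ _)]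

/-- The private register may be a different type at each query, which is what makes closure under
composition a plain induction. `OracleAlg`, with its one private register, has no such direct
induction. -/
theorem comp [DecidableEq B] {q q' : ℕ} {F' : Oracle a b → Kraus B C} (hF' : Realizes q' F')
    {F : Oracle a b → Kraus A B} (hF : Realizes q F) :
    Realizes (q' + q) fun O => (F' O).comp (F O) := by
  induction q generalizing A with
  | zero =>
    obtain ⟨K, hK, hF⟩ := hF
    exact (hF'.precomp hK).congr fun O => Kraus.choi_comp_congr rfl (hF O)
  | succ q ih =>
    obtain ⟨Z, _, _, K, G, hK, hG, hF⟩ := hF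
    refine ⟨Z, _, _, K, _, hK, ih hG, fun O => ?_⟩
    rw [Kraus.choi_comp_congr rfl (hF O), Kraus.choi_comp_assoc]

theorem query (Z : Type) [Fintype Z] [DecidableEq Z] :
    Realizes 1 fun O : Oracle a b => queryKraus O Z := by
  refine ⟨Z, _, _, Kraus.ofFun id, fun _ => Kraus.ofFun id,
    Kraus.ofFun_isChannel Function.injective_id,
    channel (Kraus.ofFun_isChannel Function.injective_id), fun O => ?_⟩
  rw [Kraus.choi_ofFun_id_comp, Kraus.choi_comp_ofFun_id]

theorem reindex [DecidableEq B] [DecidableEq B'] {q : ℕ} {F : Oracle a b → Kraus A B}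
    (hF : Realizes q F) (e : A' ≃ A)
    (e' : B' ≃ B) : Realizes q fun O => (F O).reindex e e' := by
  have h := (channel (a := a) (b := b) (Kraus.ofFun_isChannel e'.symm.injective)).comp
    (hF.precomp (Kraus.ofFun_isChannel e.injective))
  rw [zero_add] at h
  refine h.congr fun O => ?_
  funext u u' v v'
  rw [Kraus.choi_ofFun_comp, Kraus.choi_comp_ofFun, Kraus.choi_reindex]
  rfl

/-- The idle register `R` becomes a part of the private register; the permutation `e` moves it there
before each query and back afterwards. -/
theorem prod_right {q : ℕ} {F : Oracle a b → Kraus A B} (hF : Realizes q F) (R : Type)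
    [Fintype R] [DecidableEq R] :
    Realizes q fun O => (F O).prod (Kraus.ofFun (id : R → R)) := by
  have hid : (Kraus.ofFun (id : R → R)).IsChannel :=
    Kraus.ofFun_isChannel Function.injective_id
  induction q generalizing A with
  | zero =>
    obtain ⟨K, hK, hF⟩ := hF
    exact ⟨_, hK.prod hid, fun O => Kraus.choi_prod_congr (hF O) rfl⟩
  | succ q ih =>
    obtain ⟨Z, _, _, K, G, hK, hG, hF⟩ := hF
    let e : (BitStr a × BitStr b × Z) × R ≃ BitStr a × BitStr b × Z × R :=
      ⟨fun p => (p.1.1, p.1.2.1, p.1.2.2, p.2), fun p => ((p.1, p.2.1, p.2.2.1), p.2.2.2),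
        fun _ => rfl, fun _ => rfl⟩
    have he : (Kraus.ofFun e).IsChannel := Kraus.ofFun_isChannel e.injective
    have he' : (Kraus.ofFun e.symm).IsChannel := Kraus.ofFun_isChannel e.symm.injective
    refine ⟨Z × R, _, _, _, _, he.comp (hK.prod hid), (ih hG).precomp he', fun O => ?_⟩
    have h1 : ((queryKraus O Z).prod (Kraus.ofFun (id : R → R))).choi =
        ((Kraus.ofFun e.symm).comp ((queryKraus O (Z × R)).comp (Kraus.ofFun e))).choi := by
      funext u u' v v'
      rw [Kraus.choi_ofFun_comp, Kraus.choi_comp_ofFun, Kraus.choi_prod, choi_queryKraus,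
        choi_queryKraus, Kraus.choi_ofFun, Kraus.choi_ofFun, Kraus.choi_ofFun]
      simp only [e, Equiv.symm_symm, Equiv.coe_fn_mk, Prod.ext_iff, id,
        ← ite_and, mul_ite, mul_one, mul_zero]
      congr 1
      simp only [eq_iff_iff]
      tauto
    calc ((F O).prod (Kraus.ofFun (id : R → R))).choi
        = (((G O).comp ((queryKraus O Z).comp K)).prod
            ((Kraus.ofFun id).comp ((Kraus.ofFun id).comp (Kraus.ofFun (id : R → R))))).choi :=
          Kraus.choi_prod_congr (hF O) (by simp only [Kraus.choi_ofFun_id_comp])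
      _ = (((G O).prod (Kraus.ofFun id)).comp (((queryKraus O Z).prod
            (Kraus.ofFun (id : R → R))).comp (K.prod (Kraus.ofFun id)))).choi := by
          rw [Kraus.choi_prod_comp, Kraus.choi_comp_congr rfl (Kraus.choi_prod_comp _ _ _ _)]
      _ = (((G O).prod (Kraus.ofFun id)).comp (((Kraus.ofFun e.symm).comp
            ((queryKraus O (Z × R)).comp (Kraus.ofFun e))).comp
              (K.prod (Kraus.ofFun (id : R → R))))).choi :=
          Kraus.choi_comp_congr rfl (Kraus.choi_comp_congr h1 rfl)
      _ = _ := by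
          rw [Kraus.choi_comp_assoc]
          refine Kraus.choi_comp_congr rfl ?_
          rw [Kraus.choi_comp_assoc]
          refine Kraus.choi_comp_congr rfl ?_
          rw [Kraus.choi_comp_assoc]

/-- Parallel execution is sequential execution with each algorithm idle on the other's register, so
the query numbers add. -/
theorem prod [DecidableEq B'] {q q' : ℕ} {F : Oracle a b → Kraus A B} (hF : Realizes q F)
    {F' : Oracle a b → Kraus A' B'} (hF' : Realizes q' F') :
    Realizes (q + q') fun O => (F O).prod (F' O) := by
  have h1 := hF.prod_right B'
  have h2 := (hF'.prod_right A).reindex (Equiv.prodComm A A') (Equiv.prodComm A B')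
  refine (h1.comp h2).congr fun O => ?_
  calc ((F O).prod (F' O)).choi
      = (((F O).comp (Kraus.ofFun id)).prod ((Kraus.ofFun id).comp (F' O))).choi :=
        Kraus.choi_prod_congr (Kraus.choi_comp_ofFun_id _).symm (Kraus.choi_ofFun_id_comp _).symm
    _ = _ := by
        rw [Kraus.choi_prod_comp]
        refine Kraus.choi_comp_congr rfl ?_
        funext u u' v v'
        rw [Kraus.choi_reindex, Kraus.choi_prod, Kraus.choi_prod, mul_comm]
        rfl

theorem pi {n : ℕ} {A B : Fin n → Type} [∀ i, Fintype (A i)] [∀ i, DecidableEq (A i)]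
    [∀ i, Fintype (B i)] [∀ i, DecidableEq (B i)] {q : Fin n → ℕ}
    {F : ∀ i, Oracle a b → Kraus (A i) (B i)} (hF : ∀ i, Realizes (q i) (F i)) :
    Realizes (∑ i, q i) fun O => Kraus.pi fun i => F i O := by
  induction n with
  | zero =>
    refine ⟨Kraus.ofFun fun _ => finZeroElim, Kraus.ofFun_isChannel fun u v _ =>
      Subsingleton.elim u v, fun O => ?_⟩
    funext u u' v v'
    rw [Kraus.choi_pi, Kraus.choi_ofFun, if_pos ⟨Subsingleton.elim _ _, Subsingleton.elim _ _⟩]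
    simp
  | succ n ih =>
    have h := ((hF 0).prod (ih fun i => hF i.succ)).reindex (Fin.consEquiv A).symm
      (Fin.consEquiv B).symm
    rw [Fin.sum_univ_succ]
    refine h.congr fun O => ?_
    funext u u' v v'
    rw [Kraus.choi_reindex, Kraus.choi_prod, Kraus.choi_pi, Kraus.choi_pi, Fin.prod_univ_succ]
    rfl

end Realizes

/-! ### Passage between query algorithms and realizable families, and simulation of oracles -/

section Algorithms

variable {a b : ℕ} {A B C : Type} [Fintype A] [DecidableEq A] [Fintype B] [Fintype C]

/-- `after` grows at the last query while `Realizes` unfolds from the first one, so the induction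
hands the queries of `M` to `F` one by one, starting at the end. -/
theorem Realizes.comp_after (M : OracleAlg a b A B) {q : ℕ}
    {F : Oracle a b → Kraus (BitStr a × BitStr b × M.Z) C} (hF : Realizes q F) (j : ℕ) :
    Realizes (q + j) fun O => (F O).comp (M.after O j) := by
  induction j generalizing q F with
  | zero => exact hF.precomp M.init_isChannel
  | succ j ih =>
    have h := ih ((hF.precomp (M.step_isChannel j)).comp (Realizes.query M.Z))
    rw [add_assoc, add_comm 1 j] at h
    refine h.congr fun O => ?_
    rw [Kraus.choi_comp_assoc, Kraus.choi_comp_assoc]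
    rfl

theorem OracleAlg.realizes_run (M : OracleAlg a b A B) : Realizes M.queries M.run := by
  have h := Realizes.comp_after M (Realizes.channel M.final_isChannel) M.queries
  rw [zero_add] at h
  exact h

/-- A query to an oracle whose values are computed from those of another oracle takes two queries
to the latter. -/
theorem Realizes.query_simulate {a' b' : ℕ} (φ : BitStr a' → BitStr a)
    (f : BitStr a' → BitStr b → BitStr b') (Z : Type) [Fintype Z] [DecidableEq Z] :
    Realizes 2 fun O : Oracle a b => queryKraus (fun x => f x (O (φ x))) Z := by
  let _ : DecidableEq (BitStr a' × BitStr b' × Z) := inferInstance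
  let f₁ : BitStr a' × BitStr b' × Z → BitStr a × BitStr b × BitStr a' × BitStr b' × Z :=
    fun u => (φ u.1, fun _ => false, u)
  let f₂ : BitStr a × BitStr b × BitStr a' × BitStr b' × Z →
      BitStr a × BitStr b × BitStr a' × BitStr b' × Z := fun u =>
    (u.1, u.2.1, u.2.2.1, bxor u.2.2.2.1 (f u.2.2.1 u.2.1), u.2.2.2.2)
  let f₃ : BitStr a × BitStr b × BitStr a' × BitStr b' × Z → BitStr a' × BitStr b' × Z :=
    fun u => u.2.2
  -- When the work registers are discarded, the first one holds `φ x` and the second one `0`.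
  -- Discarding the former relative to `φ x` makes the discarded value constant, so no coherence
  -- between different `x` is lost.
  let t₃ : BitStr a × BitStr b × BitStr a' × BitStr b' × Z → BitStr a × BitStr b := fun u =>
    (bxor u.1 (φ u.2.2.1), u.2.1)
  have h₁ : (Kraus.ofFun f₁).IsChannel := Kraus.ofFun_isChannel fun u v h => by
    simpa [f₁] using congrArg (fun p => p.2.2) h
  have h₂ : (Kraus.ofFun f₂).IsChannel := Kraus.ofFun_isChannel (by
    rintro ⟨x, g, X, Y, z⟩ ⟨x', g', X', Y', z'⟩ h
    simp only [f₂, Prod.mk.injEq] at h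
    obtain ⟨rfl, rfl, rfl, h, rfl⟩ := h
    rw [bxor_right_injective _ h])
  have h₃ : (Kraus.ofFunDiscard f₃ t₃).IsChannel := Kraus.ofFunDiscard_isChannel (by
    rintro ⟨x, g, s⟩ ⟨x', g', s'⟩ h h'
    simp only [f₃, t₃, Prod.mk.injEq] at h h'
    obtain rfl := h
    obtain ⟨h', rfl⟩ := h'
    rw [bxor_right_injective _ h'])
  have hq : Realizes 1 fun O : Oracle a b => queryKraus O (BitStr a' × BitStr b' × Z) :=
    Realizes.query _
  -- Fetch the oracle value, add `f` of it to the answer register, and uncompute the oracle value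
  -- with a second query.
  have hfin := ((((Realizes.channel (a := a) (b := b) h₃).comp hq).comp
    (Realizes.channel h₂)).comp hq).comp (Realizes.channel h₁)
  refine hfin.congr fun O => ?_
  funext u u' v v'
  rw [Kraus.choi_comp_ofFun, Kraus.choi_comp_congr rfl (choi_queryKraus O _),
    Kraus.choi_comp_ofFun, Kraus.choi_comp_ofFun,
    Kraus.choi_comp_congr rfl (choi_queryKraus O _), Kraus.choi_comp_ofFun,
    Kraus.choi_ofFunDiscard, choi_queryKraus, Kraus.choi_ofFun]
  have hx : ∀ g : BitStr b, bxor (fun _ => false) g = g := fun g => by funext j; simp [bxor]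
  have hs : ∀ {m : ℕ} (g : BitStr m), bxor g g = fun _ => false := fun g => by
    funext j; simp [bxor]
  simp [f₁, f₂, f₃, t₃, hx, hs]

theorem Realizes.simulate {a' b' : ℕ} (φ : BitStr a' → BitStr a)
    (f : BitStr a' → BitStr b → BitStr b') {q : ℕ} {F : Oracle a' b' → Kraus A B}
    (hF : Realizes q F) :
    Realizes (2 * q) fun O : Oracle a b => F fun x => f x (O (φ x)) := by
  induction q generalizing A with
  | zero =>
    obtain ⟨K, hK, hF⟩ := hF
    exact ⟨K, hK, fun O => hF _⟩
  | succ q ih =>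
    obtain ⟨Z, _, _, K, G, hK, hG, hF⟩ := hF
    exact ((ih hG).comp ((Realizes.query_simulate φ f Z).precomp hK)).congr fun O => hF _

/-- An algorithm that applies a channel, makes a query and goes on as another algorithm does. -/
def OracleAlg.cons {Z : Type} [Fintype Z] [DecidableEq Z]
    (K : Kraus A (BitStr a × BitStr b × Z)) (hK : K.IsChannel)
    (M : OracleAlg a b (BitStr a × BitStr b × Z) B) : OracleAlg a b A B where
  Z := Z ⊕ M.Z
  queries := M.queries + 1
  init := (Kraus.ofFun fun u => (u.1, u.2.1, Sum.inl u.2.2)).comp K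
  step
    -- The left summand of the private register is in use only up to the first query. Step `0` runs
    -- `M.init` and moves to the right summand, where the steps of `M` follow with their index
    -- shifted by one.
    | 0 => Kraus.extend (fun u => (u.1, u.2.1, Sum.inl u.2.2))
        (fun u => (u.1, u.2.1, Sum.inr u.2.2)) M.init
    | j + 1 => Kraus.extend (fun u => (u.1, u.2.1, Sum.inr u.2.2))
        (fun u => (u.1, u.2.1, Sum.inr u.2.2)) (M.step j)
  -- At the end of a run the private register is in the right summand. The operators on the left
  -- summand only make the map a channel on the whole space.
  final :=
    { ι := (M.final.comp M.init).ι ⊕ M.final.ι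
      op := Sum.elim
        (fun i => Matrix.of fun v u =>
          match u with
          | (x, y, .inl z) => (M.final.comp M.init).op i v (x, y, z)
          | (_, _, .inr _) => 0)
        (fun i => Matrix.of fun v u =>
          match u with
          | (_, _, .inl _) => 0
          | (x, y, .inr z) => M.final.op i v (x, y, z)) }
  init_isChannel := (Kraus.ofFun_isChannel (by
    rintro ⟨x, y, z⟩ ⟨x', y', z'⟩ h
    simpa using h)).comp hK
  step_isChannel j := by
    cases j <;>
    · refine Kraus.extend_isChannel ?_ ?_ (by first | exact M.init_isChannel |
        exact M.step_isChannel _) <;>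
      · rintro ⟨x, y, z⟩ ⟨x', y', z'⟩ h
        simpa using h
  final_isChannel := by
    have h1 := Kraus.isChannel_iff.mp (M.final_isChannel.comp M.init_isChannel)
    have h2 := Kraus.isChannel_iff.mp M.final_isChannel
    refine Kraus.isChannel_iff.mpr ?_
    rintro ⟨x, y, z | z⟩ ⟨x', y', z' | z'⟩
    · simpa [Kraus.choi] using h1 (x, y, z) (x', y', z')
    · simp [Kraus.choi]
    · simp [Kraus.choi]
    · simpa [Kraus.choi] using h2 (x, y, z) (x', y', z')

end Algorithms

section Algorithms

variable {a b : ℕ} {A B C : Type} [Fintype A] [DecidableEq A] [Fintype B]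

theorem choi_queryKraus_comp_map (O : Oracle a b) {Z Z' : Type} [Fintype Z] [DecidableEq Z]
    [Fintype Z'] [DecidableEq Z'] (h : Z → Z') :
    ((queryKraus O Z').comp (Kraus.ofFun fun u : BitStr a × BitStr b × Z =>
      (u.1, u.2.1, h u.2.2))).choi =
    ((Kraus.ofFun fun u : BitStr a × BitStr b × Z => (u.1, u.2.1, h u.2.2)).comp
      (queryKraus O Z)).choi := by
  rw [Kraus.choi_comp_congr rfl (choi_queryKraus O Z)]
  funext u u' v v'
  rw [Kraus.choi_comp_ofFun, Kraus.choi_comp_ofFun, choi_queryKraus, Kraus.choi_ofFun,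
    Kraus.choi_ofFun]

/-- A query does not touch the private register, so the embedding by `h` slides past it and meets
`extend`, which then acts as `L`. -/
theorem choi_extend_query (O : Oracle a b) {Z Z' Y D : Type} [Fintype Z] [DecidableEq Z]
    [Fintype Z'] [DecidableEq Z'] [Fintype Y] {h : Z → Y} (h' : Z' → Y) [DecidableEq Y]
    (hh : h.Injective) (L : Kraus (BitStr a × BitStr b × Z) (BitStr a × BitStr b × Z'))
    (K : Kraus D (BitStr a × BitStr b × Z)) :
    ((Kraus.extend (fun u => (u.1, u.2.1, h u.2.2)) (fun u => (u.1, u.2.1, h' u.2.2)) L).comp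
      ((queryKraus O Y).comp ((Kraus.ofFun fun u => (u.1, u.2.1, h u.2.2)).comp K))).choi =
    ((Kraus.ofFun fun u => (u.1, u.2.1, h' u.2.2)).comp
      (L.comp ((queryKraus O Z).comp K))).choi := by
  have hl : Function.Injective fun u : BitStr a × BitStr b × Z => (u.1, u.2.1, h u.2.2) := by
    rintro ⟨x, y, z⟩ ⟨x', y', z'⟩ h
    simpa [hh.eq_iff] using h
  rw [Kraus.choi_comp_congr rfl (Kraus.choi_comp_assoc _ _ _).symm,
    Kraus.choi_comp_congr rfl (Kraus.choi_comp_congr (choi_queryKraus_comp_map O _) rfl),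
    Kraus.choi_comp_congr rfl (Kraus.choi_comp_assoc _ _ _), ← Kraus.choi_comp_assoc,
    Kraus.choi_comp_congr (Kraus.choi_extend_comp_ofFun _ hl L) rfl, Kraus.choi_comp_assoc]

theorem OracleAlg.choi_cons_after {Z : Type} [Fintype Z] [DecidableEq Z]
    (K : Kraus A (BitStr a × BitStr b × Z)) (hK : K.IsChannel)
    (M : OracleAlg a b (BitStr a × BitStr b × Z) B) (O : Oracle a b) (j : ℕ) :
    ((OracleAlg.cons K hK M).after O (j + 1)).choi =
      ((Kraus.ofFun fun u : BitStr a × BitStr b × M.Z =>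
        (u.1, u.2.1, (Sum.inr u.2.2 : Z ⊕ M.Z))).comp
          ((M.after O j).comp ((queryKraus O Z).comp K))).choi := by
  induction j with
  | zero => exact choi_extend_query O Sum.inr Sum.inl_injective M.init K
  | succ j ih =>
    refine (Kraus.choi_comp_congr rfl (Kraus.choi_comp_congr rfl ih)).trans ?_
    refine (choi_extend_query O Sum.inr Sum.inr_injective (M.step j) _).trans ?_
    refine Kraus.choi_comp_congr rfl ?_
    refine Eq.trans ?_ (Kraus.choi_comp_assoc _ _ _).symm
    exact Kraus.choi_comp_congr rfl (Kraus.choi_comp_assoc _ _ _).symm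

theorem OracleAlg.choi_cons_run {Z : Type} [Fintype Z] [DecidableEq Z]
    (K : Kraus A (BitStr a × BitStr b × Z)) (hK : K.IsChannel)
    (M : OracleAlg a b (BitStr a × BitStr b × Z) B) (O : Oracle a b) :
    ((OracleAlg.cons K hK M).run O).choi =
      ((M.run O).comp ((queryKraus O Z).comp K)).choi := by
  refine (Kraus.choi_comp_congr (L := (OracleAlg.cons K hK M).final) rfl
    (OracleAlg.choi_cons_after K hK M O M.queries)).trans ?_
  refine (Kraus.choi_comp_assoc _ _ _).symm.trans ?_
  refine Eq.trans ?_ (Kraus.choi_comp_assoc _ _ _).symm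
  refine Kraus.choi_comp_congr ?_ rfl
  funext u u' v v'
  refine (Kraus.choi_comp_ofFun _ _ _ _ _ _).trans ?_
  refine (Fintype.sum_sum_type _).trans ?_
  simp [Kraus.choi, OracleAlg.cons]

/-- An algorithm that makes no query. -/
def OracleAlg.ofChannel (a b : ℕ) (K : Kraus A B) (hK : K.IsChannel) : OracleAlg a b A B where
  Z := A
  queries := 0
  init := Kraus.ofFun fun u => (fun _ => false, fun _ => false, u)
  step _ := Kraus.ofFun id
  final := K.comp (Kraus.ofFunDiscard (fun u : BitStr a × BitStr b × A => u.2.2)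
    fun u => (u.1, u.2.1))
  init_isChannel := Kraus.ofFun_isChannel fun u v h => by simpa using h
  step_isChannel _ := Kraus.ofFun_isChannel Function.injective_id
  final_isChannel := hK.comp (Kraus.ofFunDiscard_isChannel (by
    rintro ⟨x, y, z⟩ ⟨x', y', z'⟩ h h'
    simp_all))

theorem OracleAlg.choi_ofChannel_run (K : Kraus A B) (hK : K.IsChannel) (O : Oracle a b) :
    ((OracleAlg.ofChannel a b K hK).run O).choi = K.choi := by
  change ((K.comp (Kraus.ofFunDiscard (fun u : BitStr a × BitStr b × A => u.2.2)
    fun u => (u.1, u.2.1))).comp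
      (Kraus.ofFun fun u => (fun _ => false, fun _ => false, u))).choi = _
  rw [Kraus.choi_comp_assoc]
  rw [← Kraus.choi_comp_ofFun_id K]
  refine Kraus.choi_comp_congr rfl ?_
  funext u u' v v'
  simp [Kraus.choi_comp_ofFun, Kraus.choi_ofFunDiscard, Kraus.choi_ofFun]

/-- Together with `OracleAlg.realizes_run` this lets the reduction be built with the closure
properties of `Realizes` and turned into actual adversaries only at the end. -/
theorem Realizes.exists_oracleAlg {q : ℕ} {F : Oracle a b → Kraus A B} (hF : Realizes q F) :
    ∃ M : OracleAlg a b A B, M.queries = q ∧ ∀ O, (M.run O).choi = (F O).choi := by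
  induction q generalizing A with
  | zero =>
    obtain ⟨K, hK, hF⟩ := hF
    exact ⟨OracleAlg.ofChannel a b K hK, rfl, fun O =>
      (OracleAlg.choi_ofChannel_run K hK O).trans (hF O).symm⟩
  | succ q ih =>
    obtain ⟨Z, _, _, K, G, hK, hG, hF⟩ := hF
    obtain ⟨M, hM, hMG⟩ := ih hG
    refine ⟨OracleAlg.cons K hK M, congrArg (· + 1) hM, fun O => ?_⟩
    rw [OracleAlg.choi_cons_run, hF]
    exact Kraus.choi_comp_congr (hMG O) rfl

end Algorithms

/-! ### Reprogramming an oracle at a point that is hardly queried -/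

/-- A form on Kraus operators that behaves like `K ↦ ‖K v‖²`, with `v` a purification of `σ`. -/
structure IsDominatedForm {A B : Type} [Fintype A] [Fintype B] (Q : Matrix B A ℂ → ℝ)
    (σ : Matrix A A ℂ) : Prop where
  perturb : ∀ K L M t, 0 < t → Q (K + L - M) ≤ (1 + t) * Q K + 2 * (1 + 1 / t) * (Q L + Q M)
  le_trace : ∀ K, Q K ≤ (K * σ * Kᴴ).trace.re

namespace IsDominatedForm

variable {A B C : Type} [Fintype A] [Fintype B] [DecidableEq B] [Fintype C]

/-- A channel applied afterwards can be absorbed into the form because it preserves the trace. This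
is how the remaining steps of an algorithm disappear into `Q`. -/
theorem comp {Q : Matrix C A ℂ → ℝ} {σ : Matrix A A ℂ} (hQ : IsDominatedForm Q σ)
    {S : Kraus B C} (hS : S.IsChannel) :
    IsDominatedForm (fun K : Matrix B A ℂ => ∑ s, Q (S.op s * K)) σ where
  perturb K L M t ht := by
    simp only [Matrix.mul_add, Matrix.mul_sub, ← Finset.sum_add_distrib, Finset.mul_sum]
    exact Finset.sum_le_sum fun s _ => hQ.perturb _ _ _ t ht
  le_trace K := by
    rw [← hS.trace_apply]
    simp only [Kraus.apply, Matrix.trace_sum, Complex.re_sum]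
    refine Finset.sum_le_sum fun s _ => (hQ.le_trace _).trans_eq ?_
    simp only [Matrix.conjTranspose_mul, Matrix.mul_assoc]

end IsDominatedForm

/-- The probability that the query register holds `x`. -/
def queryWeight {a b : ℕ} {Z : Type} [Fintype Z] (x : BitStr a)
    (ρ : Matrix (BitStr a × BitStr b × Z) (BitStr a × BitStr b × Z) ℂ) : ℝ :=
  ∑ p : BitStr b × Z, (ρ (x, p) (x, p)).re

section Reprogram

variable {a b : ℕ} {A B : Type} [Fintype A] [DecidableEq A] [Fintype B]

theorem sum_queryWeight {Z : Type} [Fintype Z]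
    (ρ : Matrix (BitStr a × BitStr b × Z) (BitStr a × BitStr b × Z) ℂ) :
    ∑ x, queryWeight x ρ = ρ.trace.re := by
  simp only [queryWeight, Matrix.trace, Matrix.diag_apply, Complex.re_sum]
  rw [← Fintype.sum_prod_type']

theorem queryWeight_nonneg {Z : Type} [Fintype Z] (x : BitStr a)
    {ρ : Matrix (BitStr a × BitStr b × Z) (BitStr a × BitStr b × Z) ℂ} (hρ : ρ.PosSemidef) :
    0 ≤ queryWeight x ρ :=
  Finset.sum_nonneg fun _ _ => (Complex.nonneg_iff.mp hρ.diag_nonneg).1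

/-- The projector onto the states whose query register holds `x`. -/
def queryProj {Z : Type} [DecidableEq Z] (x : BitStr a) :
    Matrix (BitStr a × BitStr b × Z) (BitStr a × BitStr b × Z) ℂ :=
  Matrix.diagonal fun u => if u.1 = x then 1 else 0

theorem trace_queryProj {Z : Type} [Fintype Z] [DecidableEq Z] (x : BitStr a)
    (ρ : Matrix (BitStr a × BitStr b × Z) (BitStr a × BitStr b × Z) ℂ) :
    (queryProj x * ρ * (queryProj x)ᴴ).trace.re = queryWeight x ρ := by
  simp only [queryProj, queryWeight, Matrix.trace, Matrix.diag_apply, Complex.re_sum,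
    Matrix.diagonal_conjTranspose, Matrix.mul_diagonal, Matrix.diagonal_mul,
    Fintype.sum_prod_type]
  rw [Finset.sum_eq_single x]
  · simp
  · intro y _ hy
    simp [hy]
  · simp

/-- The two unitaries agree off the range of `queryProj x`. The shape `K + L - M` is the one that
`IsDominatedForm.perturb` accepts. -/
theorem queryKraus_op_eq {Z : Type} [Fintype Z] [DecidableEq Z] {O O' : Oracle a b}
    {x : BitStr a} (h : ∀ y, y ≠ x → O' y = O y) :
    (queryKraus O' Z).op () = (queryKraus O Z).op () + (queryKraus O' Z).op () * queryProj x -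
      (queryKraus O Z).op () * queryProj x := by
  ext v u
  simp only [queryKraus, queryProj, Matrix.add_apply, Matrix.sub_apply, Matrix.mul_diagonal,
    Matrix.of_apply]
  by_cases hu : u.1 = x
  · simp [hu]
  · simp [hu, h _ hu]

/-- An algorithm hardly notices that its oracle is changed at a point that it hardly queries. -/
theorem OracleAlg.sum_after_le (M : OracleAlg a b A B) {O O' : Oracle a b} {x : BitStr a}
    (h : ∀ y, y ≠ x → O' y = O y) {σ : Matrix A A ℂ} (hσ : IsState σ) {t : ℝ} (ht : 0 < t)
    (j : ℕ) {Q : Matrix (BitStr a × BitStr b × M.Z) A ℂ → ℝ} (hQ : IsDominatedForm Q σ) :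
    ∑ i, Q ((M.after O' j).op i) ≤ ∑ i, Q ((M.after O j).op i) +
      ∑ l ∈ Finset.range j, (t + 4 * (1 + 1 / t) * queryWeight x ((M.after O l).apply σ)) := by
  induction j generalizing Q with
  | zero => simp only [Finset.range_zero, Finset.sum_empty, add_zero]; exact le_rfl
  | succ j ih =>
    obtain ⟨P, hP⟩ : ∃ P : Matrix (BitStr a × BitStr b × M.Z) (BitStr a × BitStr b × M.Z) ℂ,
        P = queryProj x := ⟨_, rfl⟩
    have hS : ∀ O : Oracle a b, ((M.step j).comp (queryKraus O M.Z)).IsChannel := fun O =>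
      (M.step_isChannel j).comp (queryKraus_isChannel O M.Z)
    have hsum : ∀ O : Oracle a b, ∑ i, Q ((M.after O (j + 1)).op i) = ∑ i,
        ∑ s, Q (((M.step j).comp (queryKraus O M.Z)).op s * (M.after O j).op i) := by
      intro O
      change ∑ i : (M.step j).ι × Unit × (M.after O j).ι, Q ((M.step j).op i.1 *
        ((queryKraus O M.Z).op i.2.1 * (M.after O j).op i.2.2)) = ∑ i, ∑ s : (M.step j).ι × Unit,
          Q ((M.step j).op s.1 * (queryKraus O M.Z).op s.2 * (M.after O j).op i)
      simp only [Fintype.sum_prod_type, Fintype.sum_unique, Matrix.mul_assoc]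
      exact Finset.sum_comm
    -- One query is switched; the error terms see only the part of the state whose query register
    -- holds `x`.
    have hstep : ∀ K : Matrix (BitStr a × BitStr b × M.Z) A ℂ,
        ∑ s, Q (((M.step j).comp (queryKraus O' M.Z)).op s * K) ≤
        (1 + t) * ∑ s, Q (((M.step j).comp (queryKraus O M.Z)).op s * K) +
          2 * (1 + 1 / t) * (∑ s, Q (((M.step j).comp (queryKraus O' M.Z)).op s *
            (P * K)) +
          ∑ s, Q (((M.step j).comp (queryKraus O M.Z)).op s * (P * K))) := by
      intro K
      change ∑ s : (M.step j).ι × Unit, Q ((M.step j).op s.1 * (queryKraus O' M.Z).op () * K) ≤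
        (1 + t) * ∑ s : (M.step j).ι × Unit,
          Q ((M.step j).op s.1 * (queryKraus O M.Z).op () * K) +
          2 * (1 + 1 / t) * (∑ s : (M.step j).ι × Unit,
            Q ((M.step j).op s.1 * (queryKraus O' M.Z).op () * (P * K)) +
          ∑ s : (M.step j).ι × Unit,
            Q ((M.step j).op s.1 * (queryKraus O M.Z).op () * (P * K)))
      rw [← Finset.sum_add_distrib, Finset.mul_sum, Finset.mul_sum, ← Finset.sum_add_distrib]
      refine Finset.sum_le_sum fun s _ => ?_
      refine le_trans (le_of_eq ?_) (hQ.perturb _ _ _ t ht)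
      conv_lhs => rw [queryKraus_op_eq h, ← hP]
      simp only [Matrix.mul_add, Matrix.mul_sub, Matrix.add_mul, Matrix.sub_mul,
        Matrix.mul_assoc]
    have hbound : ∀ (O₁ : Oracle a b) (P : Matrix (BitStr a × BitStr b × M.Z) _ ℂ), ∑ i,
        ∑ s, Q (((M.step j).comp (queryKraus O₁ M.Z)).op s * (P * (M.after O j).op i)) ≤
          (P * (M.after O j).apply σ * Pᴴ).trace.re := by
      intro O₁ P
      simp only [Kraus.apply, Matrix.mul_sum, Matrix.sum_mul, Matrix.trace_sum, Complex.re_sum]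
      refine Finset.sum_le_sum fun i _ => ((hQ.comp (hS O₁)).le_trace _).trans_eq ?_
      simp only [Matrix.conjTranspose_mul, Matrix.mul_assoc]
    -- With the identity in place of the projector, the form is at most the trace `1`. Hence the
    -- factor `1 + t` costs no more than the additive constant `t`.
    have h1 := hbound O 1
    simp only [Matrix.one_mul, Matrix.conjTranspose_one, Matrix.mul_one,
      (M.after_isChannel O j).trace_apply, hσ.2, Complex.one_re] at h1
    have h2 := hbound O P
    have h3 := hbound O' P
    rw [hP, trace_queryProj, ← hP] at h2 h3
    -- The first `j` queries are switched with the last one, still made to `O'`, absorbed into the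
    -- form. Thus the last query is compared on the state `M.after O j`, and all weights refer to
    -- the run with `O`.
    have h4 := ih (hQ.comp (hS O'))
    have h5 := Finset.sum_le_sum fun i (_ : i ∈ Finset.univ) => hstep ((M.after O j).op i)
    rw [Finset.sum_add_distrib, ← Finset.mul_sum, ← Finset.mul_sum,
      Finset.sum_add_distrib] at h5
    rw [hsum, hsum, Finset.sum_range_succ]
    have h6 : 2 * (1 + 1 / t) * (∑ i, ∑ s, Q (((M.step j).comp (queryKraus O' M.Z)).op s *
            (P * (M.after O j).op i)) +
          ∑ i, ∑ s, Q (((M.step j).comp (queryKraus O M.Z)).op s *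
            (P * (M.after O j).op i))) ≤
        2 * (1 + 1 / t) * (queryWeight x ((M.after O j).apply σ) +
          queryWeight x ((M.after O j).apply σ)) := by
      gcongr
    have h7 := mul_le_mul_of_nonneg_left h1 ht.le
    linarith

theorem OracleAlg.sum_run_le (M : OracleAlg a b A B) {O O' : Oracle a b} {x : BitStr a}
    (h : ∀ y, y ≠ x → O' y = O y) {σ : Matrix A A ℂ} (hσ : IsState σ) {t : ℝ} (ht : 0 < t)
    {Q : Matrix B A ℂ → ℝ} (hQ : IsDominatedForm Q σ) :
    ∑ i, Q ((M.run O').op i) ≤ ∑ i, Q ((M.run O).op i) +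
      ∑ l ∈ Finset.range M.queries,
        (t + 4 * (1 + 1 / t) * queryWeight x ((M.after O l).apply σ)) := by
  have hsum : ∀ O, ∑ i, Q ((M.run O).op i) =
      ∑ i, ∑ s, Q (M.final.op s * (M.after O M.queries).op i) := by
    intro O
    change ∑ i : M.final.ι × (M.after O M.queries).ι,
      Q (M.final.op i.1 * (M.after O M.queries).op i.2) = _
    rw [Fintype.sum_prod_type, Finset.sum_comm]
  rw [hsum, hsum]
  exact M.sum_after_le h hσ ht _ (hQ.comp M.final_isChannel)

end Reprogram

/-! ### One of several parties -/

section Parties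

variable {n : ℕ} {A B : Fin n → Type} [∀ i, Fintype (A i)] [∀ i, DecidableEq (A i)]
  [∀ i, Fintype (B i)]

/-- The reduced state of the `h`-th register. -/
def reducedOne (h : Fin n) (ρ : Matrix (∀ i, A i) (∀ i, A i) ℂ) : Matrix (A h) (A h) ℂ :=
  Matrix.of fun p p' => ∑ f : ∀ i, A i, if f h = p then ρ f (Function.update f h p') else 0

/-- One Kraus operator for each party but the `h`-th, for which it is `X`. -/
def insertOp (K : ∀ i, Kraus (A i) (B i)) (h : Fin n) (c : ∀ i : {i // i ≠ h}, (K i).ι)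
    (X : Matrix (B h) (A h) ℂ) : Matrix (∀ i, B i) (∀ i, A i) ℂ :=
  Matrix.of fun v u => X (v h) (u h) * ∏ i : {i // i ≠ h}, (K i).op (c i) (v i) (u i)

theorem apply_pi_update {A B : Fin n → Type} [∀ i, Fintype (A i)]
    (K : ∀ i, Kraus (A i) (B i)) (h : Fin n) (L : Kraus (A h) (B h))
    (ρ : Matrix (∀ i, A i) (∀ i, A i) ℂ) :
    (Kraus.pi (Function.update K h L)).apply ρ =
      ∑ l, ∑ c, insertOp K h c (L.op l) * ρ * (insertOp K h c (L.op l))ᴴ := by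
  let T : Kraus (∀ i, A i) (∀ i, B i) :=
    { ι := L.ι × ∀ i : {i // i ≠ h}, (K i).ι
      op := fun p => insertOp K h p.2 (L.op p.1) }
  have hT : T.apply ρ = ∑ l, ∑ c, insertOp K h c (L.op l) * ρ * (insertOp K h c (L.op l))ᴴ :=
    Fintype.sum_prod_type _
  rw [← hT]
  refine Kraus.apply_congr ?_ ρ
  funext u u' v v'
  rw [Kraus.choi_pi, Fintype.prod_eq_mul_prod_subtype_ne _ h]
  have h1 : ∀ i : {i // i ≠ h}, (Function.update K h L i).choi (u i) (u' i) (v i) (v' i) =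
      (K i).choi (u i) (u' i) (v i) (v' i) := fun i => by
    rw [Function.update_of_ne i.2]
  simp only [h1, Function.update_self]
  change _ = ∑ p : L.ι × ∀ i : {i // i ≠ h}, (K i).ι, insertOp K h p.2 (L.op p.1) v u *
    star (insertOp K h p.2 (L.op p.1) v' u')
  simp only [Kraus.choi, Finset.prod_univ_sum, Fintype.piFinset_univ, Fintype.sum_prod_type,
    insertOp, Matrix.of_apply, star_mul', star_prod, Finset.sum_mul_sum, Finset.prod_mul_distrib]
  refine Finset.sum_congr rfl fun l _ => Finset.sum_congr rfl fun c _ => ?_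
  ring

theorem sum_mul_prod_ne (u : ∀ i, A i) (h : Fin n) (g : (∀ i, A i) → ℂ) :
    ∑ u', g u' * ∏ i : {i // i ≠ h}, (if u i = u' i then (1 : ℂ) else 0) =
      ∑ p, g (Function.update u h p) := by
  simp only [Finset.prod_ite_zero, Finset.prod_const_one, mul_ite, mul_one, mul_zero,
    Finset.mem_univ, true_imp_iff]
  rw [← Finset.sum_filter]
  refine Finset.sum_nbij' (fun u' => u' h) (fun p => Function.update u h p) (by simp) ?_ ?_
    (by simp) ?_
  · intro p _
    simp only [Finset.mem_filter, Finset.mem_univ, true_and]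
    intro i
    rw [Function.update_of_ne i.2]
  · intro u' hu'
    simp only [Finset.mem_filter, Finset.mem_univ, true_and] at hu'
    funext i
    by_cases hi : i = h
    · subst hi
      simp
    · rw [Function.update_of_ne hi]
      exact hu' ⟨i, hi⟩
  · intro u' hu'
    simp only [Finset.mem_filter, Finset.mem_univ, true_and] at hu'
    congr 1
    funext i
    by_cases hi : i = h
    · subst hi
      simp
    · rw [Function.update_of_ne hi]
      exact (hu' ⟨i, hi⟩).symm

/-- No signalling: the other parties apply trace preserving maps, so only the reduced state of party
`h` survives in the trace, whatever the entanglement. -/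
theorem trace_insertOp {K : ∀ i, Kraus (A i) (B i)} (h : Fin n)
    (hK : ∀ i, i ≠ h → (K i).IsChannel) (X : Matrix (B h) (A h) ℂ)
    (ρ : Matrix (∀ i, A i) (∀ i, A i) ℂ) :
    ∑ c, (insertOp K h c X * ρ * (insertOp K h c X)ᴴ).trace =
      (X * reducedOne h ρ * Xᴴ).trace := by
  let L : Kraus (A h) (B h) := { ι := Unit, op := fun _ => X }
  have hL : ∀ a c b d, L.choi a c b d = X b a * star (X d c) := fun a c b d =>
    Fintype.sum_unique fun _ : Unit => X b a * star (X d c)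
  have h0 := apply_pi_update K h L ρ
  have h1 : ∑ l, ∑ c, insertOp K h c (L.op l) * ρ * (insertOp K h c (L.op l))ᴴ =
      ∑ c, insertOp K h c X * ρ * (insertOp K h c X)ᴴ := Fintype.sum_unique _
  rw [← Matrix.trace_sum, ← h1, ← h0]
  simp only [Matrix.trace, Matrix.diag_apply, Kraus.apply_apply, Kraus.choi_pi]
  rw [Finset.sum_comm]
  have h2 : ∀ u u' : ∀ i, A i, ∑ v : ∀ i, B i, ∏ i,
      (Function.update K h L i).choi (u i) (u' i) (v i) (v i) =
        (∑ b, X b (u h) * star (X b (u' h))) *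
          ∏ i : {i // i ≠ h}, (if u i = u' i then (1 : ℂ) else 0) := by
    intro u u'
    rw [← Fintype.prod_sum (fun i b => (Function.update K h L i).choi (u i) (u' i) b b),
      Fintype.prod_eq_mul_prod_subtype_ne _ h]
    simp only [Function.update_self, hL]
    congr 1
    refine Finset.prod_congr rfl fun i _ => ?_
    rw [Function.update_of_ne i.2]
    exact Kraus.isChannel_iff.mp (hK i i.2) _ _
  have h3 : ∀ u : ∀ i, A i, ∑ v : ∀ i, B i, ∑ u' : ∀ i, A i,
      ρ u u' * ∏ i, (Function.update K h L i).choi (u i) (u' i) (v i) (v i) =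
        ∑ p, ρ u (Function.update u h p) * ∑ b, X b (u h) * star (X b p) := by
    intro u
    rw [Finset.sum_comm]
    simp only [← Finset.mul_sum, h2]
    simp only [← mul_assoc]
    rw [sum_mul_prod_ne u h fun u' => ρ u u' * ∑ b, X b (u h) * star (X b (u' h))]
    simp
  simp only [h3, Matrix.mul_apply, Matrix.conjTranspose_apply, reducedOne, Matrix.of_apply,
    Finset.mul_sum, Finset.sum_mul]
  have h4 : ∀ f : ∀ i, A i, ∀ b p, ∑ q, (X b q * if f h = q then
      ρ f (Function.update f h p) else 0) * star (X b p) =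
        X b (f h) * ρ f (Function.update f h p) * star (X b p) := by
    intro f b p
    simp [Finset.sum_ite_eq]
  have h5 : ∀ b p, ∑ q, ∑ f : ∀ i, A i, (X b q * if f h = q then
      ρ f (Function.update f h p) else 0) * star (X b p) =
        ∑ f : ∀ i, A i, X b (f h) * ρ f (Function.update f h p) * star (X b p) := by
    intro b p
    rw [Finset.sum_comm]
    simp only [h4]
  simp only [h5]
  rw [Finset.sum_congr rfl fun f _ => Finset.sum_comm, Finset.sum_comm]
  refine Finset.sum_congr rfl fun b _ => ?_
  rw [Finset.sum_comm]
  refine Finset.sum_congr rfl fun p _ => Finset.sum_congr rfl fun f _ => ?_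
  ring

end Parties

/-- A measurement outcome as a functional on states. -/
structure IsEffect {B : Type} [Fintype B] (Λ : Matrix B B ℂ →ₗ[ℝ] ℝ) : Prop where
  nonneg : ∀ ρ : Matrix B B ℂ, ρ.PosSemidef → 0 ≤ Λ ρ
  le_trace : ∀ ρ : Matrix B B ℂ, ρ.PosSemidef → Λ ρ ≤ ρ.trace.re

/-- This is `‖a + b - c‖² ≤ (1 + t)‖a‖² + 2(1 + 1/t)(‖b‖² + ‖c‖²)` for the seminorm defined by `Λ`
and `ρ`. The cross terms are controlled by nonnegativity at `√t K - (L - M)/√t`, and `L - M` is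
split by nonnegativity at `L + M`. -/
theorem IsEffect.perturb {A B : Type} [Fintype A] [Fintype B] {Λ : Matrix B B ℂ →ₗ[ℝ] ℝ}
    (hΛ : IsEffect Λ) {ρ : Matrix A A ℂ} (hρ : ρ.PosSemidef) (K L M : Matrix B A ℂ) {t : ℝ}
    (ht : 0 < t) : Λ ((K + L - M) * ρ * (K + L - M)ᴴ) ≤
      (1 + t) * Λ (K * ρ * Kᴴ) + 2 * (1 + 1 / t) * (Λ (L * ρ * Lᴴ) + Λ (M * ρ * Mᴴ)) := by
  have h1 := hΛ.nonneg _ (hρ.mul_mul_conjTranspose_same (√t • K - (√t)⁻¹ • (L - M)))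
  have h2 := hΛ.nonneg _ (hρ.mul_mul_conjTranspose_same (L + M))
  have e0 : √t * √t = t := Real.mul_self_sqrt ht.le
  have e1 : √t * (√t)⁻¹ = 1 := mul_inv_cancel₀ (Real.sqrt_pos.mpr ht).ne'
  have e2 : (√t)⁻¹ * (√t)⁻¹ = t⁻¹ := by rw [← mul_inv, e0]
  simp only [Matrix.sub_mul, Matrix.mul_sub, Matrix.add_mul, Matrix.mul_add,
    Matrix.conjTranspose_sub, Matrix.conjTranspose_add, Matrix.conjTranspose_smul,
    Matrix.smul_mul, Matrix.mul_smul, star_trivial, map_sub, map_add, map_smul, smul_eq_mul,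
    smul_sub, ← mul_assoc, e0, e1, e2, mul_comm (√t)⁻¹ √t] at h1 h2 ⊢
  have h3 : 0 ≤ (1 + t⁻¹) * (Λ (L * ρ * Lᴴ) + Λ (L * ρ * Mᴴ) +
      (Λ (M * ρ * Lᴴ) + Λ (M * ρ * Mᴴ))) := mul_nonneg (by positivity) (by linarith)
  rw [one_div]
  nlinarith [h1, h3]

/-! ### The quadratic form that one party sees -/

section Parties

variable {n : ℕ} {A B : Fin n → Type} [∀ i, Fintype (A i)] [∀ i, DecidableEq (A i)]
  [∀ i, Fintype (B i)]

/-- The actions of all other parties and the final measurement are hidden in the form; the bound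
retains only the reduced state of party `h`. This makes the single-party comparison applicable to
entangled parties. -/
theorem isDominatedForm_insertOp {K : ∀ i, Kraus (A i) (B i)} (h : Fin n)
    (hK : ∀ i, i ≠ h → (K i).IsChannel) {Λ : Matrix (∀ i, B i) (∀ i, B i) ℂ →ₗ[ℝ] ℝ}
    (hΛ : IsEffect Λ) {ρ : Matrix (∀ i, A i) (∀ i, A i) ℂ} (hρ : ρ.PosSemidef) :
    IsDominatedForm (fun X => ∑ c, Λ (insertOp K h c X * ρ * (insertOp K h c X)ᴴ))
      (reducedOne h ρ) where
  perturb X Y Z t ht := by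
    simp only [← Finset.sum_add_distrib, Finset.mul_sum]
    refine Finset.sum_le_sum fun c _ => ?_
    have hc : insertOp K h c (X + Y - Z) = insertOp K h c X + insertOp K h c Y -
        insertOp K h c Z := by
      ext v u
      simp only [insertOp, Matrix.of_apply, Matrix.add_apply, Matrix.sub_apply]
      ring
    rw [hc]
    exact hΛ.perturb hρ _ _ _ ht
  le_trace X := by
    rw [← trace_insertOp h hK X ρ, Complex.re_sum]
    exact Finset.sum_le_sum fun c _ => hΛ.le_trace _ (hρ.mul_mul_conjTranspose_same _)

theorem apply_pi_eq_sum_insertOp {A B : Fin n → Type} [∀ i, Fintype (A i)]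
    (K : ∀ i, Kraus (A i) (B i)) (h : Fin n)
    (L : Kraus (A h) (B h)) (Λ : Matrix (∀ i, B i) (∀ i, B i) ℂ →ₗ[ℝ] ℝ)
    (ρ : Matrix (∀ i, A i) (∀ i, A i) ℂ) :
    Λ ((Kraus.pi (Function.update K h L)).apply ρ) =
      ∑ l, ∑ c, Λ (insertOp K h c (L.op l) * ρ * (insertOp K h c (L.op l))ᴴ) := by
  rw [apply_pi_update]
  simp only [map_sum]

/-- The partial trace is the channel that keeps the `h`-th register and discards the others. -/
theorem reducedOne_isState (h : Fin n) {ρ : Matrix (∀ i, A i) (∀ i, A i) ℂ} (hρ : IsState ρ) :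
    IsState (reducedOne h ρ) := by
  let K := Kraus.ofFunDiscard (fun f : ∀ i, A i => f h) fun f (i : {i // i ≠ h}) => f i
  have hK : K.IsChannel := Kraus.ofFunDiscard_isChannel fun f g h1 h2 => by
    funext i
    by_cases hi : i = h
    · subst hi
      exact h1
    · exact congrFun h2 ⟨i, hi⟩
  have hKρ : reducedOne h ρ = K.apply ρ := by
    ext p p'
    rw [Kraus.apply_apply]
    refine Finset.sum_congr rfl fun f _ => ?_
    rw [Finset.sum_eq_single (Function.update f h p')]
    · have : (fun i : {i // i ≠ h} => f i) = fun i : {i // i ≠ h} =>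
          Function.update f h p' i := by
        funext i
        rw [Function.update_of_ne i.2]
      simp only [K, Kraus.choi_ofFunDiscard, Function.update_self, ← this, and_true, mul_ite,
        mul_one, mul_zero, eq_comm (a := p)]
    · intro g _ hg
      have : ¬ (p = f h ∧ p' = g h ∧
          (fun i : {i // i ≠ h} => f i) = fun i : {i // i ≠ h} => g i) := by
        rintro ⟨-, h1, h2⟩
        refine hg (funext fun i => ?_)
        by_cases hi : i = h
        · subst hi
          simp [h1]
        · rw [Function.update_of_ne hi]
          exact (congrFun h2 ⟨i, hi⟩).symm
      simp only [K, Kraus.choi_ofFunDiscard, if_neg this, mul_zero]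
    · simp
  rw [hKρ]
  exact hK.isState hρ

end Parties

/-! ### Circuits as channels -/

section Gates

variable {a b : ℕ} {W : Type} [Fintype W] [DecidableEq W]

/-- The matrix elements of the Hadamard gate. -/
def hadamardCoeff (x y : Bool) : ℂ := (if x && y then -1 else 1) / (Real.sqrt 2 : ℂ)

theorem sqrt_two_mul_self : (Real.sqrt 2 : ℂ) * (Real.sqrt 2 : ℂ) = 2 := by
  rw [← Complex.ofReal_mul, Real.mul_self_sqrt zero_le_two, Complex.ofReal_ofNat]

theorem sqrt_two_ne_zero : (Real.sqrt 2 : ℂ) ≠ 0 := fun h => by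
  have := sqrt_two_mul_self
  simp [h] at this

theorem hadamard_mulVec (O : Oracle a b) (w : W) (v : (W → Bool) → ℂ) (f : W → Bool) :
    ((Gate.hadamard w : Gate a b W).unitary O *ᵥ v) f =
      ∑ x : Bool, hadamardCoeff (f w) x * v (Function.update f w x) := by
  simp only [Matrix.mulVec, dotProduct, Gate.unitary, Matrix.of_apply, ite_mul, zero_mul]
  rw [← Finset.sum_filter]
  refine Finset.sum_nbij' (fun g => g w) (fun x => Function.update f w x) (by simp) ?_ ?_
    (by simp) ?_
  · intro x _
    simp only [Finset.mem_filter, Finset.mem_univ, true_and]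
    intro u hu
    rw [Function.update_of_ne hu]
  all_goals
    intro g hg
    simp only [Finset.mem_filter, Finset.mem_univ, true_and] at hg
    have : Function.update f w (g w) = g := by
      funext u
      by_cases hu : u = w
      · subst hu
        simp
      · rw [Function.update_of_ne hu]
        exact hg u hu
    rw [this]
  rfl

theorem phaseT_mulVec (O : Oracle a b) (w : W) (v : (W → Bool) → ℂ) (f : W → Bool) :
    ((Gate.phaseT w : Gate a b W).unitary O *ᵥ v) f =
      (if f w then Complex.exp (Complex.I * Real.pi / 4) else 1) * v f := by
  simp only [Gate.unitary, Matrix.mulVec_diagonal]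

theorem permutation_mulVec {S : Type} [Fintype S] [DecidableEq S] {π : S → S}
    (hπ : Function.Involutive π) (v : S → ℂ) (f : S) :
    ((Matrix.of fun f g => if f = π g then (1 : ℂ) else 0) *ᵥ v) f = v (π f) := by
  simp only [Matrix.mulVec, dotProduct, Matrix.of_apply, ite_mul, zero_mul, one_mul]
  rw [Finset.sum_eq_single (π f)]
  · rw [if_pos (hπ f).symm]
  · intro g _ hg
    rw [if_neg]
    rintro rfl
    exact hg (hπ g).symm
  · simp

/-- The action of a controlled not on basis states. -/
def cnotMap (c t : W) (g : W → Bool) : W → Bool := Function.update g t (xor (g t) (g c))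

theorem cnotMap_involutive {W : Type} [DecidableEq W] {c t : W} (h : c ≠ t) :
    Function.Involutive (cnotMap c t) := by
  intro g
  funext w
  by_cases hw : w = t
  · subst hw
    simp [cnotMap, Function.update_of_ne h]
  · simp [cnotMap, hw]

theorem cnot_mulVec (O : Oracle a b) (c t : W) (h : c ≠ t) (v : (W → Bool) → ℂ) (f : W → Bool) :
    ((Gate.cnot c t h : Gate a b W).unitary O *ᵥ v) f = v (cnotMap c t f) :=
  permutation_mulVec (cnotMap_involutive h) v f

/-- The action of a query gate on basis states. -/
def queryMap (O : Oracle a b) (x : Fin a ↪ W) (y : Fin b ↪ W) (g : W → Bool) : W → Bool :=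
  fun w => xor (g w) (decide (∃ j, y j = w ∧ O (fun i => g (x i)) j = true))

theorem queryMap_apply_inp {W : Type} [DecidableEq W] (O : Oracle a b)
    {x : Fin a ↪ W} {y : Fin b ↪ W}
    (h : ∀ i j, x i ≠ y j) (g : W → Bool) (i : Fin a) : queryMap O x y g (x i) = g (x i) := by
  have : ¬ ∃ j, y j = x i ∧ O (fun i => g (x i)) j = true := by
    rintro ⟨j, hj, -⟩
    exact h i j hj.symm
  simp only [queryMap, this, decide_false, Bool.xor_false]

theorem queryMap_involutive {W : Type} [DecidableEq W] (O : Oracle a b)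
    {x : Fin a ↪ W} {y : Fin b ↪ W}
    (h : ∀ i j, x i ≠ y j) : Function.Involutive (queryMap O x y) := by
  intro g
  funext w
  have : (fun i => queryMap O x y g (x i)) = fun i => g (x i) :=
    funext (queryMap_apply_inp O h g)
  rw [queryMap, this, queryMap, Bool.xor_assoc, Bool.xor_self, Bool.xor_false]

theorem query_mulVec (O : Oracle a b) (x : Fin a ↪ W) (y : Fin b ↪ W) (h : ∀ i j, x i ≠ y j)
    (v : (W → Bool) → ℂ) (f : W → Bool) :
    ((Gate.query x y h : Gate a b W).unitary O *ᵥ v) f = v (queryMap O x y f) := by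
  refine Eq.trans ?_ (permutation_mulVec (queryMap_involutive O h) v f)
  simp only [Gate.unitary]
  rfl

theorem hadamard_mul_self (O : Oracle a b) (w : W) :
    (Gate.hadamard w : Gate a b W).unitary O * (Gate.hadamard w : Gate a b W).unitary O = 1 := by
  refine Matrix.ext_of_mulVec_single fun g => ?_
  rw [Matrix.one_mulVec, ← Matrix.mulVec_mulVec]
  funext f
  simp only [hadamard_mulVec, Fintype.sum_bool, Function.update_self, Function.update_idem]
  have h2 := sqrt_two_mul_self
  have h0 := sqrt_two_ne_zero
  cases hf : f w
  · have : Function.update f w false = f := by rw [← hf, Function.update_eq_self]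
    simp only [this, hadamardCoeff]
    field_simp
    simp
    linear_combination (-(Pi.single g (1 : ℂ) : (W → Bool) → ℂ) f) * h2
  · have : Function.update f w true = f := by rw [← hf, Function.update_eq_self]
    simp only [this, hadamardCoeff]
    field_simp
    simp
    linear_combination (-(Pi.single g (1 : ℂ) : (W → Bool) → ℂ) f) * h2

theorem Gate.conjTranspose_unitary_mul_self (O : Oracle a b) (g : Gate a b W) :
    (g.unitary O)ᴴ * g.unitary O = 1 := by
  have hperm : ∀ π : (W → Bool) → W → Bool, Function.Involutive π →
      (Matrix.of fun f g => if f = π g then (1 : ℂ) else 0)ᴴ *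
        (Matrix.of fun f g => if f = π g then (1 : ℂ) else 0) = 1 := fun π hπ =>
    Kraus.ofFun_conjTranspose_mul_self hπ.injective
  cases g with
  | hadamard w =>
    have : ((Gate.hadamard w : Gate a b W).unitary O)ᴴ =
        (Gate.hadamard w : Gate a b W).unitary O := by
      ext f g
      simp only [Gate.unitary, Matrix.conjTranspose_apply, Matrix.of_apply, Bool.and_comm (f w),
        eq_comm (a := f _)]
      split_ifs <;> simp [Complex.conj_ofReal]
    rw [this, hadamard_mul_self]
  | phaseT w =>
    simp only [Gate.unitary, Matrix.diagonal_conjTranspose, Matrix.diagonal_mul_diagonal]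
    rw [← Matrix.diagonal_one]
    congr 1
    funext g
    have h : star (Complex.exp (Complex.I * Real.pi / 4)) *
        Complex.exp (Complex.I * Real.pi / 4) = 1 := by
      rw [Complex.star_def, ← Complex.exp_conj, ← Complex.exp_add]
      have : (starRingEnd ℂ) (Complex.I * Real.pi / 4) + Complex.I * Real.pi / 4 = 0 := by
        simp [Complex.conj_ofReal, map_ofNat]
        ring
      rw [this, Complex.exp_zero]
    by_cases hg : g w = true
    · simpa [hg] using h
    · simp [hg]
  | cnot c t h => exact hperm _ (cnotMap_involutive h)
  | query x y h =>
    refine Eq.trans ?_ (hperm _ (queryMap_involutive O h))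
    simp only [Gate.unitary]
    rfl

/-- The action of a list of gates on a vector; the head of the list is applied first. -/
def applyGates (O : Oracle a b) (L : List (Gate a b W)) (v : (W → Bool) → ℂ) :
    (W → Bool) → ℂ :=
  L.foldl (fun v g => g.unitary O *ᵥ v) v

theorem applyGates_append (O : Oracle a b) (L L' : List (Gate a b W)) (v : (W → Bool) → ℂ) :
    applyGates O (L ++ L') v = applyGates O L' (applyGates O L v) :=
  List.foldl_append

theorem foldl_unitary_mulVec (O : Oracle a b) (L : List (Gate a b W))
    (U : Matrix (W → Bool) (W → Bool) ℂ) (v : (W → Bool) → ℂ) :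
    L.foldl (fun U g => g.unitary O * U) U *ᵥ v = applyGates O L (U *ᵥ v) := by
  induction L generalizing U with
  | nil => rfl
  | cons g L ih =>
    rw [List.foldl_cons, ih, ← Matrix.mulVec_mulVec]
    rfl

theorem foldl_unitary_isometry (O : Oracle a b) (L : List (Gate a b W))
    (U : Matrix (W → Bool) (W → Bool) ℂ) (hU : Uᴴ * U = 1) :
    (L.foldl (fun U g => g.unitary O * U) U)ᴴ * L.foldl (fun U g => g.unitary O * U) U = 1 := by
  induction L generalizing U with
  | nil => exact hU
  | cons g L ih =>
    rw [List.foldl_cons]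
    refine ih _ ?_
    rw [Matrix.conjTranspose_mul, Matrix.mul_assoc, ← Matrix.mul_assoc _ (g.unitary O),
      g.conjTranspose_unitary_mul_self, Matrix.one_mul, hU]

/-- Hadamard gates put wires that hold `0` into a uniform superposition. -/
theorem applyGates_hadamard (O : Oracle a b) (L : List W) (hL : L.Nodup)
    (u v : (W → Bool) → ℂ) (hu : ∀ w ∈ L, ∀ f x, u (Function.update f w x) = u f)
    (h1 : ∀ f, (∀ w ∈ L, f w = false) → v f = u f)
    (h0 : ∀ f, ¬ (∀ w ∈ L, f w = false) → v f = 0) :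
    applyGates O (L.map Gate.hadamard) v =
      fun f => (1 / (Real.sqrt 2 : ℂ)) ^ L.length * u f := by
  induction L generalizing u v with
  | nil =>
    funext f
    simp [applyGates, h1]
  | cons w L ih =>
    rw [List.nodup_cons] at hL
    have h2 : ∀ f x, (∀ w' ∈ L, Function.update f w x w' = false) ↔ ∀ w' ∈ L, f w' = false := by
      intro f x
      refine forall₂_congr fun w' hw' => ?_
      rw [Function.update_of_ne]
      rintro rfl
      exact hL.1 hw'
    have h3 : ∀ f, v (Function.update f w true) = 0 := fun f => h0 _ (by simp)
    have h4 : ∀ f, ((Gate.hadamard w : Gate a b W).unitary O *ᵥ v) f =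
        (1 / (Real.sqrt 2 : ℂ)) * v (Function.update f w false) := by
      intro f
      rw [hadamard_mulVec, Fintype.sum_bool, h3]
      simp [hadamardCoeff]
    rw [List.map_cons]
    change applyGates O (L.map Gate.hadamard) (_ *ᵥ _) = _
    rw [ih hL.2 (fun f => (1 / (Real.sqrt 2 : ℂ)) * u f) _ (fun w' hw' f x => by
      rw [hu w' (List.mem_cons_of_mem _ hw')])]
    · funext f
      rw [List.length_cons, pow_succ, mul_assoc]
    · intro f hf
      rw [h4, h1 _ (List.forall_mem_cons.mpr ⟨by simp, (h2 f false).mpr hf⟩), hu w (by simp)]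
    · intro f hf
      rw [h4, h0 _ fun h => hf ((h2 f false).mp (List.forall_mem_cons.mp h).2), mul_zero]

/-- No target is a control and the targets are distinct, so the gates do not interfere and act as
one simultaneous addition of the original control bits. -/
theorem applyGates_cnot (O : Oracle a b) {K : ℕ} (c t : Fin K → W) (ht : t.Injective)
    (hct : ∀ i j, c i ≠ t j) (L : List (Fin K)) (hL : L.Nodup) (v : (W → Bool) → ℂ)
    (f : W → Bool) :
    applyGates O (L.map fun j => Gate.cnot (c j) (t j) (hct j j)) v f =
      v fun w => xor (f w) (decide (∃ j ∈ L, t j = w ∧ f (c j) = true)) := by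
  induction L generalizing v with
  | nil => simp [applyGates]
  | cons i L ih =>
    rw [List.nodup_cons] at hL
    rw [List.map_cons]
    change applyGates O (L.map _) (_ *ᵥ v) f = _
    rw [ih hL.2, cnot_mulVec]
    congr 1
    funext w
    have h1 : ∀ i, ¬ ∃ j ∈ L, t j = c i ∧ f (c j) = true := by
      rintro i ⟨j, -, hj, -⟩
      exact hct i j hj.symm
    have h2 : ¬ ∃ j ∈ L, t j = t i ∧ f (c j) = true := by
      rintro ⟨j, hj, hj', -⟩
      rw [ht hj'] at hj
      exact hL.1 hj
    by_cases hw : w = t i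
    · subst hw
      simp only [cnotMap, Function.update_self, h1, h2, decide_false, Bool.xor_false]
      have h3 : (∃ j ∈ i :: L, t j = t i ∧ f (c j) = true) ↔ f (c i) = true := by
        simp only [List.mem_cons]
        constructor
        · rintro ⟨j, -, hj, hj'⟩
          rwa [ht hj] at hj'
        · exact fun h => ⟨i, Or.inl rfl, rfl, h⟩
      simp only [h3, Bool.decide_eq_true]
    · rw [cnotMap, Function.update_of_ne hw]
      congr 2
      simp [Ne.symm hw]

/-- The gates that flip a bit. -/
def notGates (a b : ℕ) (w : W) : List (Gate a b W) :=
  [.hadamard w, .phaseT w, .phaseT w, .phaseT w, .phaseT w, .hadamard w]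

/-- `T⁴` is the Pauli `Z`, and conjugation by Hadamard turns it into `X`, which is not among the
elementary gates. -/
theorem applyGates_not (O : Oracle a b) (w : W) (v : (W → Bool) → ℂ) (f : W → Bool) :
    applyGates O (notGates a b w) v f = v (Function.update f w (!f w)) := by
  have he : Complex.exp (Complex.I * Real.pi / 4) ^ 4 = -1 := by
    rw [← Complex.exp_nat_mul, ← Complex.exp_pi_mul_I]
    congr 1
    push_cast
    ring
  have h2 := sqrt_two_mul_self
  have h0 := sqrt_two_ne_zero
  simp only [applyGates, notGates, List.foldl_cons, List.foldl_nil]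
  rw [hadamard_mulVec]
  simp only [phaseT_mulVec, hadamard_mulVec, Fintype.sum_bool, Function.update_self,
    Function.update_idem]
  generalize Complex.exp (Complex.I * Real.pi / 4) = e at he
  cases hf : f w
  · have : Function.update f w false = f := by rw [← hf, Function.update_eq_self]
    simp only [this, hadamardCoeff, Bool.not_false]
    generalize v (Function.update f w true) = p
    generalize v f = p'
    simp
    field_simp
    linear_combination (p' - p) * he - p * h2
  · have : Function.update f w true = f := by rw [← hf, Function.update_eq_self]
    simp only [this, hadamardCoeff, Bool.not_true]
    generalize v (Function.update f w false) = p
    generalize v f = p'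
    simp
    field_simp
    linear_combination (p' - p) * he - p * h2

end Gates

namespace Circuit

variable {a b : ℕ} {α β : Type} [Fintype α] [Fintype β]

/-- The isometry that a circuit performs before it discards its working wires. -/
def isometry (C : Circuit a b α β) (O : Oracle a b) : Matrix (C.W → Bool) (α → Bool) ℂ :=
  C.unitary O * C.embed

/-- The channel that a circuit performs. -/
def toKraus (C : Circuit a b α β) (O : Oracle a b) : Kraus (α → Bool) (β → Bool) :=
  (Kraus.ofFunDiscard (fun (f : C.W → Bool) j => f (C.out j))
    (fun f (w : {w // ∀ j, C.out j ≠ w}) => f w)).comp { ι := Unit, op := fun _ => C.isometry O }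

theorem choi_toKraus (C : Circuit a b α β) (O : Oracle a b) (u u' : α → Bool) (s t : β → Bool) :
    (C.toKraus O).choi u u' s t = ∑ f, ∑ g, C.isometry O f u * star (C.isometry O g u') *
      if (∀ j, f (C.out j) = s j) ∧ (∀ j, g (C.out j) = t j) ∧
        ∀ w, (∀ j, C.out j ≠ w) → f w = g w then 1 else 0 := by
  rw [toKraus, Kraus.choi_comp]
  refine Finset.sum_congr rfl fun f _ => Finset.sum_congr rfl fun g _ => ?_
  rw [Kraus.choi_ofFunDiscard]
  congr 1
  · exact Fintype.sum_unique fun _ : Unit => C.isometry O f u * star (C.isometry O g u')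
  · refine if_congr (and_congr ?_ (and_congr ?_ ?_)) rfl rfl
    · exact eq_comm.trans funext_iff
    · exact eq_comm.trans funext_iff
    · exact funext_iff.trans Subtype.forall

/-- The indicator of the partial trace is left as an arbitrary `r`, so that it can be written on the
wires `C.W ⊕ ExtraWire N K M` with any decidability instance. -/
theorem choi_toKraus_eq_sum (C : Circuit a b α β) (O : Oracle a b) (u u' : α → Bool)
    (s t : β → Bool) (r : (C.W → Bool) → (C.W → Bool) → ℂ)
    (h1 : ∀ f g, ((∀ j, f (C.out j) = s j) ∧ (∀ j, g (C.out j) = t j) ∧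
      ∀ w, (∀ j, C.out j ≠ w) → f w = g w) → r f g = 1)
    (h0 : ∀ f g, ¬ ((∀ j, f (C.out j) = s j) ∧ (∀ j, g (C.out j) = t j) ∧
      ∀ w, (∀ j, C.out j ≠ w) → f w = g w) → r f g = 0) :
    (C.toKraus O).choi u u' s t =
      ∑ f, ∑ g, C.isometry O f u * star (C.isometry O g u') * r f g := by
  rw [choi_toKraus]
  refine Finset.sum_congr rfl fun f _ => Finset.sum_congr rfl fun g _ => ?_
  split_ifs with h
  · rw [h1 f g h]
  · rw [h0 f g h]

theorem eval_eq_apply [DecidableEq α] (C : Circuit a b α β) (O : Oracle a b)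
    (ρ : Matrix (α → Bool) (α → Bool) ℂ) : C.eval O ρ = (C.toKraus O).apply ρ := by
  rw [toKraus, Kraus.apply_comp]
  have : ({ ι := Unit, op := fun _ => C.isometry O } : Kraus (α → Bool) (C.W → Bool)).apply ρ =
      C.isometry O * ρ * (C.isometry O)ᴴ :=
    Fintype.sum_unique fun _ : Unit => C.isometry O * ρ * (C.isometry O)ᴴ
  rw [this]
  ext s t
  rw [Kraus.apply_apply]
  refine Finset.sum_congr rfl fun f _ => Finset.sum_congr rfl fun g _ => ?_
  rw [Kraus.choi_ofFunDiscard, mul_ite, mul_one, mul_zero]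
  refine if_congr (and_congr ?_ (and_congr ?_ ?_)) rfl rfl
  · exact funext_iff.symm.trans eq_comm
  · exact funext_iff.symm.trans eq_comm
  · exact ⟨fun h => funext fun w => h w w.2, fun h w hw => congrFun h ⟨w, hw⟩⟩

theorem embed_isometry {β : Type} (C : Circuit a b α β) : C.embedᴴ * C.embed = 1 := by
  let emb : (α → Bool) → C.W → Bool := fun s w => if h : ∃ i, C.inp i = w then s h.choose else false
  have hinp : ∀ s i, emb s (C.inp i) = s i := fun s i => by
    have h : ∃ i', C.inp i' = C.inp i := ⟨i, rfl⟩
    simp only [emb, dif_pos h]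
    exact congrArg s (C.inp.injective h.choose_spec)
  have hemb : C.embed = (Kraus.ofFun emb).op () := by
    ext g s
    refine if_congr ⟨?_, ?_⟩ rfl rfl
    · rintro ⟨h1, h2⟩
      funext w
      by_cases h : ∃ i, C.inp i = w
      · obtain ⟨i, rfl⟩ := h
        rw [h1, hinp]
      · simp only [emb, dif_neg h]
        exact h2 w fun i hi => h ⟨i, hi⟩
    · rintro rfl
      refine ⟨hinp s, fun w hw => ?_⟩
      simp only [emb]
      rw [dif_neg]
      rintro ⟨i, hi⟩
      exact hw i hi
  rw [hemb]
  refine Kraus.ofFun_conjTranspose_mul_self fun s t h => funext fun i => ?_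
  rw [← hinp s, ← hinp t, h]

theorem toKraus_isChannel [DecidableEq β] (C : Circuit a b α β) (O : Oracle a b) :
    (C.toKraus O).IsChannel := by
  refine Kraus.IsChannel.comp (Kraus.ofFunDiscard_isChannel fun f g h1 h2 => funext fun w => ?_) ?_
  · by_cases h : ∃ j, C.out j = w
    · obtain ⟨j, rfl⟩ := h
      exact congrFun h1 j
    · push Not at h
      exact congrFun h2 ⟨w, h⟩
  · refine (Fintype.sum_unique fun _ : Unit => (C.isometry O)ᴴ * C.isometry O).trans ?_
    rw [isometry, Matrix.conjTranspose_mul, Matrix.mul_assoc, ← Matrix.mul_assoc _ (C.unitary O),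
      unitary, foldl_unitary_isometry _ _ _ (by simp), Matrix.one_mul, embed_isometry]

theorem isometry_apply {β : Type} (C : Circuit a b α β) (O : Oracle a b) (f : C.W → Bool)
    (u : α → Bool) :
    C.isometry O f u = applyGates O C.gates (fun g => C.embed g u) f := by
  have h := foldl_unitary_mulVec O C.gates 1 fun g => C.embed g u
  rw [Matrix.one_mulVec] at h
  rw [← h]
  rfl

end Circuit

/-! ### Gates on the wires of a circuit and additional wires -/

/-- Two flags, padding, a string and a copy of it, and wires for unused bits. -/
abbrev ExtraWire (N K M : ℕ) : Type := Bool ⊕ Fin N ⊕ Fin K ⊕ Fin K ⊕ Fin M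

namespace ExtraWire

variable {N K M : ℕ}

abbrev flag (c : Bool) : ExtraWire N K M := .inl c
abbrev pad (i : Fin N) : ExtraWire N K M := .inr (.inl i)
abbrev str (j : Fin K) : ExtraWire N K M := .inr (.inr (.inl j))
abbrev copy (j : Fin K) : ExtraWire N K M := .inr (.inr (.inr (.inl j)))
abbrev junk (j : Fin M) : ExtraWire N K M := .inr (.inr (.inr (.inr j)))

end ExtraWire

open ExtraWire

/-- One of the oracles that a single oracle contains by domain separation. -/
def domainOracle {N M : ℕ} (c : Bool) (a b : ℕ) (O : Oracle (N + 1) M) : Oracle a b :=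
  fun x => resize b (O (Fin.cons c (resize N x)))

section Lift

variable {a b N K M : ℕ} {W : Type}

/-- The input wires of a query to `domainOracle c`. -/
def domainInp (c : Bool) (x : Fin a → W ⊕ ExtraWire N K M) : Fin (N + 1) → W ⊕ ExtraWire N K M :=
  Fin.cons (.inr (flag c)) fun i => if h : i.val < a then x ⟨i, h⟩ else .inr (pad i)

/-- The output wires of a query to `domainOracle c`. -/
def domainOut (y : Fin b → W) : Fin M → W ⊕ ExtraWire N K M :=
  fun j => if h : j.val < b then .inl (y ⟨j, h⟩) else .inr (junk j)

theorem domainInp_injective (c : Bool) {x : Fin a → W ⊕ ExtraWire N K M} (hx : x.Injective)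
    (hx' : ∀ i, (∃ w, x i = .inl w) ∨ ∃ j, x i = .inr (str j)) :
    (domainInp c x).Injective := by
  rw [domainInp, Fin.cons_injective_iff]
  constructor
  · rintro ⟨i, hi⟩
    simp only at hi
    split_ifs at hi with h
    · rcases hx' ⟨i, h⟩ with ⟨w, hw⟩ | ⟨j, hj⟩
      · rw [hw] at hi
        cases hi
      · rw [hj] at hi
        cases hi
    · cases hi
  · intro i i' h
    simp only at h
    split_ifs at h with h1 h2 h2
    · simpa [Fin.ext_iff] using hx h
    · rcases hx' ⟨i, h1⟩ with ⟨w, hw⟩ | ⟨j, hj⟩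
      · rw [hw] at h
        cases h
      · rw [hj] at h
        cases h
    · rcases hx' ⟨i', h2⟩ with ⟨w, hw⟩ | ⟨j, hj⟩
      · rw [hw] at h
        cases h
      · rw [hj] at h
        cases h
    · simpa using h

theorem domainOut_injective {y : Fin b → W} (hy : y.Injective) :
    (domainOut y : Fin M → W ⊕ ExtraWire N K M).Injective := by
  intro j j' h
  simp only [domainOut] at h
  split_ifs at h with h1 h2 h2
  · simpa [Fin.ext_iff] using hy (Sum.inl_injective h)
  · simpa using h

theorem domainInp_ne_domainOut (c : Bool) {x : Fin a → W ⊕ ExtraWire N K M} {y : Fin b → W}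
    (hx' : ∀ i, (∃ w, x i = .inl w) ∨ ∃ j, x i = .inr (str j)) (hxy : ∀ i j, x i ≠ .inl (y j))
    (i : Fin (N + 1)) (j : Fin M) : domainInp c x i ≠ domainOut y j := by
  refine Fin.cases ?_ (fun i => ?_) i
  · simp only [domainInp, Fin.cons_zero, domainOut]
    split_ifs <;> simp
  · simp only [domainInp, Fin.cons_succ, domainOut]
    split_ifs with h1 h2 h2
    · exact hxy _ _
    · rcases hx' ⟨i, h1⟩ with ⟨w, hw⟩ | ⟨j, hj⟩
      · simp [hw]
      · simp [hj]
    · simp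
    · simp

/-- A query to `domainOracle c`. -/
def domainGate (c : Bool) (x : Fin a → W ⊕ ExtraWire N K M) (y : Fin b → W) (hx : x.Injective)
    (hx' : ∀ i, (∃ w, x i = .inl w) ∨ ∃ j, x i = .inr (str j)) (hy : y.Injective)
    (hxy : ∀ i j, x i ≠ .inl (y j)) : Gate (N + 1) M (W ⊕ ExtraWire N K M) :=
  .query ⟨domainInp c x, domainInp_injective c hx hx'⟩ ⟨domainOut y, domainOut_injective hy⟩
    (domainInp_ne_domainOut c hx' hxy)

/-- A gate of a circuit that queries `domainOracle false`. -/
def liftGate : Gate a b W → Gate (N + 1) M (W ⊕ ExtraWire N K M)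
  | .hadamard w => .hadamard (.inl w)
  | .phaseT w => .phaseT (.inl w)
  | .cnot c t h => .cnot (.inl c) (.inl t) (Sum.inl_injective.ne h)
  | .query x y h => domainGate false (fun i => .inl (x i)) y (Sum.inl_injective.comp x.injective)
      (fun _ => .inl ⟨_, rfl⟩) y.injective fun i j => Sum.inl_injective.ne (h i j)

/-- A vector on the wires `W`, which may depend on the string, and one on the additional wires. -/
def jointVec (Ψ : BitStr K → (W → Bool) → ℂ) (χ : (ExtraWire N K M → Bool) → ℂ) :
    (W ⊕ ExtraWire N K M → Bool) → ℂ :=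
  fun f => Ψ (fun j => f (.inr (str j))) (fun w => f (.inl w)) * χ fun x => f (.inr x)

/-- The flag `c` and the padding hold their values, and the unused wires are in the uniform
superposition. -/
structure IsReady (c : Bool) (χ : (ExtraWire N K M → Bool) → ℂ) : Prop where
  flag_eq : ∀ e, χ e ≠ 0 → e (flag c) = c
  pad_eq : ∀ e, χ e ≠ 0 → ∀ i, e (pad i) = false
  junk_inv : ∀ e e', (∀ x, (∀ j, x ≠ junk j) → e x = e' x) → χ e = χ e'

variable [Fintype W] [DecidableEq W]

/-- The large oracle returns more bits than are wanted. The surplus is added to wires whose uniform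
superposition is invariant under flips, so it leaves no trace. On the support of `χ`, the flag and
the padding complete the input to that of the chosen domain; off the support both sides vanish. -/
theorem domainGate_mulVec (O : Oracle (N + 1) M) {c : Bool} {x : Fin a → W ⊕ ExtraWire N K M}
    {y : Fin b → W} {hx : x.Injective}
    {hx' : ∀ i, (∃ w, x i = .inl w) ∨ ∃ j, x i = .inr (str j)} {hy : y.Injective}
    {hxy : ∀ i j, x i ≠ .inl (y j)} (Ψ : BitStr K → (W → Bool) → ℂ)
    {χ : (ExtraWire N K M → Bool) → ℂ} (hχ : IsReady c χ) (f : W ⊕ ExtraWire N K M → Bool) :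
    ((domainGate c x y hx hx' hy hxy).unitary O *ᵥ jointVec Ψ χ) f =
      Ψ (fun j => f (.inr (str j))) (fun w => xor (f (.inl w))
        (decide (∃ j, y j = w ∧ domainOracle c a b O (fun i => f (x i)) j = true))) *
      χ fun z => f (.inr z) := by
  rw [domainGate, query_mulVec, jointVec]
  have h1 : ∀ z : ExtraWire N K M, (∀ j, z ≠ junk j) →
      queryMap O ⟨domainInp c x, domainInp_injective c hx hx'⟩
        ⟨domainOut y, domainOut_injective hy⟩ f (.inr z) = f (.inr z) := by
    intro z hz
    have : ¬ ∃ j : Fin M, (domainOut y j : W ⊕ ExtraWire N K M) = .inr z ∧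
        O (fun i => f (domainInp c x i)) j = true := by
      rintro ⟨j, hj, -⟩
      simp only [domainOut] at hj
      split_ifs at hj
      exact hz j (Sum.inr_injective hj).symm
    simp only [queryMap, Function.Embedding.coeFn_mk, this, decide_false, Bool.xor_false]
  rw [hχ.junk_inv _ (fun z => f (.inr z)) h1]
  by_cases h0 : χ (fun z => f (.inr z)) = 0
  · simp only [h0, mul_zero]
  · have h2 : (fun i => f (domainInp c x i)) = Fin.cons c (resize N fun i => f (x i)) := by
      funext i
      refine Fin.cases ?_ (fun i => ?_) i
      · simpa [domainInp] using hχ.flag_eq _ h0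
      · simp only [domainInp, Fin.cons_succ, resize, bit]
        split_ifs with h
        · rfl
        · exact hχ.pad_eq _ h0 i
    congr 2
    · funext j
      exact h1 _ (by simp)
    · funext w
      simp only [queryMap, Function.Embedding.coeFn_mk, h2]
      congr 1
      rw [decide_eq_decide]
      constructor
      · rintro ⟨j, hj, hO⟩
        simp only [domainOut] at hj
        split_ifs at hj with h
        refine ⟨⟨j, h⟩, Sum.inl_injective hj, ?_⟩
        simpa [domainOracle, resize, bit] using hO
      · rintro ⟨j, hj, hO⟩
        simp only [domainOracle, resize, bit] at hO
        split_ifs at hO with h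
        exact ⟨⟨j, h⟩, by simp [domainOut, hj], hO⟩

theorem liftGate_mulVec (O : Oracle (N + 1) M) (g : Gate a b W) (Ψ : BitStr K → (W → Bool) → ℂ)
    {χ : (ExtraWire N K M → Bool) → ℂ} (hχ : IsReady false χ) :
    (liftGate g).unitary O *ᵥ jointVec Ψ χ =
      jointVec (fun y => g.unitary (domainOracle false a b O) *ᵥ Ψ y) χ := by
  have hupd : ∀ (f : W ⊕ ExtraWire N K M → Bool) w x, (fun w' => Function.update f (.inl w) x
      (.inl w')) = Function.update (fun w' => f (.inl w')) w x := fun f w x =>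
    Function.update_comp_eq_of_injective f Sum.inl_injective w x
  funext f
  cases g with
  | hadamard w =>
    simp only [liftGate, jointVec, hadamard_mulVec, hupd, Finset.sum_mul, mul_assoc]
    rfl
  | phaseT w =>
    simp only [liftGate, jointVec, phaseT_mulVec, mul_assoc]
  | cnot c t h =>
    simp only [liftGate, jointVec, cnot_mulVec, cnotMap, hupd]
    rfl
  | query x y h =>
    rw [liftGate, domainGate_mulVec O Ψ hχ]
    simp only [jointVec, query_mulVec]
    rfl

theorem applyGates_liftGate (O : Oracle (N + 1) M) (L : List (Gate a b W))
    (Ψ : BitStr K → (W → Bool) → ℂ) {χ : (ExtraWire N K M → Bool) → ℂ} (hχ : IsReady false χ) :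
    applyGates O (L.map liftGate) (jointVec Ψ χ) =
      jointVec (fun y => applyGates (domainOracle false a b O) L (Ψ y)) χ := by
  induction L generalizing Ψ with
  | nil => rfl
  | cons g L ih =>
    rw [List.map_cons]
    change applyGates O (L.map liftGate) (_ *ᵥ _) = _
    rw [liftGate_mulVec O g Ψ hχ, ih]
    rfl

end Lift

/-! ### Loading the hash as the key and running a given circuit -/

section Tail

variable {a b ℓ N K M : ℕ} {γ δ : Type} [Fintype γ]

/-- Adding `s` to key wires that start at zero writes `s` there. The addition stands inside the
argument of `embed` because a query acts on vectors by precomposition with an involution. -/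
theorem embed_xor_key (C : Circuit a b (Fin ℓ ⊕ γ) δ) (g : C.W → Bool) (s : BitStr ℓ)
    (m : γ → Bool) :
    C.embed (fun w => xor (g w) (decide (∃ j, C.inp (.inl j) = w ∧ s j = true)))
      (Sum.elim (fun _ => false) m) = C.embed g (Sum.elim s m) := by
  have h1 : ∀ j, decide (∃ j', C.inp (.inl j') = C.inp (.inl j) ∧ s j' = true) = s j := by
    intro j
    have : (∃ j', C.inp (.inl j') = C.inp (.inl j) ∧ s j' = true) ↔ s j = true := by
      constructor
      · rintro ⟨j', hj', hs⟩
        rwa [Sum.inl_injective (C.inp.injective hj')] at hs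
      · exact fun h => ⟨j, rfl, h⟩
    simp only [this, Bool.decide_eq_true]
  have h2 : ∀ w, (∀ j, C.inp (.inl j) ≠ w) →
      decide (∃ j', C.inp (.inl j') = w ∧ s j' = true) = false := by
    intro w hw
    rw [decide_eq_false_iff_not]
    rintro ⟨j, hj, -⟩
    exact hw j hj
  refine if_congr (and_congr ?_ ?_) rfl rfl
  · rw [Sum.forall, Sum.forall]
    refine and_congr (forall_congr' fun j => ?_) (forall_congr' fun j => ?_)
    · beta_reduce
      rw [h1, Sum.elim_inl, Sum.elim_inl]
      cases g (C.inp (Sum.inl j)) <;> cases s j <;> simp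
    · beta_reduce
      rw [h2 _ fun j' hj => Sum.inl_ne_inr (C.inp.injective hj), Bool.xor_false]
      rfl
  · refine forall_congr' fun w => forall_congr' fun hw => ?_
    beta_reduce
    rw [h2 _ fun j => hw (.inl j), Bool.xor_false]

theorem strWire_injective {W : Type} :
    Function.Injective fun j : Fin K => (.inr (str j) : W ⊕ ExtraWire N K M) :=
  fun _ _ h => by simpa using h

/-- Compute the key as the hash of the string, then do as `C` does. -/
def tailGates (C : Circuit a b (Fin ℓ ⊕ γ) δ) (N K M : ℕ) :
    List (Gate (N + 1) M (C.W ⊕ ExtraWire N K M)) :=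
  notGates _ _ (.inr (flag true)) ++
    domainGate true (fun j : Fin K => .inr (str j)) (fun j => C.inp (.inl j))
      strWire_injective (fun j => .inr ⟨j, rfl⟩)
      (C.inp.injective.comp Sum.inl_injective) (fun _ _ => by simp) :: C.gates.map liftGate

/-- Flag `true` is set to `1`, so that a query reaches `H` and puts `H(y)` on the zero key wires.
Flag `false` stays `0` throughout, so the queries of `C` reach `G`. The key is computed separately
for each `y`, which is why the first factor depends on the string. -/
theorem applyGates_tail (C : Circuit a b (Fin ℓ ⊕ γ) δ) (O : Oracle (N + 1) M) (m : γ → Bool)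
    {χ : (ExtraWire N K M → Bool) → ℂ} (hχ : IsReady false χ)
    (hχ' : ∀ e, χ e ≠ 0 → e (flag true) = false) :
    applyGates O (tailGates C N K M)
      (jointVec (fun _ g => C.embed g (Sum.elim (fun _ => false) m)) χ) =
    jointVec (fun y g => C.isometry (domainOracle false a b O) g
        (Sum.elim (domainOracle true K ℓ O y) m))
      fun e => χ (Function.update e (flag true) !e (flag true)) := by
  set χ₁ : (ExtraWire N K M → Bool) → ℂ :=
    fun e => χ (Function.update e (flag true) !e (flag true)) with hχ₁
  have h1 : IsReady true χ₁ :=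
    { flag_eq := fun e he => by simpa using hχ' _ he
      pad_eq := fun e he i => by simpa using hχ.pad_eq _ he i
      junk_inv := fun e e' h => hχ.junk_inv _ _ fun x hx => by
        have h0 := h (flag true) (by simp)
        by_cases hx' : x = flag true
        · subst hx'
          simp [h0]
        · rw [Function.update_of_ne hx', Function.update_of_ne hx', h x hx] }
  have h2 : IsReady false χ₁ :=
    { flag_eq := fun e he => by simpa using hχ.flag_eq _ he
      pad_eq := h1.pad_eq
      junk_inv := h1.junk_inv }
  have e1 : applyGates O (notGates _ _ (.inr (flag true)))
      (jointVec (fun _ g => C.embed g (Sum.elim (fun _ => false) m)) χ) =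
      jointVec (fun _ g => C.embed g (Sum.elim (fun _ => false) m)) χ₁ := by
    funext f
    rw [applyGates_not]
    simp only [jointVec, hχ₁]
    congr 2
    exact Function.update_comp_eq_of_injective f Sum.inr_injective (flag true) _
  rw [tailGates, applyGates_append, e1]
  change applyGates O (C.gates.map liftGate) (_ *ᵥ _) = _
  have e2 : (domainGate true (fun j : Fin K => .inr (str j)) (fun j => C.inp (.inl j))
      strWire_injective (fun j => .inr ⟨j, rfl⟩)
      (C.inp.injective.comp Sum.inl_injective) (fun _ _ => by simp)).unitary O *ᵥ
        jointVec (fun _ g => C.embed g (Sum.elim (fun _ => false) m)) χ₁ =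
      jointVec (fun y g => C.embed g (Sum.elim (domainOracle true K ℓ O y) m)) χ₁ := by
    funext f
    rw [domainGate_mulVec O _ h1]
    simp only [jointVec]
    rw [embed_xor_key]
  rw [e2, applyGates_liftGate O _ _ h2]
  congr 1
  funext y g
  rw [Circuit.isometry_apply]

/-- The sum over the values of the additional wires, most of which are determined. -/
theorem sum_extraWire (cp : BitStr K → BitStr K) (G : BitStr K → ℂ) :
    ∑ e : ExtraWire N K M → Bool, (if (∀ c, e (flag c) = c) ∧ (∀ i, e (pad i) = false) ∧
      (∀ j, e (copy j) = cp (fun i => e (str i)) j) then G fun j => e (str j) else 0) =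
        2 ^ M * ∑ y, G y := by
  rw [← Finset.sum_filter]
  have h : ∑ p : BitStr K × BitStr M, G p.1 = 2 ^ M * ∑ y, G y := by
    simp [Fintype.sum_prod_type, Finset.mul_sum]
  rw [← h]
  refine Finset.sum_nbij' (fun e => (fun j => e (str j), fun j => e (junk j)))
    (fun p => Sum.elim id (Sum.elim (fun _ => false) (Sum.elim p.1 (Sum.elim (cp p.1) p.2))))
    (by simp) (by simp) ?_ (by simp) (by simp)
  intro e he
  simp only [Finset.mem_filter, Finset.mem_univ, true_and] at he
  funext x
  rcases x with c | i | j | j | j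
  · exact (he.1 c).symm
  · exact (he.2.1 i).symm
  · rfl
  · exact (he.2.2 j).symm
  · rfl

/-- Additional wires that are discarded and hold the same value in both arguments. -/
theorem sum_jointVec {W X : Type} [Fintype W] [DecidableEq W] [Fintype X] [DecidableEq X]
    (Φ Φ' : (X → Bool) → (W → Bool) → ℂ) (χ χ' : (X → Bool) → ℂ)
    (r : (W ⊕ X → Bool) → (W ⊕ X → Bool) → ℂ) (p : (W → Bool) → (W → Bool) → ℂ)
    (T : (X → Bool) → ℂ)
    (hr : ∀ f g e e', χ e ≠ 0 → χ' e' ≠ 0 →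
      r (Sum.elim f e) (Sum.elim g e') = if e' = e then T e * p f g else 0) :
    ∑ f : W ⊕ X → Bool, ∑ g : W ⊕ X → Bool,
      (Φ (fun x => f (.inr x)) (fun w => f (.inl w)) * χ fun x => f (.inr x)) *
      star (Φ' (fun x => g (.inr x)) (fun w => g (.inl w)) * χ' fun x => g (.inr x)) * r f g =
    ∑ e, T e * (χ e * star (χ' e)) * ∑ f, ∑ g, Φ e f * star (Φ' e g) * p f g := by
  have hsum : ∀ F : (W ⊕ X → Bool) → ℂ, ∑ f, F f = ∑ e : X → Bool, ∑ f : W → Bool,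
      F (Sum.elim f e) := by
    intro F
    rw [← Equiv.sum_comp (Equiv.sumArrowEquivProdArrow W X Bool).symm, Fintype.sum_prod_type,
      Finset.sum_comm]
    rfl
  rw [hsum]
  simp only [hsum fun g => _ * star _ * _, Sum.elim_inr, Sum.elim_inl]
  refine Finset.sum_congr rfl fun e _ => ?_
  rw [Finset.mul_sum]
  refine Finset.sum_congr rfl fun f _ => ?_
  rw [Finset.sum_eq_single e]
  · rw [Finset.mul_sum]
    refine Finset.sum_congr rfl fun g _ => ?_
    by_cases h : χ e = 0
    · simp [h]
    by_cases h' : χ' e = 0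
    · simp [h']
    rw [hr f g e e h h', if_pos rfl, star_mul']
    ring
  · intro e' _ he
    refine Finset.sum_eq_zero fun g _ => ?_
    by_cases h : χ e = 0
    · simp [h]
    by_cases h' : χ' e' = 0
    · simp [h']
    rw [hr f g e e' h h', if_neg he, mul_zero]
  · simp

end Tail

/-! ### The sharing and reconstruction circuits and their initial states -/

section Circuits

variable {a b ℓ N K M : ℕ} {γ δ ι : Type} [Fintype γ]

theorem Circuit.embed_eq_ite (C : Circuit a b γ δ) (g : C.W → Bool) (u : γ → Bool) {p : Prop}
    [Decidable p] (h : ((∀ i, g (C.inp i) = u i) ∧ ∀ w, (∀ i, C.inp i ≠ w) → g w = false) ↔ p) :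
    C.embed g u = if p then 1 else 0 :=
  if_congr h rfl rfl

theorem embed_zero_key (C : Circuit a b (Fin ℓ ⊕ γ) δ) (g : C.W → Bool) (m : γ → Bool) :
    C.embed g (Sum.elim (fun _ => false) m) =
      if (∀ i, g (C.inp (.inr i)) = m i) ∧ ∀ w, (∀ i, C.inp (.inr i) ≠ w) → g w = false
      then 1 else 0 := by
  refine if_congr ⟨?_, ?_⟩ rfl rfl
  · rintro ⟨h1, h2⟩
    refine ⟨fun i => h1 (.inr i), fun w hw => ?_⟩
    by_cases h : ∃ j, C.inp (.inl j) = w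
    · obtain ⟨j, rfl⟩ := h
      exact h1 (.inl j)
    · refine h2 w ?_
      rintro (j | i)
      · exact fun hj => h ⟨j, hj⟩
      · exact hw i
  · rintro ⟨h1, h2⟩
    refine ⟨?_, fun w hw => h2 w fun i => hw (.inr i)⟩
    rintro (j | i)
    · exact h2 _ fun i hi => by simpa using C.inp.injective hi
    · exact h1 i

/-- The wires for unused bits. -/
def junkWires (W : Type) (N K M : ℕ) : List (W ⊕ ExtraWire N K M) :=
  (List.finRange M).map fun j => .inr (junk j)

/-- The wires for the string. -/
def strWires (W : Type) (N K M : ℕ) : List (W ⊕ ExtraWire N K M) :=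
  (List.finRange K).map fun j => .inr (str j)

/-- Choose a uniformly random string, and encrypt with its hash as the key. -/
def shareCircuit (C : Circuit a b (Fin ℓ ⊕ γ) δ) (N M : ℕ) (σ : ι ≃ δ ⊕ Fin K) :
    Circuit (N + 1) M γ ι where
  W := C.W ⊕ ExtraWire N K M
  inp := ⟨fun i => .inl (C.inp (.inr i)), Sum.inl_injective.comp
    (C.inp.injective.comp Sum.inr_injective)⟩
  out := ⟨fun p => Sum.map C.out str (σ p), (Sum.map_injective.mpr ⟨C.out.injective,
    fun _ _ h => by simpa using h⟩).comp σ.injective⟩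
  gates := (junkWires C.W N K M ++ strWires C.W N K M).map .hadamard ++
    ((List.finRange K).map (fun j => .cnot (.inr (str j)) (.inr (copy j)) (by simp)) ++
      tailGates C N K M)

/-- Decrypt with the hash of the string as the key. -/
def reconstructCircuit (C : Circuit a b (Fin ℓ ⊕ γ) δ) (N M : ℕ) (σ : ι ≃ γ ⊕ Fin K) :
    Circuit (N + 1) M ι δ where
  W := C.W ⊕ ExtraWire N K M
  inp := ⟨fun p => Sum.map (fun i => C.inp (.inr i)) str (σ p), (Sum.map_injective.mpr
    ⟨C.inp.injective.comp Sum.inr_injective, fun _ _ h => by simpa using h⟩).comp σ.injective⟩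
  out := ⟨fun i => .inl (C.out i), Sum.inl_injective.comp C.out.injective⟩
  gates := (junkWires C.W N K M).map .hadamard ++ tailGates C N K M

/-- The additional wires after the string has been copied. -/
def shareVec (v : Bool → Bool) (e : ExtraWire N K M → Bool) : ℂ :=
  if (∀ c, e (flag c) = v c) ∧ (∀ i, e (pad i) = false) ∧ ∀ j, e (copy j) = e (str j)
  then (1 / (Real.sqrt 2 : ℂ)) ^ (M + K) else 0

/-- The additional wires when the string is `y`. -/
def reconstructVec (v : Bool → Bool) (y : BitStr K) (e : ExtraWire N K M → Bool) : ℂ :=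
  if (∀ c, e (flag c) = v c) ∧ (∀ i, e (pad i) = false) ∧ (∀ j, e (copy j) = false) ∧
    ∀ j, e (str j) = y j
  then (1 / (Real.sqrt 2 : ℂ)) ^ M else 0

theorem shareVec_isReady :
    IsReady false (shareVec (fun _ => false) : (ExtraWire N K M → Bool) → ℂ) where
  flag_eq e he := by
    simp only [shareVec, ne_eq, ite_eq_right_iff, Classical.not_imp] at he
    exact he.1.1 false
  pad_eq e he := by
    simp only [shareVec, ne_eq, ite_eq_right_iff, Classical.not_imp] at he
    exact he.1.2.1
  junk_inv e e' h := by
    simp only [shareVec, h (flag _) (by simp), h (pad _) (by simp), h (copy _) (by simp),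
      h (str _) (by simp)]

theorem reconstructVec_isReady (y : BitStr K) :
    IsReady false (reconstructVec (fun _ => false) y : (ExtraWire N K M → Bool) → ℂ) where
  flag_eq e he := by
    simp only [reconstructVec, ne_eq, ite_eq_right_iff, Classical.not_imp] at he
    exact he.1.1 false
  pad_eq e he := by
    simp only [reconstructVec, ne_eq, ite_eq_right_iff, Classical.not_imp] at he
    exact he.1.2.1
  junk_inv e e' h := by
    simp only [reconstructVec, h (flag _) (by simp), h (pad _) (by simp), h (copy _) (by simp),
      h (str _) (by simp)]

theorem shareVec_update (e : ExtraWire N K M → Bool) :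
    shareVec (fun _ => false) (Function.update e (flag true) !e (flag true)) =
      shareVec id e := by
  simp [shareVec]

theorem reconstructVec_update (y : BitStr K) (e : ExtraWire N K M → Bool) :
    reconstructVec (fun _ => false) y (Function.update e (flag true) !e (flag true)) =
      reconstructVec id y e := by
  simp [reconstructVec]

/-- This is the form required by `applyGates_hadamard`: the wires that receive Hadamard gates are
zero, and the remaining factor does not depend on them. -/
theorem shareCircuit_embed (C : Circuit a b (Fin ℓ ⊕ γ) δ) (σ : ι ≃ δ ⊕ Fin K) (m : γ → Bool)
    (f : C.W ⊕ ExtraWire N K M → Bool) :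
    (shareCircuit C N M σ).embed f m =
      if ∀ w ∈ junkWires C.W N K M ++ strWires C.W N K M, f w = false then
      C.embed (fun w => f (.inl w)) (Sum.elim (fun _ => false) m) *
        (if (∀ c, f (.inr (flag c)) = false) ∧ (∀ i, f (.inr (pad i)) = false) ∧
          ∀ j, f (.inr (copy j)) = false then 1 else 0) else 0 := by
  rw [embed_zero_key, mul_ite, mul_one, mul_zero, ← ite_and, ← ite_and]
  refine Circuit.embed_eq_ite _ _ _ ?_
  change ((∀ i, f (.inl (C.inp (.inr i))) = m i) ∧ ∀ w : C.W ⊕ ExtraWire N K M,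
    (∀ i : γ, (.inl (C.inp (.inr i)) : C.W ⊕ ExtraWire N K M) ≠ w) → f w = false) ↔ _
  simp only [Sum.forall, List.mem_append, junkWires, strWires, List.mem_map, List.mem_finRange,
    true_and, ne_eq, Sum.inl.injEq, reduceCtorEq, not_false_eq_true, implies_true, true_imp_iff,
    Sum.inr.injEq, exists_false, or_self, false_imp_iff, false_or, or_false, exists_eq]
  tauto

theorem reconstructCircuit_embed [Fintype ι] (C : Circuit a b (Fin ℓ ⊕ γ) δ)
    (σ : ι ≃ γ ⊕ Fin K) (u : ι → Bool) (f : C.W ⊕ ExtraWire N K M → Bool) :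
    (reconstructCircuit C N M σ).embed f u =
      if ∀ w ∈ junkWires C.W N K M, f w = false then
      C.embed (fun w => f (.inl w)) (Sum.elim (fun _ => false) fun i => u (σ.symm (.inl i))) *
        (if (∀ c, f (.inr (flag c)) = false) ∧ (∀ i, f (.inr (pad i)) = false) ∧
          (∀ j, f (.inr (copy j)) = false) ∧ ∀ j, f (.inr (str j)) = u (σ.symm (.inr j))
          then 1 else 0) else 0 := by
  rw [embed_zero_key, mul_ite, mul_one, mul_zero, ← ite_and, ← ite_and]
  refine Circuit.embed_eq_ite _ _ _ ?_
  change ((∀ p, f (Sum.map (fun i => C.inp (.inr i)) str (σ p)) = u p) ∧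
    ∀ w : C.W ⊕ ExtraWire N K M, (∀ p : ι, (Sum.map (fun i => C.inp (.inr i)) str (σ p) :
      C.W ⊕ ExtraWire N K M) ≠ w) → f w = false) ↔ _
  simp only [σ.forall_congr_left, Equiv.apply_symm_apply, Sum.forall, Sum.map_inl, Sum.map_inr,
    junkWires, List.mem_map, List.mem_finRange, true_and, ne_eq, Sum.inl.injEq, reduceCtorEq,
    not_false_eq_true, implies_true, Sum.inr.injEq, exists_false, false_imp_iff, and_true,
    true_imp_iff, exists_eq]
  have h : ∀ x, (∀ j : Fin K, ¬ j = x) ↔ False := fun x => by simp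
  simp only [h, false_imp_iff, implies_true]
  tauto

end Circuits

/-! ### The channels performed by the sharing and reconstruction circuits -/

section Circuits

variable {a b ℓ N K M : ℕ} {γ δ ι : Type} [Fintype γ]

theorem junkWires_nodup (W : Type) (N K M : ℕ) : (junkWires W N K M).Nodup :=
  (List.nodup_finRange M).map fun _ _ h => by simpa using h

theorem strWires_nodup (W : Type) (N K M : ℕ) : (strWires W N K M).Nodup :=
  (List.nodup_finRange K).map fun _ _ h => by simpa using h

theorem shareWires_nodup (W : Type) (N K M : ℕ) :
    (junkWires W N K M ++ strWires W N K M).Nodup := by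
  refine (junkWires_nodup W N K M).append (strWires_nodup W N K M) ?_
  intro w h1 h2
  simp only [junkWires, strWires, List.mem_map] at h1 h2
  obtain ⟨j, -, rfl⟩ := h1
  obtain ⟨j', -, h⟩ := h2
  simp at h

/-- The Hadamard gates put the string and the surplus wires into uniform superposition, the
controlled nots tie the copy to the string, and the tail then encrypts under the hash of the string.
-/
theorem applyGates_share (C : Circuit a b (Fin ℓ ⊕ γ) δ) (O : Oracle (N + 1) M) (m : γ → Bool) :
    applyGates O ((junkWires C.W N K M ++ strWires C.W N K M).map .hadamard ++
      ((List.finRange K).map (fun j => .cnot (.inr (str j)) (.inr (copy j)) (by simp)) ++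
        tailGates C N K M))
      (fun f => if ∀ w ∈ junkWires C.W N K M ++ strWires C.W N K M, f w = false then
        C.embed (fun w => f (.inl w)) (Sum.elim (fun _ => false) m) *
          (if (∀ c, f (.inr (flag c)) = false) ∧ (∀ i, f (.inr (pad i)) = false) ∧
            ∀ j, f (.inr (copy j)) = false then 1 else 0) else 0) =
    jointVec (fun y g => C.isometry (domainOracle false a b O) g
      (Sum.elim (domainOracle true K ℓ O y) m)) (shareVec id) := by
  have hx : ∀ x y : Bool, (xor x y = false) = (x = y) := by decide
  rw [applyGates_append, applyGates_hadamard O _ (shareWires_nodup C.W N K M) (fun f =>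
    C.embed (fun w => f (.inl w)) (Sum.elim (fun _ => false) m) *
      (if (∀ c, f (.inr (flag c)) = false) ∧ (∀ i, f (.inr (pad i)) = false) ∧
        ∀ j, f (.inr (copy j)) = false then 1 else 0)) _ ?_ (fun f hf => if_pos hf)
      (fun f hf => if_neg hf), applyGates_append]
  swap
  · intro w hw f x
    simp only [junkWires, strWires, List.mem_append, List.mem_map] at hw
    rcases hw with ⟨j, -, rfl⟩ | ⟨j, -, rfl⟩ <;> simp
  have h1 : applyGates O ((List.finRange K).map fun j =>
      .cnot (.inr (str j)) (.inr (copy j)) (by simp)) (fun f : C.W ⊕ ExtraWire N K M → Bool =>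
      (1 / (Real.sqrt 2 : ℂ)) ^ (junkWires C.W N K M ++ strWires C.W N K M).length *
      (C.embed (fun w => f (.inl w)) (Sum.elim (fun _ => false) m) *
        (if (∀ c, f (.inr (flag c)) = false) ∧ (∀ i, f (.inr (pad i)) = false) ∧
          ∀ j, f (.inr (copy j)) = false then 1 else 0))) =
      jointVec (fun _ g => C.embed g (Sum.elim (fun _ => false) m))
        (shareVec fun _ => false) := by
    funext f
    refine (applyGates_cnot O (fun j : Fin K => (.inr (str j) : C.W ⊕ ExtraWire N K M))
      (fun j => .inr (copy j)) (fun _ _ h => by simpa using h) (by simp) _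
      (List.nodup_finRange K) _ _).trans ?_
    simp only [jointVec, shareVec, junkWires, strWires, List.length_append, List.length_map,
      List.length_finRange, reduceCtorEq, false_and, and_false, exists_false,
      decide_false, Bool.xor_false, Sum.inr.injEq, Sum.inl.injEq, exists_eq_left,
      List.mem_finRange, true_and, Bool.decide_eq_true, hx]
    rw [mul_left_comm, mul_ite, mul_one, mul_zero]
  rw [h1, applyGates_tail C O m shareVec_isReady]
  · simp only [shareVec_update]
  · intro e he
    simp only [shareVec, ne_eq, ite_eq_right_iff, Classical.not_imp] at he
    exact he.1.1 true

theorem shareCircuit_isometry (C : Circuit a b (Fin ℓ ⊕ γ) δ) (σ : ι ≃ δ ⊕ Fin K)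
    (O : Oracle (N + 1) M) (m : γ → Bool) (f : C.W ⊕ ExtraWire N K M → Bool) :
    (shareCircuit C N M σ).isometry O f m = jointVec (fun y g =>
      C.isometry (domainOracle false a b O) g (Sum.elim (domainOracle true K ℓ O y) m))
        (shareVec id) f := by
  rw [← applyGates_share]
  refine (Circuit.isometry_apply (shareCircuit C N M σ) O f m).trans ?_
  exact congrArg (fun v => applyGates O (shareCircuit C N M σ).gates v f)
    (funext (shareCircuit_embed C σ m))

theorem applyGates_reconstruct (C : Circuit a b (Fin ℓ ⊕ γ) δ) (O : Oracle (N + 1) M)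
    (m : γ → Bool) (y : BitStr K) :
    applyGates O ((junkWires C.W N K M).map .hadamard ++ tailGates C N K M)
      (fun f => if ∀ w ∈ junkWires C.W N K M, f w = false then
        C.embed (fun w => f (.inl w)) (Sum.elim (fun _ => false) m) *
          (if (∀ c, f (.inr (flag c)) = false) ∧ (∀ i, f (.inr (pad i)) = false) ∧
            (∀ j, f (.inr (copy j)) = false) ∧ ∀ j, f (.inr (str j)) = y j then 1 else 0) else 0) =
    jointVec (fun y g => C.isometry (domainOracle false a b O) g
      (Sum.elim (domainOracle true K ℓ O y) m)) (reconstructVec id y) := by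
  rw [applyGates_append, applyGates_hadamard O _ (junkWires_nodup C.W N K M) (fun f =>
    C.embed (fun w => f (.inl w)) (Sum.elim (fun _ => false) m) *
      (if (∀ c, f (.inr (flag c)) = false) ∧ (∀ i, f (.inr (pad i)) = false) ∧
        (∀ j, f (.inr (copy j)) = false) ∧ ∀ j, f (.inr (str j)) = y j then 1 else 0)) _ ?_
      (fun f hf => if_pos hf) (fun f hf => if_neg hf)]
  swap
  · intro w hw f x
    simp only [junkWires, List.mem_map] at hw
    obtain ⟨j, -, rfl⟩ := hw
    simp
  have h1 : (fun f : C.W ⊕ ExtraWire N K M → Bool =>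
      (1 / (Real.sqrt 2 : ℂ)) ^ (junkWires C.W N K M).length *
      (C.embed (fun w => f (.inl w)) (Sum.elim (fun _ => false) m) *
        (if (∀ c, f (.inr (flag c)) = false) ∧ (∀ i, f (.inr (pad i)) = false) ∧
          (∀ j, f (.inr (copy j)) = false) ∧ ∀ j, f (.inr (str j)) = y j then 1 else 0))) =
      jointVec (fun _ g => C.embed g (Sum.elim (fun _ => false) m))
        (reconstructVec (fun _ => false) y) := by
    funext f
    simp only [jointVec, reconstructVec, junkWires, List.length_map, List.length_finRange]
    rw [mul_left_comm, mul_ite, mul_one, mul_zero]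
  rw [h1, applyGates_tail C O m (reconstructVec_isReady y)]
  · simp only [reconstructVec_update]
  · intro e he
    simp only [reconstructVec, ne_eq, ite_eq_right_iff, Classical.not_imp] at he
    exact he.1.1 true

theorem reconstructCircuit_isometry [Fintype ι] (C : Circuit a b (Fin ℓ ⊕ γ) δ)
    (σ : ι ≃ γ ⊕ Fin K) (O : Oracle (N + 1) M) (u : ι → Bool)
    (f : C.W ⊕ ExtraWire N K M → Bool) :
    (reconstructCircuit C N M σ).isometry O f u = jointVec (fun y g =>
      C.isometry (domainOracle false a b O) g
        (Sum.elim (domainOracle true K ℓ O y) fun i => u (σ.symm (.inl i))))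
        (reconstructVec id fun j => u (σ.symm (.inr j))) f := by
  rw [← applyGates_reconstruct]
  refine (Circuit.isometry_apply (reconstructCircuit C N M σ) O f u).trans ?_
  exact congrArg (fun v => applyGates O (reconstructCircuit C N M σ).gates v f)
    (funext (reconstructCircuit_embed C σ u))

theorem inv_sqrt_two_pow_mul_star (r : ℕ) :
    (1 / (Real.sqrt 2 : ℂ)) ^ r * star ((1 / (Real.sqrt 2 : ℂ)) ^ r) = (1 / 2) ^ r := by
  rw [star_pow, ← mul_pow]
  congr 1
  rw [star_div₀, star_one, Complex.star_def, Complex.conj_ofReal, div_mul_div_comm,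
    sqrt_two_mul_self, one_mul]

variable [Fintype δ] [Fintype ι]

theorem forall_sum_elim_iff {ι W α : Type} (out : α → W) (τ : ι ≃ α ⊕ Fin K) (s : ι → Bool)
    (f : W → Bool) (e : ExtraWire N K M → Bool) :
    (∀ p, (Sum.elim f e : W ⊕ ExtraWire N K M → Bool) (Sum.map out str (τ p)) = s p) ↔
      (∀ j, f (out j) = s (τ.symm (.inl j))) ∧ ∀ j, e (str j) = s (τ.symm (.inr j)) := by
  simp only [τ.forall_congr_left, Equiv.apply_symm_apply, Sum.forall, Sum.map_inl, Sum.map_inr,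
    Sum.elim_inl, Sum.elim_inr]

/-- The copy of the string is among the discarded wires, which acts as a measurement: matrix
elements between different strings vanish, and each string has probability `2⁻ᴷ`. -/
theorem choi_shareCircuit (C : Circuit a b (Fin ℓ ⊕ γ) δ) (σ : ι ≃ δ ⊕ Fin K)
    (O : Oracle (N + 1) M) (u u' : γ → Bool) (s t : ι → Bool) :
    ((shareCircuit C N M σ).toKraus O).choi u u' s t =
      if (fun j => s (σ.symm (.inr j))) = fun j => t (σ.symm (.inr j)) then
        (1 / 2) ^ K * (C.toKraus (domainOracle false a b O)).choi
          (Sum.elim (domainOracle true K ℓ O fun j => s (σ.symm (.inr j))) u)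
          (Sum.elim (domainOracle true K ℓ O fun j => s (σ.symm (.inr j))) u')
          (fun j => s (σ.symm (.inl j))) (fun j => t (σ.symm (.inl j))) else 0 := by
  classical
  let Φ : (γ → Bool) → (ExtraWire N K M → Bool) → (C.W → Bool) → ℂ := fun u e g =>
    C.isometry (domainOracle false a b O) g
      (Sum.elim (domainOracle true K ℓ O fun j => e (str j)) u)
  have hr : ∀ (f g : C.W → Bool) (e e' : ExtraWire N K M → Bool),
      shareVec id e ≠ 0 → shareVec id e' ≠ 0 →
      (if (∀ p, (Sum.elim f e : C.W ⊕ ExtraWire N K M → Bool) (Sum.map C.out str (σ p)) = s p) ∧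
        (∀ p, (Sum.elim g e' : C.W ⊕ ExtraWire N K M → Bool) (Sum.map C.out str (σ p)) = t p) ∧
        ∀ w, (∀ p, Sum.map C.out str (σ p) ≠ w) →
          (Sum.elim f e : C.W ⊕ ExtraWire N K M → Bool) w = Sum.elim g e' w
        then (1 : ℂ) else 0) =
      if e' = e then (if (fun j => e (str j)) = (fun j => s (σ.symm (.inr j))) ∧
        (fun j => e (str j)) = (fun j => t (σ.symm (.inr j))) then 1 else 0) *
        (if (∀ j, f (C.out j) = s (σ.symm (.inl j))) ∧ (∀ j, g (C.out j) = t (σ.symm (.inl j))) ∧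
          ∀ w, (∀ j, C.out j ≠ w) → f w = g w then 1 else 0) else 0 := by
    intro f g e e' he he'
    simp only [shareVec, ne_eq, ite_eq_right_iff, Classical.not_imp] at he he'
    rw [ite_zero_mul_ite_zero, mul_one, ← ite_and]
    refine if_congr ?_ rfl rfl
    have hs : ∀ v : ι → Bool, (fun j => e (str j)) = (fun j => v (σ.symm (.inr j))) ↔
        ∀ j, e (str j) = v (σ.symm (.inr j)) := fun _ => funext_iff
    rw [forall_sum_elim_iff, forall_sum_elim_iff, hs, hs]
    simp only [σ.forall_congr_left, Equiv.apply_symm_apply, Sum.forall, Sum.map_inl, Sum.map_inr,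
      ne_eq, Sum.inl.injEq, reduceCtorEq, not_false_eq_true, implies_true, and_true,
      Sum.inr.injEq, true_imp_iff, true_and, Sum.elim_inl, Sum.elim_inr]
    -- The string itself is output and not compared by the partial trace; equality of the two
    -- strings comes from the discarded copies.
    have hee : (∀ j, e (copy j) = e' (copy j)) → ((∀ c, e (flag c) = e' (flag c)) ∧
        (∀ i, e (pad i) = e' (pad i)) ∧ (∀ j, e (junk j) = e' (junk j)) → e' = e) := by
      rintro h1 ⟨h2, h3, h4⟩
      funext x
      rcases x with c | i | j | j | j
      · exact (h2 c).symm
      · exact (h3 i).symm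
      · exact (he'.1.2.2 j).symm.trans ((h1 j).symm.trans (he.1.2.2 j))
      · exact (h1 j).symm
      · exact (h4 j).symm
    constructor
    · rintro ⟨⟨h1, h2⟩, ⟨h3, h4⟩, h5, h6, h7, -, h8, h9⟩
      obtain rfl := hee h8 ⟨h6, h7, h9⟩
      exact ⟨rfl, ⟨h2, h4⟩, h1, h3, h5⟩
    · rintro ⟨rfl, ⟨h2, h4⟩, h1, h3, h5⟩
      exact ⟨⟨h1, h2⟩, ⟨h3, h4⟩, h5, fun _ => rfl, fun _ => rfl, fun _ _ => rfl, fun _ => rfl,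
        fun _ => rfl⟩
  refine (Circuit.choi_toKraus_eq_sum (shareCircuit C N M σ) O u u' s t
    (fun f g : C.W ⊕ ExtraWire N K M → Bool =>
      if (∀ p, f (Sum.map C.out str (σ p)) = s p) ∧ (∀ p, g (Sum.map C.out str (σ p)) = t p) ∧
        ∀ w, (∀ p, Sum.map C.out str (σ p) ≠ w) → f w = g w then 1 else 0)
    (fun _ _ h => if_pos h) (fun _ _ h => if_neg h)).trans ?_
  refine (Finset.sum_congr rfl fun f _ => Finset.sum_congr rfl fun g _ => congrArg₂ (· * ·)
    (congrArg₂ (· * ·) (shareCircuit_isometry C σ O u f)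
      (congrArg star (shareCircuit_isometry C σ O u' g))) rfl).trans ?_
  refine (sum_jointVec (Φ u) (Φ u') (shareVec id) (shareVec id) _ _ _ hr).trans ?_
  simp only [Φ, ← Circuit.choi_toKraus]
  let G : BitStr K → ℂ := fun y => if y = (fun j => s (σ.symm (.inr j))) ∧
    y = (fun j => t (σ.symm (.inr j))) then (1 / 2) ^ (M + K) *
      (C.toKraus (domainOracle false a b O)).choi (Sum.elim (domainOracle true K ℓ O y) u)
      (Sum.elim (domainOracle true K ℓ O y) u')
      (fun j => s (σ.symm (.inl j))) (fun j => t (σ.symm (.inl j))) else 0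
  have hG : ∀ e : ExtraWire N K M → Bool,
      (if (fun j => e (str j)) = (fun j => s (σ.symm (.inr j))) ∧
        (fun j => e (str j)) = (fun j => t (σ.symm (.inr j))) then 1 else 0) *
        (shareVec id e * star (shareVec id e)) *
        (C.toKraus (domainOracle false a b O)).choi
          (Sum.elim (domainOracle true K ℓ O fun j => e (str j)) u)
          (Sum.elim (domainOracle true K ℓ O fun j => e (str j)) u')
          (fun j => s (σ.symm (.inl j))) (fun j => t (σ.symm (.inl j))) =
      if (∀ c, e (flag c) = c) ∧ (∀ i, e (pad i) = false) ∧
        (∀ j, e (copy j) = id (fun i => e (str i)) j) then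
        G (fun j => e (str j)) else 0 := by
    intro e
    have he : shareVec id e * star (shareVec id e) = if (∀ c, e (flag c) = c) ∧
        (∀ i, e (pad i) = false) ∧ (∀ j, e (copy j) = id (fun i => e (str i)) j) then
        (1 / 2) ^ (M + K) else 0 := by
      simp only [shareVec, id]
      split_ifs
      · exact inv_sqrt_two_pow_mul_star _
      · simp
    rw [he]
    simp only [G, ite_mul, mul_ite, zero_mul, mul_zero, one_mul]
  refine (Finset.sum_congr rfl fun e _ => hG e).trans ((sum_extraWire id G).trans ?_)
  split_ifs with h
  -- The sum over the surplus wires gives `2 ^ M`, which cancels their share of the normalisation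
  -- `(1 / 2) ^ (M + K)`.
  · have hv : G (fun j => s (σ.symm (.inr j))) = _ := if_pos ⟨rfl, h⟩
    rw [Finset.sum_eq_single fun j => s (σ.symm (.inr j)), hv, pow_add,
      ← mul_assoc, ← mul_assoc, ← mul_pow]
    · norm_num
    · intro y _ hy
      exact if_neg fun hh => hy hh.1
    · simp
  · rw [Finset.sum_eq_zero fun y _ => if_neg fun hh => h (hh.1.symm.trans hh.2), mul_zero]

/-- Here the string wires are discarded themselves, which amounts to the measurement of `y₁, …, yₙ`;
the copy wires stay at zero. -/
theorem choi_reconstructCircuit [DecidableEq γ] (C : Circuit a b (Fin ℓ ⊕ γ) δ)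
    (σ : ι ≃ γ ⊕ Fin K) (O : Oracle (N + 1) M) (u u' : ι → Bool) (s t : δ → Bool) :
    ((reconstructCircuit C N M σ).toKraus O).choi u u' s t =
      if (fun j => u (σ.symm (.inr j))) = fun j => u' (σ.symm (.inr j)) then
        (C.toKraus (domainOracle false a b O)).choi
          (Sum.elim (domainOracle true K ℓ O fun j => u (σ.symm (.inr j)))
            fun i => u (σ.symm (.inl i)))
          (Sum.elim (domainOracle true K ℓ O fun j => u (σ.symm (.inr j)))
            fun i => u' (σ.symm (.inl i))) s t else 0 := by
  classical
  let Φ : (ι → Bool) → (ExtraWire N K M → Bool) → (C.W → Bool) → ℂ := fun u e g =>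
    C.isometry (domainOracle false a b O) g
      (Sum.elim (domainOracle true K ℓ O fun j => e (str j)) fun i => u (σ.symm (.inl i)))
  let χ : (ι → Bool) → (ExtraWire N K M → Bool) → ℂ := fun u =>
    reconstructVec id fun j => u (σ.symm (.inr j))
  have hr : ∀ (f g : C.W → Bool) (e e' : ExtraWire N K M → Bool),
      χ u e ≠ 0 → χ u' e' ≠ 0 →
      (if (∀ j, (Sum.elim f e : C.W ⊕ ExtraWire N K M → Bool) (.inl (C.out j)) = s j) ∧
        (∀ j, (Sum.elim g e' : C.W ⊕ ExtraWire N K M → Bool) (.inl (C.out j)) = t j) ∧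
        ∀ w, (∀ j, .inl (C.out j) ≠ w) →
          (Sum.elim f e : C.W ⊕ ExtraWire N K M → Bool) w = Sum.elim g e' w
        then (1 : ℂ) else 0) =
      if e' = e then 1 * (if (∀ j, f (C.out j) = s j) ∧ (∀ j, g (C.out j) = t j) ∧
          ∀ w, (∀ j, C.out j ≠ w) → f w = g w then 1 else 0) else 0 := by
    intro f g e e' _ _
    rw [one_mul, ← ite_and]
    refine if_congr ?_ rfl rfl
    have hee : e' = e ↔ ∀ x, e x = e' x := eq_comm.trans funext_iff
    rw [hee]
    simp only [Sum.forall (α := C.W) (β := ExtraWire N K M), ne_eq, Sum.inl.injEq, reduceCtorEq,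
      not_false_eq_true, implies_true, true_imp_iff, Sum.elim_inl, Sum.elim_inr]
    tauto
  refine (Circuit.choi_toKraus_eq_sum (reconstructCircuit C N M σ) O u u' s t
    (fun f g : C.W ⊕ ExtraWire N K M → Bool =>
      if (∀ j, f (.inl (C.out j)) = s j) ∧ (∀ j, g (.inl (C.out j)) = t j) ∧
        ∀ w, (∀ j, (.inl (C.out j) : C.W ⊕ ExtraWire N K M) ≠ w) → f w = g w then 1 else 0)
    (fun _ _ h => if_pos h) (fun _ _ h => if_neg h)).trans ?_
  refine (Finset.sum_congr rfl fun f _ => Finset.sum_congr rfl fun g _ => congrArg₂ (· * ·)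
    (congrArg₂ (· * ·) (reconstructCircuit_isometry C σ O u f)
      (congrArg star (reconstructCircuit_isometry C σ O u' g))) rfl).trans ?_
  refine (sum_jointVec (Φ u) (Φ u') (χ u) (χ u') _ _ _ hr).trans ?_
  simp only [Φ, χ, ← Circuit.choi_toKraus]
  let G : BitStr K → ℂ := fun y => if y = (fun j => u (σ.symm (.inr j))) ∧
    y = (fun j => u' (σ.symm (.inr j))) then (1 / 2) ^ M *
      (C.toKraus (domainOracle false a b O)).choi
      (Sum.elim (domainOracle true K ℓ O y) fun i => u (σ.symm (.inl i)))
      (Sum.elim (domainOracle true K ℓ O y) fun i => u' (σ.symm (.inl i))) s t else 0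
  have hG : ∀ e : ExtraWire N K M → Bool,
      1 * (reconstructVec id (fun j => u (σ.symm (.inr j))) e *
        star (reconstructVec id (fun j => u' (σ.symm (.inr j))) e)) *
        (C.toKraus (domainOracle false a b O)).choi
          (Sum.elim (domainOracle true K ℓ O fun j => e (str j)) fun i => u (σ.symm (.inl i)))
          (Sum.elim (domainOracle true K ℓ O fun j => e (str j)) fun i => u' (σ.symm (.inl i)))
          s t =
      if (∀ c, e (flag c) = c) ∧ (∀ i, e (pad i) = false) ∧
        (∀ j, e (copy j) = (fun _ _ => false) (fun i => e (str i)) j) then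
        G (fun j => e (str j)) else 0 := by
    intro e
    have he : reconstructVec id (fun j => u (σ.symm (.inr j))) e *
        star (reconstructVec id (fun j => u' (σ.symm (.inr j))) e) =
        if (∀ c, e (flag c) = c) ∧ (∀ i, e (pad i) = false) ∧
          (∀ j, e (copy j) = (fun _ _ => false) (fun i => e (str i)) j) then
        (if (fun j => e (str j)) = (fun j => u (σ.symm (.inr j))) ∧
          (fun j => e (str j)) = (fun j => u' (σ.symm (.inr j))) then (1 / 2) ^ M else 0)
        else 0 := by
      simp only [reconstructVec, id, funext_iff]
      rw [← inv_sqrt_two_pow_mul_star]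
      split_ifs <;> first | rfl | (exfalso; tauto) | simp
    rw [he]
    simp only [G, ite_mul, zero_mul, one_mul]
  refine (Finset.sum_congr rfl fun e _ => hG e).trans
    ((sum_extraWire (fun _ _ => false) G).trans ?_)
  split_ifs with h
  · have hv : G (fun j => u (σ.symm (.inr j))) = _ := if_pos ⟨rfl, h⟩
    rw [Finset.sum_eq_single fun j => u (σ.symm (.inr j)), hv, ← mul_assoc,
      ← mul_pow]
    · norm_num
    · intro y _ hy
      exact if_neg fun hh => hy hh.1
    · simp
  · rw [Finset.sum_eq_zero fun y _ => if_neg fun hh => h (hh.1.symm.trans hh.2), mul_zero]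

end Circuits

/-! ### The hash-based scheme -/

section Shares

variable {n ct k : ℕ}

/-- A string as the sequence of its blocks. -/
def concatEquiv (n k : ℕ) : (Fin n → BitStr k) ≃ BitStr (n * k) where
  toFun := concat
  invFun x := fun i j => x (finProdFinEquiv (i, j))
  left_inv y := by
    funext i j
    simp [concat]
  right_inv x := by
    funext j
    exact congrArg x (finProdFinEquiv.apply_symm_apply j)

theorem concat_injective : Function.Injective (concat : (Fin n → BitStr k) → BitStr (n * k)) :=
  (concatEquiv n k).injective

/-- The wires of the shares hold a ciphertext and a string. -/
def shareEquiv (hn : 0 < n) (ct k : ℕ) :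
    (Σ i : Fin n, Fin (hashShareLen n ct k i)) ≃ Fin ct ⊕ Fin (n * k) where
  toFun p := Fin.addCases (motive := fun _ => Fin ct ⊕ Fin (n * k))
    (fun j : Fin (if p.1.val = 0 then ct else 0) => .inl ⟨j, j.2.trans_le (by split_ifs <;> simp)⟩)
    (fun j => .inr (finProdFinEquiv (p.1, j))) p.2
  invFun := Sum.elim
    (fun j => ⟨⟨0, hn⟩, Fin.castAdd k (Fin.cast (if_pos rfl).symm j)⟩)
    (fun j => ⟨(finProdFinEquiv.symm j).1, Fin.natAdd _ (finProdFinEquiv.symm j).2⟩)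
  left_inv := by
    rintro ⟨i, j⟩
    change Fin ((if i.val = 0 then ct else 0) + k) at j
    refine Fin.addCases (fun j => ?_) (fun j => ?_) j
    · by_cases hi : i.val = 0
      · obtain rfl : i = ⟨0, hn⟩ := Fin.ext hi
        simp only [Fin.addCases_left, Sum.elim_inl]
        rfl
      · exact absurd j.2 (by simp [hi])
    · simp only [Fin.addCases_right, Sum.elim_inr]
      rw [Equiv.symm_apply_apply]
  right_inv := by
    rintro (j | j)
    · exact Fin.addCases_left (Fin.cast (if_pos rfl).symm j)
    · exact (Fin.addCases_right _).trans (congrArg Sum.inr (finProdFinEquiv.apply_symm_apply j))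

theorem joinShares_apply (hn : 0 < n) (c : BitStr ct) (y : Fin n → BitStr k)
    (p : Σ i : Fin n, Fin (hashShareLen n ct k i)) :
    joinShares c y p.1 p.2 = Sum.elim c (concat y) (shareEquiv hn ct k p) := by
  obtain ⟨i, j⟩ := p
  change Fin ((if i.val = 0 then ct else 0) + k) at j
  refine Fin.addCases (fun j => ?_) (fun j => ?_) j
  · have hj : j.val < ct := j.2.trans_le (by split_ifs <;> simp)
    simp [joinShares, shareEquiv, bit, hj]
  · simp [joinShares, shareEquiv, concat]

theorem joinShares_bijective (hn : 0 < n) : Function.Bijective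
    fun p : BitStr ct × (Fin n → BitStr k) => joinShares p.1 p.2 := by
  constructor
  · rintro ⟨c, y⟩ ⟨c', y'⟩ h
    have h1 : ∀ x, Sum.elim c (concat y) x = Sum.elim c' (concat y') x := by
      intro x
      have h2 := congrFun (congrFun h ((shareEquiv hn ct k).symm x).1)
        ((shareEquiv hn ct k).symm x).2
      simp only at h2
      rw [joinShares_apply hn, joinShares_apply hn] at h2
      simpa using h2
    rw [Prod.mk.injEq]
    exact ⟨funext fun j => h1 (.inl j), concat_injective (funext fun j => h1 (.inr j))⟩
  · intro s
    let v : Fin ct ⊕ Fin (n * k) → Bool := fun x =>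
      s ((shareEquiv hn ct k).symm x).1 ((shareEquiv hn ct k).symm x).2
    refine ⟨(fun j => v (.inl j), (concatEquiv n k).symm fun j => v (.inr j)), ?_⟩
    funext i j
    refine (joinShares_apply hn _ _ ⟨i, j⟩).trans ?_
    have h1 : concat ((concatEquiv n k).symm fun j => v (.inr j)) = fun j => v (.inr j) :=
      (concatEquiv n k).apply_symm_apply fun j => v (.inr j)
    rw [h1]
    have h2 : ∀ x, Sum.elim (fun j => v (.inl j)) (fun j => v (.inr j)) x = v x := by
      rintro (j | j) <;> rfl
    rw [h2]
    simp only [v]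
    rw [Equiv.symm_apply_apply]

/-- The basis states of the shares. -/
def joinEquiv (hn : 0 < n) (ct k : ℕ) :
    BitStr ct × (Fin n → BitStr k) ≃ ∀ i, BitStr (hashShareLen n ct k i) :=
  Equiv.ofBijective _ (joinShares_bijective hn)

end Shares

theorem Circuit.eval_ket {a b : ℕ} {α β : Type} [Fintype α] [DecidableEq α] [Fintype β]
    [DecidableEq β] (C : Circuit a b α β) (O : Oracle a b) (u : α → Bool) (s t : β → Bool) :
    C.eval O (ket u) s t = (C.toKraus O).choi u u s t := by
  rw [C.eval_eq_apply, Kraus.apply_apply, Finset.sum_eq_single u, Finset.sum_eq_single u]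
  · simp [ket]
  · intro v _ hv
    simp [ket, hv.symm]
  · simp
  · intro v _ hv
    simp [ket, hv.symm]
  · simp

theorem UEScheme.decState_apply (E : UEScheme) (lam : ℕ) (O : Oracle (E.oIn lam) (E.oOut lam))
    (sk : BitStr (E.keyLen lam)) (ρ : Matrix (BitStr (E.ctLen lam)) (BitStr (E.ctLen lam)) ℂ)
    (m m' : BitStr (E.msgLen lam)) : E.decState lam O sk ρ m m' =
      ∑ c, ∑ c', ρ c c' *
        ((E.dec lam).toKraus O).choi (Sum.elim sk c) (Sum.elim sk c') m m' := by
  have hsum : ∀ F : (Fin (E.keyLen lam) ⊕ Fin (E.ctLen lam) → Bool) → ℂ, ∑ u,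
      (if (fun i => u (Sum.inl i)) = sk then F u else 0) = ∑ c, F (Sum.elim sk c) := by
    intro F
    rw [← Equiv.sum_comp (Equiv.sumArrowEquivProdArrow _ _ Bool).symm, Fintype.sum_prod_type,
      Finset.sum_eq_single sk]
    · exact Finset.sum_congr rfl fun c _ => if_pos rfl
    · intro s _ hs
      exact Finset.sum_eq_zero fun c _ => if_neg hs
    · simp
  rw [UEScheme.decState, Circuit.eval_eq_apply, Kraus.apply_apply]
  simp only [Matrix.of_apply, ite_mul, zero_mul, ite_and]
  refine Eq.trans ?_ (hsum fun u => ∑ c', ρ (fun i => u (.inr i)) c' *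
    ((E.dec lam).toKraus O).choi u (Sum.elim sk c') m m')
  refine Finset.sum_congr rfl fun u _ => ?_
  split_ifs
  · exact hsum fun v => ρ (fun i => u (.inr i)) (fun i => v (.inr i)) *
      ((E.dec lam).toKraus O).choi u v m m'
  · simp

theorem shareCircuit_size {a b ℓ K : ℕ} {γ δ ι : Type} (C : Circuit a b (Fin ℓ ⊕ γ) δ)
    (N M : ℕ) (σ : ι ≃ δ ⊕ Fin K) :
    (shareCircuit C N M σ).size = C.size + 9 + N + 4 * K + 2 * M := by
  have h1 : Fintype.card (C.W ⊕ ExtraWire N K M) =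
      Fintype.card C.W + (2 + (N + (K + (K + M)))) := by
    simp
  have h2 : (shareCircuit C N M σ).gates.length = M + K + (K + (6 + (C.gates.length + 1))) := by
    simp [shareCircuit, tailGates, notGates, junkWires, strWires]
    omega
  change Fintype.card (C.W ⊕ ExtraWire N K M) + _ =
    Fintype.card C.W + C.gates.length + _ + _ + _ + _
  omega

theorem reconstructCircuit_size {a b ℓ K : ℕ} {γ δ ι : Type} (C : Circuit a b (Fin ℓ ⊕ γ) δ)
    (N M : ℕ) (σ : ι ≃ γ ⊕ Fin K) :
    (reconstructCircuit C N M σ).size = C.size + 9 + N + 2 * K + 2 * M := by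
  have h1 : Fintype.card (C.W ⊕ ExtraWire N K M) =
      Fintype.card C.W + (2 + (N + (K + (K + M)))) := by
    simp
  have h2 : (reconstructCircuit C N M σ).gates.length = M + (6 + (C.gates.length + 1)) := by
    simp [reconstructCircuit, tailGates, notGates, junkWires]
    omega
  change Fintype.card (C.W ⊕ ExtraWire N K M) + _ =
    Fintype.card C.W + C.gates.length + _ + _ + _ + _
  omega

section Scheme

variable (E : UEScheme) (k : ℕ → ℕ) {n : ℕ} (hn : 0 < n)

/-- The hash-based scheme. -/
def hashScheme : USSScheme n E.msgLen (fun lam => hashShareLen n (E.ctLen lam) (k lam))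
    (hashIn E k n) (hashOut E) where
  share lam := shareCircuit (E.enc lam) (max (E.oIn lam) (n * k lam)) (hashOut E lam)
    (shareEquiv hn (E.ctLen lam) (k lam))
  reconstruct lam := reconstructCircuit (E.dec lam) (max (E.oIn lam) (n * k lam)) (hashOut E lam)
    (shareEquiv hn (E.ctLen lam) (k lam))

variable {E k}

theorem hashScheme_shareState_apply (lam : ℕ) (O : Oracle (hashIn E k n lam) (hashOut E lam))
    (m : BitStr (E.msgLen lam)) (c c' : BitStr (E.ctLen lam)) (y y' : Fin n → BitStr (k lam)) :
    (hashScheme E k hn).shareState lam O m (joinShares c y) (joinShares c' y') =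
      if y = y' then (1 / 2) ^ (n * k lam) *
        E.encState lam (encOracle _ _ O) (hashKey E k n lam O y) m c c' else 0 := by
  have h1 : ∀ (c : BitStr (E.ctLen lam)) (y : Fin n → BitStr (k lam)) j,
      joinShares c y ((shareEquiv hn _ _).symm (.inl j)).1
        ((shareEquiv hn _ _).symm (.inl j)).2 = c j := by
    intro c y j
    rw [joinShares_apply hn, Equiv.apply_symm_apply, Sum.elim_inl]
  have h2 : ∀ (c : BitStr (E.ctLen lam)) (y : Fin n → BitStr (k lam)) j,
      joinShares c y ((shareEquiv hn _ _).symm (.inr j)).1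
        ((shareEquiv hn _ _).symm (.inr j)).2 = concat y j := by
    intro c y j
    rw [joinShares_apply hn, Equiv.apply_symm_apply, Sum.elim_inr]
  refine (Circuit.eval_ket _ _ _ _ _).trans ((choi_shareCircuit _ _ _ _ _ _ _).trans ?_)
  simp only [h1, h2]
  refine if_congr concat_injective.eq_iff ?_ rfl
  rw [UEScheme.encState, Circuit.eval_ket]
  rfl

theorem hashScheme_reconstructState_apply (lam : ℕ)
    (O : Oracle (hashIn E k n lam) (hashOut E lam)) (ρ : Matrix
      (∀ i : Fin n, BitStr (hashShareLen n (E.ctLen lam) (k lam) i))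
      (∀ i : Fin n, BitStr (hashShareLen n (E.ctLen lam) (k lam) i)) ℂ) :
    (hashScheme E k hn).reconstructState lam O ρ =
      ∑ y : Fin n → BitStr (k lam),
        E.decState lam (encOracle _ _ O) (hashKey E k n lam O y)
          (ρ.submatrix (fun c => joinShares c y) (fun c => joinShares c y)) := by
  let e : BitStr (E.ctLen lam) × (Fin n → BitStr (k lam)) ≃
      ((Σ i : Fin n, Fin (hashShareLen n (E.ctLen lam) (k lam) i)) → Bool) :=
    (joinEquiv hn _ _).trans (Equiv.piCurry fun _ _ => Bool).symm
  have he : ∀ c y p, e (c, y) p = joinShares c y p.1 p.2 := fun _ _ _ => rfl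
  have h1 : ∀ c y j, e (c, y) ((shareEquiv hn _ _).symm (.inl j)) = c j := by
    intro c y j
    rw [he, joinShares_apply hn, Equiv.apply_symm_apply, Sum.elim_inl]
  have h2 : ∀ c y j, e (c, y) ((shareEquiv hn _ _).symm (.inr j)) = concat y j := by
    intro c y j
    rw [he, joinShares_apply hn, Equiv.apply_symm_apply, Sum.elim_inr]
  ext m m'
  refine (congrFun (congrFun (Circuit.eval_eq_apply _ O _) m) m').trans
    ((Kraus.apply_apply _ _ m m').trans ?_)
  refine (Finset.sum_congr rfl fun u _ => Finset.sum_congr rfl fun u' _ => congrArg₂ (· * ·) rfl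
    (choi_reconstructCircuit (E.dec lam) _ O u u' m m')).trans ?_
  rw [← e.sum_comp, Fintype.sum_prod_type, Finset.sum_comm, Matrix.sum_apply]
  refine Finset.sum_congr rfl fun y _ => ?_
  rw [UEScheme.decState_apply]
  refine Finset.sum_congr rfl fun c _ => ?_
  rw [← e.sum_comp, Fintype.sum_prod_type]
  refine Finset.sum_congr rfl fun c' _ => ?_
  simp only [h1, h2, concat_injective.eq_iff, Matrix.of_apply, mul_ite, mul_zero]
  rw [Finset.sum_ite_eq]
  simp only [Finset.mem_univ, if_true]
  rfl

theorem hashScheme_isHashScheme : IsHashScheme E k n (hashScheme E k hn) := by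
  refine fun lam O => ⟨fun m => ?_, hashScheme_reconstructState_apply hn lam O⟩
  ext s t
  obtain ⟨⟨c₀, y₀⟩, rfl⟩ := (joinShares_bijective hn).2 s
  obtain ⟨⟨c₁, y₁⟩, rfl⟩ := (joinShares_bijective hn).2 t
  refine (hashScheme_shareState_apply hn lam O m c₀ c₁ y₀ y₁).trans ?_
  have hinj : ∀ (c c' : BitStr (E.ctLen lam)) (y y' : Fin n → BitStr (k lam)),
      joinShares c y = joinShares c' y' ↔ c = c' ∧ y = y' := fun c c' y y' =>
    ((joinShares_bijective hn).1.eq_iff (a := (c, y)) (b := (c', y'))).trans Prod.mk_inj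
  simp only [Matrix.sum_apply, Matrix.single_apply, hinj]
  rw [Finset.sum_eq_single y₀, Finset.sum_eq_single c₀, Finset.sum_eq_single c₁]
  · simp
  · intro c _ hc
    simp [hc]
  · simp
  · intro c _ hc
    simp [hc]
  · simp
  · intro y _ hy
    simp [hy]
  · simp

theorem hashScheme_isEfficient (hE : E.IsEfficient) (hk : PolyBounded k) :
    (hashScheme E k hn).IsEfficient := by
  obtain ⟨h1, h2, h3, h4⟩ := hE
  -- The key wires inject into the wires of the encryption circuit, so the key length is bounded by
  -- the size of that circuit.
  have hkey : PolyBounded E.keyLen := h3.of_le fun lam => by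
    have h := Fintype.card_le_of_injective _ ((E.enc lam).inp.injective.comp Sum.inl_injective)
    rw [Fintype.card_fin] at h
    exact h.trans (Nat.le_add_right _ _)
  have hin : PolyBounded fun lam => max (E.oIn lam) (n * k lam) := h1.max (hk.const_mul n)
  have hout : PolyBounded (hashOut E) := h2.max hkey
  refine ⟨hin.add (polyBounded_const 1), hout, ?_, ?_⟩
  · exact ((((h3.add (polyBounded_const 9)).add hin).add ((hk.const_mul n).const_mul 4)).add
      (hout.const_mul 2)).of_le fun lam => (shareCircuit_size _ _ _ _).le
  · exact ((((h4.add (polyBounded_const 9)).add hin).add ((hk.const_mul n).const_mul 2)).add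
      (hout.const_mul 2)).of_le fun lam => (reconstructCircuit_size _ _ _ _).le

end Scheme

/-! ### Resampling parts of a random oracle -/

section Resample

theorem resize_resize {m m' : ℕ} (h : m ≤ m') (s : BitStr m) : resize m (resize m' s) = s := by
  funext j
  simp [resize, bit, j.2.trans_le h]

theorem resize_injective {m m' : ℕ} (h : m ≤ m') :
    Function.Injective (resize m' : BitStr m → BitStr m') :=
  Function.LeftInverse.injective (g := resize m) (resize_resize h)

/-- Replace the first bits of a string. -/
def overwriteBits {m M : ℕ} (s : BitStr M) (t : BitStr m) : BitStr M :=
  fun j => if h : j.val < m then t ⟨j, h⟩ else s j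

theorem resize_overwriteBits {m M : ℕ} (h : m ≤ M) (s : BitStr M) (t : BitStr m) :
    resize m (overwriteBits s t) = t := by
  funext j
  simp [resize, bit, overwriteBits, j.2.trans_le h]

theorem overwriteBits_overwriteBits {m M : ℕ} (s : BitStr M) (t : BitStr m) :
    overwriteBits (overwriteBits s t) (resize m s) = s := by
  funext j
  simp only [resize, bit, overwriteBits]
  by_cases h : j.val < m
  · simp [h]
  · simp [h]

theorem avg_overwriteBits {m M : ℕ} (h : m ≤ M) (f : BitStr M → ℝ) :
    avg f = avg fun s => avg fun t : BitStr m => f (overwriteBits s t) :=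
  avg_overwrite overwriteBits (resize m) (resize_overwriteBits h) overwriteBits_overwriteBits f

theorem avg_update {α β : Type} [Fintype α] [DecidableEq α] [Fintype β] [Nonempty β]
    [DecidableEq β] (x : α) (f : (α → β) → ℝ) :
    avg f = avg fun g => avg fun z => f (Function.update g x z) :=
  avg_overwrite (fun g z => Function.update g x z) (fun g => g x) (by simp) (by simp) f

variable {a b N M : ℕ}

/-- Replace the part of an oracle that `encOracle` reads off. -/
def overwriteOracle (O : Oracle (N + 1) M) (G : Oracle a b) : Oracle (N + 1) M :=
  fun x => if x = Fin.cons false (resize N (resize a (Fin.tail x))) then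
    overwriteBits (O x) (G (resize a (Fin.tail x))) else O x

/-- The test in `overwriteOracle` singles out the inputs that consist of a `0`, an input of `G` and
zero padding, which are those that `encOracle` uses. The bounds on `a` and `b` ensure that nothing
is truncated. -/
theorem encOracle_overwriteOracle (ha : a ≤ N) (hb : b ≤ M) (O : Oracle (N + 1) M)
    (G : Oracle a b) : encOracle a b (overwriteOracle O G) = G := by
  funext x
  simp only [encOracle, overwriteOracle, Fin.tail_cons, resize_resize ha, if_true,
    resize_overwriteBits hb]

theorem overwriteOracle_overwriteOracle (O : Oracle (N + 1) M) (G : Oracle a b) :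
    overwriteOracle (overwriteOracle O G) (encOracle a b O) = O := by
  funext x
  by_cases h : x = Fin.cons false (resize N (resize a (Fin.tail x)))
  · simp only [overwriteOracle, if_pos h, encOracle]
    rw [← h, overwriteBits_overwriteBits]
  · simp only [overwriteOracle, if_neg h]

theorem avg_overwriteOracle (ha : a ≤ N) (hb : b ≤ M) (f : Oracle (N + 1) M → ℝ) :
    avg f = avg fun O => avg fun G : Oracle a b => f (overwriteOracle O G) :=
  avg_overwrite overwriteOracle (encOracle a b) (encOracle_overwriteOracle ha hb)
    overwriteOracle_overwriteOracle f

theorem avg_encOracle (ha : a ≤ N) (hb : b ≤ M) (f : Oracle a b → ℝ) :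
    (avg fun O : Oracle (N + 1) M => f (encOracle a b O)) = avg f := by
  rw [avg_overwriteOracle ha hb]
  simp only [encOracle_overwriteOracle ha hb, avg_const]

/-- The oracle input at which `hashOracle` is evaluated on `y`. -/
def hashPoint {n k : ℕ} (N : ℕ) (y : Fin n → BitStr k) : BitStr (N + 1) :=
  Fin.cons true (resize N (concat y))

theorem hashPoint_injective {n k : ℕ} (h : n * k ≤ N) :
    Function.Injective (hashPoint N : (Fin n → BitStr k) → BitStr (N + 1)) := fun y y' hy => by
  simp only [hashPoint] at hy
  exact concat_injective (resize_injective h ((Fin.cons_injective2 hy).2))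

/-- Domain separation: the first bits differ. Hence reprogramming `H` leaves the ciphertext
unchanged. -/
theorem encOracle_update {n k : ℕ} (y : Fin n → BitStr k) (O : Oracle (N + 1) M) (s : BitStr M) :
    encOracle a b (Function.update O (hashPoint N y) s) = encOracle a b O := by
  funext x
  rw [encOracle, encOracle, Function.update_of_ne]
  intro h
  simpa [hashPoint] using congrFun h 0

theorem hashOracle_update {n k ℓ : ℕ} (y : Fin n → BitStr k) (O : Oracle (N + 1) M)
    (s : BitStr M) :
    hashOracle (n * k) ℓ (Function.update O (hashPoint N y) s) (concat y) = resize ℓ s := by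
  rw [hashOracle]
  exact congrArg (resize ℓ) (Function.update_self _ _ _)

/-- For fixed `y` the key is uniform and independent of the rest of the oracle. The string `s`
supplies the bits of the new oracle value beyond the first `ℓ`. -/
theorem avg_hash {n k ℓ : ℕ} (y : Fin n → BitStr k) (hℓ : ℓ ≤ M)
    (f : Oracle (N + 1) M → BitStr ℓ → ℝ) :
    (avg fun O : Oracle (N + 1) M => f O (hashOracle (n * k) ℓ O (concat y))) =
      avg fun O => avg fun s : BitStr M => avg fun sk : BitStr ℓ =>
        f (Function.update O (hashPoint N y) (overwriteBits s sk)) sk := by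
  rw [avg_update (hashPoint N y)]
  simp only [hashOracle_update]
  congr 1
  funext O
  rw [avg_overwriteBits hℓ]
  simp only [resize_overwriteBits hℓ]

end Resample

/-! ### Correctness -/

section Correctness

/-- The price of replacing the distribution of `keyGen` by the uniform one, used for both
correctness and security; the right side is twice the statistical distance if `p` is a distribution.
-/
theorem abs_sum_mul_sub_avg_le {α : Type} [Fintype α] (p : α → ℝ) {f : α → ℝ}
    (h0 : ∀ x, 0 ≤ f x) (h1 : ∀ x, f x ≤ 1) :
    |∑ x, p x * f x - avg f| ≤ ∑ x, |p x - 1 / Fintype.card α| := by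
  have h : ∑ x, p x * f x - avg f = ∑ x, (p x - 1 / Fintype.card α) * f x := by
    simp only [avg, sub_mul, Finset.sum_sub_distrib, div_mul_eq_mul_div, one_mul, Finset.sum_div]
  rw [h]
  refine (Finset.abs_sum_le_sum_abs _ _).trans (Finset.sum_le_sum fun x _ => ?_)
  rw [abs_mul, abs_of_nonneg (h0 x)]
  exact mul_le_of_le_one_right (abs_nonneg _) (h1 x)

theorem IsState.diag_nonneg {A : Type} [Fintype A] {ρ : Matrix A A ℂ} (hρ : IsState ρ) (x : A) :
    0 ≤ (ρ x x).re :=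
  (Complex.nonneg_iff.mp hρ.1.diag_nonneg).1

theorem IsState.diag_le_one {A : Type} [Fintype A] {ρ : Matrix A A ℂ} (hρ : IsState ρ) (x : A) :
    (ρ x x).re ≤ 1 := by
  have h := congrArg Complex.re hρ.2
  simp only [Matrix.trace, Matrix.diag_apply, Complex.re_sum, Complex.one_re] at h
  rw [← h]
  exact Finset.single_le_sum (f := fun x => (ρ x x).re) (fun x _ => hρ.diag_nonneg x)
    (Finset.mem_univ x)

theorem isState_ket {A : Type} [Fintype A] [DecidableEq A] (x : A) : IsState (ket x) := by
  refine ⟨?_, by simp [ket, Matrix.trace_single_eq_same]⟩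
  have h : ket x = Matrix.diagonal (Pi.single x 1) := by
    rw [ket, Matrix.diagonal_single]
  rw [h]
  exact Matrix.PosSemidef.diagonal fun y => by
    by_cases hy : y = x
    · subst hy
      simp
    · simp [hy]

theorem UEScheme.isState_encState (E : UEScheme) (lam : ℕ) (O : Oracle (E.oIn lam) (E.oOut lam))
    (sk : BitStr (E.keyLen lam)) (m : BitStr (E.msgLen lam)) : IsState (E.encState lam O sk m) := by
  rw [UEScheme.encState, Circuit.eval_eq_apply]
  exact ((E.enc lam).toKraus_isChannel O).isState (isState_ket _)

theorem UEScheme.isState_decState (E : UEScheme) (lam : ℕ) (O : Oracle (E.oIn lam) (E.oOut lam))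
    (sk : BitStr (E.keyLen lam)) {ρ : Matrix (BitStr (E.ctLen lam)) (BitStr (E.ctLen lam)) ℂ}
    (hρ : IsState ρ) : IsState (E.decState lam O sk ρ) := by
  have h : E.decState lam O sk ρ = (((E.dec lam).toKraus O).comp
      (Kraus.ofFun fun c => Sum.elim sk c)).apply ρ := by
    ext m m'
    rw [UEScheme.decState_apply, Kraus.apply_apply]
    simp only [Kraus.choi_comp_ofFun]
  rw [h]
  exact (((E.dec lam).toKraus_isChannel O).comp (Kraus.ofFun_isChannel fun c c' hc =>
    funext fun j => congrFun hc (.inr j))).isState hρ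

theorem UEScheme.decState_smul (E : UEScheme) (lam : ℕ) (O : Oracle (E.oIn lam) (E.oOut lam))
    (sk : BitStr (E.keyLen lam)) (r : ℂ)
    (ρ : Matrix (BitStr (E.ctLen lam)) (BitStr (E.ctLen lam)) ℂ) :
    E.decState lam O sk (r • ρ) = r • E.decState lam O sk ρ := by
  ext m m'
  simp only [UEScheme.decState_apply, Matrix.smul_apply, smul_eq_mul, Finset.mul_sum, mul_assoc]

variable {E : UEScheme} {k : ℕ → ℕ} {n : ℕ}

theorem re_sum_half_pow_mul {K : ℕ} {α : Type} [Fintype α] (hα : Fintype.card α = 2 ^ K)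
    (f : α → ℂ) : (∑ x, (1 / 2 : ℂ) ^ K * f x).re = avg fun x => (f x).re := by
  have h : (1 / 2 : ℂ) ^ K = (((1 / 2 : ℝ) ^ K : ℝ) : ℂ) := by
    push_cast
    rfl
  rw [← Finset.mul_sum, avg, hα, Nat.cast_pow, Nat.cast_ofNat, h, Complex.re_ofReal_mul,
    Complex.re_sum, one_div_pow, one_div_mul_eq_div]

theorem card_blocks (n k : ℕ) : Fintype.card (Fin n → BitStr k) = 2 ^ (n * k) := by
  simp [← pow_mul, mul_comm]

/-- For each fixed `y` the pair of `G` and `H(y)` is uniform, so reconstruction succeeds as often as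
decryption does under a uniform key, which differs from `keyGen` by a negligible amount. -/
theorem hashScheme_isCorrect (hn : 0 < n) (hKey : E.HasNearUniformKey) (hE : E.IsCorrect) :
    (hashScheme E k hn).IsCorrect := by
  obtain ⟨ε, hε, hE⟩ := hE
  refine ⟨_, hε.add (hKey.const_mul 2), fun lam m => ?_⟩
  have hin : E.oIn lam ≤ max (E.oIn lam) (n * k lam) := le_max_left _ _
  have hout : E.oOut lam ≤ hashOut E lam := le_max_left _ _
  have hkey : E.keyLen lam ≤ hashOut E lam := le_max_right _ _
  let P : Oracle (E.oIn lam) (E.oOut lam) → BitStr (E.keyLen lam) → ℝ := fun G sk =>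
    (E.decState lam G sk (E.encState lam G sk m) m m).re
  have hP : ∀ G sk, IsState (E.decState lam G sk (E.encState lam G sk m)) := fun G sk =>
    E.isState_decState lam G sk (E.isState_encState lam G sk m)
  have h1 : ∀ O : Oracle (hashIn E k n lam) (hashOut E lam),
      ((hashScheme E k hn).reconstructState lam O
        ((hashScheme E k hn).shareState lam O m) m m).re =
      avg fun y : Fin n → BitStr (k lam) => P (encOracle _ _ O) (hashKey E k n lam O y) := by
    intro O
    rw [hashScheme_reconstructState_apply, Matrix.sum_apply,
      ← re_sum_half_pow_mul (card_blocks n (k lam))]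
    congr 1
    refine Finset.sum_congr rfl fun y _ => ?_
    have h2 : ((hashScheme E k hn).shareState lam O m).submatrix (fun c => joinShares c y)
        (fun c => joinShares c y) = (1 / 2 : ℂ) ^ (n * k lam) •
          E.encState lam (encOracle _ _ O) (hashKey E k n lam O y) m := by
      ext c c'
      rw [Matrix.submatrix_apply, hashScheme_shareState_apply, if_pos rfl]
      rfl
    rw [h2, UEScheme.decState_smul]
    rfl
  have h2 : ∀ y : Fin n → BitStr (k lam), (avg fun O : Oracle (hashIn E k n lam) (hashOut E lam) =>
      P (encOracle _ _ O) (hashKey E k n lam O y)) = avg fun G => avg fun sk => P G sk := by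
    intro y
    refine (avg_hash y hkey fun O sk => P (encOracle _ _ O) sk).trans ?_
    simp only [encOracle_update, avg_const]
    exact avg_encOracle hin hout fun G => avg fun sk => P G sk
  simp only [h1]
  rw [avg_comm]
  simp only [h2, avg_const]
  have h3 := hE lam m
  have h4 : (avg fun G : Oracle (E.oIn lam) (E.oOut lam) =>
      ∑ sk, (E.keyGen lam sk).toReal * P G sk) ≤ avg fun G => ((avg fun sk => P G sk) +
        ∑ sk, |(E.keyGen lam sk).toReal - 1 / Fintype.card (BitStr (E.keyLen lam))|) := by
    refine avg_mono fun G => ?_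
    have h := (abs_le.mp (abs_sum_mul_sub_avg_le (fun sk => (E.keyGen lam sk).toReal)
      (fun sk => (hP G sk).diag_nonneg m) (fun sk => (hP G sk).diag_le_one m))).2
    simp only [P]
    linarith
  rw [avg_add, avg_const] at h4
  linarith

end Correctness

/-! ### Reprogramming the oracle of several parties -/

section Hybrid

variable {n : ℕ} {A B : Fin n → Type} [∀ i, Fintype (A i)]

/-- A hybrid argument over the set of parties that have been switched. Only mixtures of `K` and `K'`
occur, so in applications every party applies a channel. -/
theorem apply_pi_le {K K' : ∀ i, Kraus (A i) (B i)} (Λ : Matrix (∀ i, B i) (∀ i, B i) ℂ → ℝ)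
    (ρ : Matrix (∀ i, A i) (∀ i, A i) ℂ) (e : Fin n → ℝ)
    (h : ∀ J : ∀ i, Kraus (A i) (B i), (∀ i, J i = K i ∨ J i = K' i) → ∀ i,
      Λ ((Kraus.pi (Function.update J i (K' i))).apply ρ) ≤
        Λ ((Kraus.pi (Function.update J i (K i))).apply ρ) + e i) :
    Λ ((Kraus.pi K').apply ρ) ≤ Λ ((Kraus.pi K).apply ρ) + ∑ i, e i := by
  have key : ∀ s : Finset (Fin n), Λ ((Kraus.pi K').apply ρ) ≤
      Λ ((Kraus.pi (s.piecewise K K')).apply ρ) + ∑ i ∈ s, e i := by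
    intro s
    induction s using Finset.induction_on with
    | empty => simp
    | insert i s hi ih =>
      have h1 := h (s.piecewise K K') (fun j => by
        by_cases hj : j ∈ s
        · exact .inl (s.piecewise_eq_of_mem _ _ hj)
        · exact .inr (s.piecewise_eq_of_notMem _ _ hj)) i
      rw [← Finset.piecewise_insert, Function.update_eq_self_iff.mpr
        (s.piecewise_eq_of_notMem K K' hi).symm] at h1
      rw [Finset.sum_insert hi]
      linarith
  simpa using key Finset.univ

variable {a b : ℕ} [∀ i, DecidableEq (A i)] [∀ i, Fintype (B i)]

/-- The error of party `i` is measured in its own run with the unchanged oracle `O` on its own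
reduced state, no matter which oracle the other parties have at that stage. -/
theorem apply_pi_run_le (M : ∀ i, OracleAlg a b (A i) (B i)) {O O' : Oracle a b} {x : BitStr a}
    (h : ∀ y, y ≠ x → O' y = O y) {Λ : Matrix (∀ i, B i) (∀ i, B i) ℂ →ₗ[ℝ] ℝ} (hΛ : IsEffect Λ)
    {ρ : Matrix (∀ i, A i) (∀ i, A i) ℂ} (hρ : IsState ρ) {t : ℝ} (ht : 0 < t) :
    Λ ((Kraus.pi fun i => (M i).run O').apply ρ) ≤ Λ ((Kraus.pi fun i => (M i).run O).apply ρ) +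
      ∑ i, ∑ l ∈ Finset.range (M i).queries,
        (t + 4 * (1 + 1 / t) * queryWeight x (((M i).after O l).apply (reducedOne i ρ))) := by
  refine apply_pi_le Λ ρ _ fun J hJ i => ?_
  rw [apply_pi_eq_sum_insertOp, apply_pi_eq_sum_insertOp]
  refine (M i).sum_run_le h (reducedOne_isState i hρ) ht
    (isDominatedForm_insertOp i (fun j _ => ?_) hΛ hρ.1)
  rcases hJ j with hj | hj <;> rw [hj] <;> exact (M j).run_isChannel _

end Hybrid

/-! ### The shares as an input of the parties -/

/-- A family of pairs as a pair of families. -/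
def pairEquiv {n : ℕ} (A B : Fin n → Type) : (∀ i, A i) × (∀ i, B i) ≃ ∀ i, A i × B i where
  toFun p i := (p.1 i, p.2 i)
  invFun u := (fun i => (u i).1, fun i => (u i).2)
  left_inv _ := rfl
  right_inv _ := rfl

section Prepare

variable {n ct k : ℕ} {Aux : Fin n → Type} [∀ i, Fintype (Aux i)]

/-- Distribute the ciphertext, the strings `y` and the state `Bᴴ * B`. -/
def prepare (B : Matrix (∀ i, Aux i) (∀ i, Aux i) ℂ) (y : Fin n → BitStr k) :
    Kraus (BitStr ct) (∀ i, BitStr (hashShareLen n ct k i) × Aux i) where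
  ι := ∀ i, Aux i
  op j := Matrix.of fun u c =>
    if (fun i => (u i).1) = joinShares c y then star (B j fun i => (u i).2) else 0

theorem choi_prepare (B : Matrix (∀ i, Aux i) (∀ i, Aux i) ℂ) (y : Fin n → BitStr k)
    (c c' : BitStr ct) (u v : ∀ i, BitStr (hashShareLen n ct k i) × Aux i) :
    (prepare B y).choi c c' u v =
      if (fun i => (u i).1) = joinShares c y ∧ (fun i => (v i).1) = joinShares c' y then
        (Bᴴ * B) (fun i => (u i).2) (fun i => (v i).2) else 0 := by
  change ∑ j : ∀ i, Aux i, (if (fun i => (u i).1) = joinShares c y then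
    star (B j fun i => (u i).2) else 0) * star (if (fun i => (v i).1) = joinShares c' y then
    star (B j fun i => (v i).2) else 0) = _
  by_cases h1 : (fun i => (u i).1) = joinShares c y
  · by_cases h2 : (fun i => (v i).1) = joinShares c' y
    · simp [h1, h2, Matrix.mul_apply]
    · simp [h1, h2]
  · simp [h1]

theorem prepare_isChannel [∀ i, DecidableEq (Aux i)] (hn : 0 < n)
    {B : Matrix (∀ i, Aux i) (∀ i, Aux i) ℂ} (hB : (Bᴴ * B).trace = 1) (y : Fin n → BitStr k) :
    (prepare B y : Kraus (BitStr ct) _).IsChannel := by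
  rw [Kraus.isChannel_iff]
  intro c c'
  simp only [choi_prepare]
  rw [← (pairEquiv (fun i => BitStr (hashShareLen n ct k i)) Aux).sum_comp,
    Fintype.sum_prod_type, Finset.sum_eq_single (joinShares c y)]
  · simp only [pairEquiv, Equiv.coe_fn_mk, true_and]
    have h : joinShares c y = joinShares c' y ↔ c = c' :=
      ((joinShares_bijective hn).1.eq_iff (a := (c, y)) (b := (c', y))).trans (by simp)
    simp only [h]
    split_ifs
    · exact hB
    · simp
  · intro s _ hs
    refine Finset.sum_eq_zero fun z _ => if_neg fun h => hs h.1
  · simp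

theorem joinShares_eq_iff {c c' : BitStr ct} {y : Fin n → BitStr k} {i : Fin n} :
    joinShares c y i = joinShares c' y i ↔
      ∀ j : Fin (if i.val = 0 then ct else 0), bit c j = bit c' j := by
  constructor
  · intro h j
    have := congrFun h (Fin.castAdd k j)
    simpa [joinShares] using this
  · intro h
    unfold joinShares
    rw [funext h]

/-- In this formula the strings `y` occur only in `joinShares c y h` and `joinShares c' y h`, hence
only through `y h`. The condition on the other parties' bits of `c` and `c'` comes from tracing out
their shares. -/
theorem reducedOne_prepare_apply [∀ i, DecidableEq (Aux i)]
    (B : Matrix (∀ i, Aux i) (∀ i, Aux i) ℂ) (y : Fin n → BitStr k)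
    (ρ : Matrix (BitStr ct) (BitStr ct) ℂ) (h : Fin n)
    (p p' : BitStr (hashShareLen n ct k h) × Aux h) :
    reducedOne h ((prepare B y).apply ρ) p p' = ∑ z : ∀ i, Aux i, ∑ c, ∑ c',
      ρ c c' * if (joinShares c y h, z h) = p ∧ p'.1 = joinShares c' y h ∧
        (∀ i, i ≠ h → ∀ j : Fin (if i.val = 0 then ct else 0), bit c j = bit c' j)
        then (Bᴴ * B) z (Function.update z h p'.2) else 0 := by
  have hupd : ∀ (s : ∀ i, BitStr (hashShareLen n ct k i)) (z : ∀ i, Aux i),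
      (fun i => (Function.update (fun i => (s i, z i)) h p' i).1) = Function.update s h p'.1 ∧
      (fun i => (Function.update (fun i => (s i, z i)) h p' i).2) = Function.update z h p'.2 := by
    intro s z
    constructor <;>
    · funext i
      by_cases hi : i = h
      · subst hi
        simp
      · simp [hi]
  have hs : ∀ c c' : BitStr ct, Function.update (joinShares c y) h p'.1 = joinShares c' y ↔
      p'.1 = joinShares c' y h ∧ ∀ i, i ≠ h →
        ∀ j : Fin (if i.val = 0 then ct else 0), bit c j = bit c' j := by
    intro c c'
    rw [Function.update_eq_iff]
    simp only [joinShares_eq_iff]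
  rw [reducedOne, Matrix.of_apply, ← (pairEquiv _ Aux).sum_comp, Fintype.sum_prod_type,
    Finset.sum_comm]
  refine Finset.sum_congr rfl fun z _ => ?_
  simp only [pairEquiv, Equiv.coe_fn_mk, Kraus.apply_apply, choi_prepare, (hupd _ _).1,
    (hupd _ _).2]
  have hif : ∀ s : ∀ i, BitStr (hashShareLen n ct k i), (if (s h, z h) = p then
      ∑ c, ∑ c', ρ c c' * (if s = joinShares c y ∧ Function.update s h p'.1 = joinShares c' y
        then (Bᴴ * B) z (Function.update z h p'.2) else 0) else 0) =
      ∑ c, if s = joinShares c y then ∑ c', ρ c c' * (if (s h, z h) = p ∧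
        Function.update s h p'.1 = joinShares c' y
        then (Bᴴ * B) z (Function.update z h p'.2) else 0) else 0 := by
    intro s
    by_cases h1 : (s h, z h) = p
    · simp only [h1, true_and]
      refine Finset.sum_congr rfl fun c _ => ?_
      by_cases h2 : s = joinShares c y <;> simp [h2]
    · simp [h1]
  simp only [hif]
  rw [Finset.sum_comm]
  refine Finset.sum_congr rfl fun c _ => ?_
  rw [Finset.sum_ite_eq' Finset.univ (joinShares c y)]
  simp only [Finset.mem_univ, if_true, hs]

theorem reducedOne_prepare_congr [∀ i, DecidableEq (Aux i)] (B : Matrix (∀ i, Aux i) (∀ i, Aux i) ℂ)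
    {y y' : Fin n → BitStr k} {h : Fin n} (hy : y h = y' h)
    (ρ : Matrix (BitStr ct) (BitStr ct) ℂ) :
    reducedOne h ((prepare B y).apply ρ) = reducedOne h ((prepare B y').apply ρ) := by
  have hj : ∀ c : BitStr ct, joinShares c y h = joinShares c y' h := fun c => by
    unfold joinShares
    rw [hy]
  ext p p'
  simp only [reducedOne_prepare_apply, hj]

/-- While the block of another party varies, the state `R y` stays fixed and the `2ᵏ` points are
distinct, so their weights sum to at most `1`. -/
theorem avg_queryWeight_le {N b : ℕ} {Z : Type} [Fintype Z] (hn : 2 ≤ n) (hN : n * k ≤ N)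
    (h : Fin n) {R : (Fin n → BitStr k) →
      Matrix (BitStr (N + 1) × BitStr b × Z) (BitStr (N + 1) × BitStr b × Z) ℂ}
    (hR : ∀ y y', y h = y' h → R y = R y') (hs : ∀ y, IsState (R y)) :
    (avg fun y => queryWeight (hashPoint N y) (R y)) ≤ (1 / 2) ^ k := by
  have _ : Nontrivial (Fin n) := Fin.nontrivial_iff_two_le.mpr hn
  -- A block unknown to party `h`. The average over this block alone suffices, for every value of
  -- the others.
  obtain ⟨j, hj⟩ := exists_ne h
  rw [avg_update j]
  refine avg_le fun y => ?_
  have h1 : ∀ z, R (Function.update y j z) = R y := fun z =>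
    hR _ _ (Function.update_of_ne hj.symm _ _)
  simp only [h1, avg]
  have h2 : ∑ z, queryWeight (hashPoint N (Function.update y j z)) (R y) ≤ 1 := by
    let φ : BitStr k ↪ BitStr (N + 1) := ⟨fun z => hashPoint N (Function.update y j z),
      fun z z' hz => Function.update_injective y j (hashPoint_injective hN hz)⟩
    calc _ = ∑ x ∈ Finset.univ.map φ, queryWeight x (R y) :=
          (Finset.sum_map Finset.univ φ fun x => queryWeight x (R y)).symm
      _ ≤ ∑ x, queryWeight x (R y) := Finset.sum_le_univ_sum_of_nonneg fun x =>
          queryWeight_nonneg x (hs y).1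
      _ = 1 := by rw [sum_queryWeight, (hs y).2, Complex.one_re]
  have h3 : (Fintype.card (BitStr k) : ℝ) = 2 ^ k := by simp
  rw [h3, one_div_pow]
  exact div_le_div_of_nonneg_right h2 (by positivity)

end Prepare

/-! ### Security -/

theorem Kraus.apply_reindex {A B B' : Type} [Fintype A] (K : Kraus A B) (g : B' → B)
    (ρ : Matrix A A ℂ) : (K.reindex id g).apply ρ = (K.apply ρ).submatrix g g := by
  ext u v
  simp only [Matrix.submatrix_apply, Kraus.apply_apply, Kraus.choi_reindex, id]

section Security

variable {n : ℕ}

/-- The probability that Bob and Charlie, whose oracle is `O`, both output `c`. -/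
def USSScheme.Adversary.guess {μ a b : ℕ} {len : Fin n → ℕ} (𝒜 : USSScheme.Adversary μ len a b)
    (O : Oracle a b) (c : Bool) :
    Matrix (∀ i, 𝒜.X i × 𝒜.Y i) (∀ i, 𝒜.X i × 𝒜.Y i) ℂ →ₗ[ℝ] ℝ where
  toFun τ := (((𝒜.bob.run O).prod (𝒜.charlie.run O)).apply
    (τ.submatrix (pairEquiv 𝒜.X 𝒜.Y) (pairEquiv 𝒜.X 𝒜.Y)) (c, c) (c, c)).re
  map_add' τ τ' := by
    rw [Matrix.submatrix_add, Pi.add_apply, Pi.add_apply, Kraus.apply_add, Matrix.add_apply,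
      Complex.add_re]
  map_smul' r τ := by
    have h : (r • τ).submatrix (pairEquiv 𝒜.X 𝒜.Y) (pairEquiv 𝒜.X 𝒜.Y) =
        (r : ℂ) • τ.submatrix (pairEquiv 𝒜.X 𝒜.Y) (pairEquiv 𝒜.X 𝒜.Y) := by
      ext u v
      simp
    rw [h, Kraus.apply_smul, Matrix.smul_apply, smul_eq_mul, Complex.re_ofReal_mul]
    rfl

theorem USSScheme.Adversary.guess_isEffect {μ a b : ℕ} {len : Fin n → ℕ}
    (𝒜 : USSScheme.Adversary μ len a b) (O : Oracle a b) (c : Bool) :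
    IsEffect (𝒜.guess O c) where
  nonneg ρ hρ := (Complex.nonneg_iff.mp (Kraus.apply_posSemidef _ (hρ.submatrix _)).diag_nonneg).1
  le_trace ρ hρ := by
    have h1 : (ρ.submatrix (pairEquiv 𝒜.X 𝒜.Y) (pairEquiv 𝒜.X 𝒜.Y)).trace = ρ.trace :=
      (pairEquiv 𝒜.X 𝒜.Y).sum_comp fun u => ρ u u
    rw [← h1, ← ((𝒜.bob.run_isChannel O).prod (𝒜.charlie.run_isChannel O)).trace_apply,
      Matrix.trace, Complex.re_sum]
    exact Finset.single_le_sum (f := fun x => (Matrix.diag (((𝒜.bob.run O).prod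
      (𝒜.charlie.run O)).apply (ρ.submatrix (pairEquiv 𝒜.X 𝒜.Y) (pairEquiv 𝒜.X 𝒜.Y))) x).re)
      (fun x _ => (Complex.nonneg_iff.mp (Kraus.apply_posSemidef _ (hρ.submatrix _)).diag_nonneg).1)
      (Finset.mem_univ (c, c))

theorem IsEffect.le_one {B : Type} [Fintype B] {Λ : Matrix B B ℂ →ₗ[ℝ] ℝ} (hΛ : IsEffect Λ)
    {ρ : Matrix B B ℂ} (hρ : IsState ρ) : Λ ρ ≤ 1 := by
  have h := hΛ.le_trace ρ hρ.1
  rwa [hρ.2, Complex.one_re] at h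

theorem Kraus.IsChannel.pi {A B : Fin n → Type} [∀ i, Fintype (A i)] [∀ i, DecidableEq (A i)]
    [∀ i, Fintype (B i)] {K : ∀ i, Kraus (A i) (B i)} (hK : ∀ i, (K i).IsChannel) :
    (Kraus.pi K).IsChannel := by
  rw [Kraus.isChannel_iff]
  intro u u'
  simp only [Kraus.choi_pi]
  rw [← Fintype.prod_sum fun i b => (K i).choi (u i) (u' i) b b]
  simp only [fun i => Kraus.isChannel_iff.mp (hK i), Finset.prod_ite_zero, Finset.prod_const_one,
    Finset.mem_univ, true_imp_iff, funext_iff]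

variable {N M k ct μ : ℕ}

/-- The state of all parties when their oracle is `O`, the strings are `y`, and the ciphertext is
`ρ`; the shared state is `Bᴴ * B`. -/
def USSScheme.Adversary.cloneKraus (𝒜 : USSScheme.Adversary μ (hashShareLen n ct k) (N + 1) M)
    (B : Matrix (∀ i, 𝒜.Aux i) (∀ i, 𝒜.Aux i) ℂ) (O : Oracle (N + 1) M)
    (y : Fin n → BitStr k) : Kraus (BitStr ct) (∀ i, 𝒜.X i × 𝒜.Y i) :=
  (Kraus.pi fun i => (𝒜.party i).run O).comp (prepare B y)

theorem USSScheme.Adversary.cloneKraus_isChannel (hn : 0 < n)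
    (𝒜 : USSScheme.Adversary μ (hashShareLen n ct k) (N + 1) M)
    {B : Matrix (∀ i, 𝒜.Aux i) (∀ i, 𝒜.Aux i) ℂ} (hB : 𝒜.ξ = Bᴴ * B) (O : Oracle (N + 1) M)
    (y : Fin n → BitStr k) : (𝒜.cloneKraus B O y).IsChannel :=
  (Kraus.IsChannel.pi fun i => (𝒜.party i).run_isChannel O).comp
    (prepare_isChannel hn (hB ▸ 𝒜.ξ_isState.2) y)

/-- The parties hardly notice that the oracle is changed at the point that yields the key. -/
theorem USSScheme.Adversary.avg_guess_le (hn : 2 ≤ n) (hN : n * k ≤ N)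
    (𝒜 : USSScheme.Adversary μ (hashShareLen n ct k) (N + 1) M) {q : ℕ} (hq : 𝒜.QueryBound q)
    {B : Matrix (∀ i, 𝒜.Aux i) (∀ i, 𝒜.Aux i) ℂ} (hB : 𝒜.ξ = Bᴴ * B) (O : Oracle (N + 1) M)
    (s : BitStr M) (c : Bool) {ρ : Matrix (BitStr ct) (BitStr ct) ℂ} (hρ : IsState ρ) :
    (avg fun y => 𝒜.guess (Function.update O (hashPoint N y) s) c
      ((𝒜.cloneKraus B (Function.update O (hashPoint N y) s) y).apply ρ)) ≤
    (avg fun y => 𝒜.guess (Function.update O (hashPoint N y) s) c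
      ((𝒜.cloneKraus B O y).apply ρ)) + n * (q * (9 * √((1 / 2) ^ k))) := by
  set δ : ℝ := (1 / 2) ^ k with hδ
  have hδ0 : 0 < δ := by positivity
  have hδ1 : δ ≤ 1 := pow_le_one₀ (by norm_num) (by norm_num)
  -- This choice balances the two errors `t` and `(1 + 1/t) δ` of a single query.
  set t : ℝ := √δ with ht
  have ht0 : 0 < t := Real.sqrt_pos.mpr hδ0
  have ht1 : t ≤ 1 := Real.sqrt_le_one.mpr hδ1
  have htt : t * t = δ := Real.mul_self_sqrt hδ0.le
  have hprep : ∀ y : Fin n → BitStr k, IsState ((prepare B y).apply ρ) := fun y =>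
    (prepare_isChannel (by omega) (hB ▸ 𝒜.ξ_isState.2) y).isState hρ
  have h1 : ∀ y : Fin n → BitStr k, 𝒜.guess (Function.update O (hashPoint N y) s) c
      ((𝒜.cloneKraus B (Function.update O (hashPoint N y) s) y).apply ρ) ≤
      𝒜.guess (Function.update O (hashPoint N y) s) c ((𝒜.cloneKraus B O y).apply ρ) +
      ∑ i, ∑ l ∈ Finset.range (𝒜.party i).queries, (t + 4 * (1 + 1 / t) *
        queryWeight (hashPoint N y) (((𝒜.party i).after O l).apply
          (reducedOne i ((prepare B y).apply ρ)))) := by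
    intro y
    rw [cloneKraus, Kraus.apply_comp, cloneKraus, Kraus.apply_comp]
    exact apply_pi_run_le 𝒜.party (fun x hx => Function.update_of_ne hx _ _)
      (𝒜.guess_isEffect _ c) (hprep y) ht0
  refine (avg_mono h1).trans ?_
  rw [avg_add]
  gcongr
  rw [avg_sum]
  have h2 : ∀ i, (avg fun y : Fin n → BitStr k => ∑ l ∈ Finset.range (𝒜.party i).queries,
      (t + 4 * (1 + 1 / t) * queryWeight (hashPoint N y) (((𝒜.party i).after O l).apply
          (reducedOne i ((prepare B y).apply ρ))))) ≤ q * (9 * t) := by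
    intro i
    rw [avg_sum]
    have h3 : ∀ l, (avg fun y : Fin n → BitStr k =>
        t + 4 * (1 + 1 / t) * queryWeight (hashPoint N y) (((𝒜.party i).after O l).apply
          (reducedOne i ((prepare B y).apply ρ)))) ≤ 9 * t := by
      intro l
      rw [avg_add, avg_const, avg_mul_left]
      have h4 := avg_queryWeight_le hn hN i (R := fun y => ((𝒜.party i).after O l).apply
          (reducedOne i ((prepare B y).apply ρ)))
        (fun y y' hy => by rw [reducedOne_prepare_congr B hy])
        (fun y => ((𝒜.party i).after_isChannel O l).isState (reducedOne_isState i (hprep y)))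
      have h5 := mul_le_mul_of_nonneg_left h4 (show 0 ≤ 4 * (1 + 1 / t) by positivity)
      -- Since `δ = t²` and `t ≤ 1`, one query costs at most `t + 4t² + 4t ≤ 9t`.
      have h6 : 4 * (1 + 1 / t) * δ = 4 * (t * t) + 4 * t := by
        rw [← htt]
        field_simp
      rw [← hδ, h6] at h5
      nlinarith
    calc _ ≤ ∑ _l ∈ Finset.range (𝒜.party i).queries, 9 * t := Finset.sum_le_sum fun l _ => h3 l
      _ = (𝒜.party i).queries * (9 * t) := by simp
      _ ≤ q * (9 * t) := by
        gcongr
        exact hq.1 i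
  calc _ ≤ ∑ _i : Fin n, q * (9 * t) := Finset.sum_le_sum fun i _ => h2 i
    _ = n * (q * (9 * t)) := by simp

end Security

/-! ### Reduction to a cloning attack on the encryption scheme -/

section Reduction

variable {E : UEScheme} {lam n N M k : ℕ}

/-- The adversary that simulates the oracle of the secret sharing scheme. -/
theorem USSScheme.Adversary.exists_simulation (hn : 0 < n)
    (𝒜 : USSScheme.Adversary (E.msgLen lam) (hashShareLen n (E.ctLen lam) k) (N + 1) M) {q : ℕ}
    (hq : 𝒜.QueryBound q) {B : Matrix (∀ i, 𝒜.Aux i) (∀ i, 𝒜.Aux i) ℂ} (hB : 𝒜.ξ = Bᴴ * B)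
    (O : Oracle (N + 1) M) (s : BitStr M) (y : Fin n → BitStr k) :
    ∃ 𝒟 : E.Adversary lam, 𝒟.QueryBound (2 * (n * q) + 2 * q) ∧
      𝒟.winProb = avg fun G : Oracle (E.oIn lam) (E.oOut lam) =>
        ∑ sk, (E.keyGen lam sk).toReal * avg fun c : Bool =>
          𝒜.guess (Function.update (overwriteOracle O G) (hashPoint N y) (overwriteBits s sk)) c
            ((𝒜.cloneKraus B (overwriteOracle O G) y).apply (E.encState lam G sk (𝒜.m c))) := by
  -- Each value of the large oracle is a function of the fixed `O` and of one value of `G`, at `φ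
  -- x`, which is the situation of `Realizes.simulate`. In `f'`, available to Bob and Charlie only,
  -- the key is programmed in at the point given by `y`.
  let φ : BitStr (N + 1) → BitStr (E.oIn lam) := fun x => resize _ (Fin.tail x)
  let f : BitStr (N + 1) → BitStr (E.oOut lam) → BitStr M := fun x g =>
    if x = Fin.cons false (resize N (resize (E.oIn lam) (Fin.tail x))) then
      overwriteBits (O x) g else O x
  let f' : BitStr (E.keyLen lam) → BitStr (N + 1) → BitStr (E.oOut lam) → BitStr M :=
    fun sk x g => if x = hashPoint N y then overwriteBits s sk else f x g
  have hf : ∀ G : Oracle (E.oIn lam) (E.oOut lam), (fun x => f x (G (φ x))) =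
      overwriteOracle O G := fun G => rfl
  have hf' : ∀ sk, ∀ G : Oracle (E.oIn lam) (E.oOut lam), (fun x => f' sk x (G (φ x))) =
      Function.update (overwriteOracle O G) (hashPoint N y) (overwriteBits s sk) := fun sk G => by
    funext x
    rw [Function.update_apply]
    rfl
  -- The splitter runs all shareholders on one register, after an input channel that has `y` and the
  -- pre-shared state built in.
  have h1 := ((Realizes.simulate φ f (Realizes.pi fun i => (𝒜.party i).realizes_run)).precomp
    (prepare_isChannel hn (hB ▸ 𝒜.ξ_isState.2) y)).reindex (Equiv.refl _)
      (pairEquiv 𝒜.X 𝒜.Y)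
  obtain ⟨split, hsplit, hsplit'⟩ := h1.exists_oracleAlg
  have h2 := fun sk => (Realizes.simulate φ (f' sk) 𝒜.bob.realizes_run).exists_oracleAlg
  have h3 := fun sk => (Realizes.simulate φ (f' sk) 𝒜.charlie.realizes_run).exists_oracleAlg
  choose bob hbob hbob' using h2
  choose charlie hcharlie hcharlie' using h3
  refine ⟨⟨𝒜.m, ∀ i, 𝒜.X i, ∀ i, 𝒜.Y i, split, bob, charlie⟩, ⟨?_, fun sk => ⟨?_, ?_⟩⟩, ?_⟩
  · have h4 : ∑ i, (𝒜.party i).queries ≤ n * q := by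
      refine (Finset.sum_le_sum fun i _ => hq.1 i).trans ?_
      simp
    simp only [hsplit]
    omega
  · have h4 := hq.2.1
    simp only [hbob]
    omega
  · have h4 := hq.2.2
    simp only [hcharlie]
    omega
  · unfold UEScheme.Adversary.winProb
    congr 1
    funext G
    refine Finset.sum_congr rfl fun sk _ => ?_
    congr 2
    funext c
    simp only
    rw [Kraus.apply_congr (Kraus.choi_prod_congr (hbob' sk G) (hcharlie' sk G)),
      Kraus.apply_congr (hsplit' G)]
    rw [← hf' sk G, ← hf G]
    refine congrArg (fun τ => Complex.re (Kraus.apply _ τ (c, c) (c, c))) ?_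
    exact Kraus.apply_reindex _ _ _

end Reduction

theorem avg_comm₃ {α β γ δ : Type} [Fintype α] [Fintype β] [Fintype γ] [Fintype δ]
    (f : α → β → γ → δ → ℝ) :
    (avg fun x => avg fun y => avg fun z => avg fun w => f x y z w) =
      avg fun y => avg fun z => avg fun w => avg fun x => f x y z w := by
  rw [avg_comm]
  congr 1
  funext y
  rw [avg_comm]
  congr 1
  funext z
  rw [avg_comm]

theorem Kraus.apply_sum {A B ι : Type} [Fintype A] (K : Kraus A B) (s : Finset ι)
    (ρ : ι → Matrix A A ℂ) : K.apply (∑ i ∈ s, ρ i) = ∑ i ∈ s, K.apply (ρ i) :=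
  map_sum (AddMonoidHom.mk' K.apply K.apply_add) ρ s

-- The rows of `B` give the Kraus operators by which `prepare` creates the pre-shared state.
open scoped MatrixOrder in
theorem posSemidef_exists_eq_conjTranspose_mul_self {A : Type} [Fintype A] [DecidableEq A]
    {ρ : Matrix A A ℂ} (hρ : ρ.PosSemidef) : ∃ B : Matrix A A ℂ, ρ = Bᴴ * B :=
  CStarAlgebra.nonneg_iff_eq_star_mul_self.mp hρ.nonneg

/-! ### Security of the hash-based scheme -/

section HashSecurity

variable {E : UEScheme} {k : ℕ → ℕ} {n : ℕ} (hn : 0 < n)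

/-- The joint state of the shares and the pre-shared state. -/
theorem hashScheme_shareState_mul {Aux : Fin n → Type} [∀ i, Fintype (Aux i)]
    (B : Matrix (∀ i, Aux i) (∀ i, Aux i) ℂ) (lam : ℕ)
    (O : Oracle (hashIn E k n lam) (hashOut E lam)) (m : BitStr (E.msgLen lam)) :
    (Matrix.of fun u v => (hashScheme E k hn).shareState lam O m (fun i => (u i).1)
      (fun i => (v i).1) * (Bᴴ * B) (fun i => (u i).2) (fun i => (v i).2)) =
    ∑ y : Fin n → BitStr (k lam), ((1 / 2 : ℝ) ^ (n * k lam) : ℂ) • (prepare B y).apply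
      (E.encState lam (encOracle _ _ O) (hashKey E k n lam O y) m) := by
  ext u v
  rw [Matrix.of_apply, (hashScheme_isHashScheme hn lam O).1 m]
  simp only [Matrix.sum_apply, Matrix.smul_apply, Kraus.apply_apply, choi_prepare,
    Matrix.single_apply, Finset.sum_mul, Finset.mul_sum, smul_eq_mul]
  refine Finset.sum_congr rfl fun y _ => Finset.sum_congr rfl fun c _ =>
    Finset.sum_congr rfl fun c' _ => ?_
  rw [ite_mul, zero_mul, mul_ite, mul_zero, mul_ite, mul_zero]
  refine if_congr (and_congr eq_comm eq_comm) ?_ rfl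
  push_cast
  ring

/-- The shares are a uniform mixture over `y`, so the game may be analysed for each `y` separately,
with `y` as a parameter of the channel `cloneKraus`. -/
theorem hashScheme_guess_eq {lam : ℕ} (𝒜 : USSScheme.Adversary (E.msgLen lam)
      (hashShareLen n (E.ctLen lam) (k lam)) (hashIn E k n lam) (hashOut E lam))
    {B : Matrix (∀ i, 𝒜.Aux i) (∀ i, 𝒜.Aux i) ℂ} (hB : 𝒜.ξ = Bᴴ * B)
    (O : Oracle (hashIn E k n lam) (hashOut E lam)) (c : Bool) :
    (((𝒜.bob.run O).prod (𝒜.charlie.run O)).apply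
      (𝒜.cloned O ((hashScheme E k hn).shareState lam O (𝒜.m c))) (c, c) (c, c)).re =
    avg fun y : Fin n → BitStr (k lam) => 𝒜.guess O c ((𝒜.cloneKraus B O y).apply
      (E.encState lam (encOracle _ _ O) (hashKey E k n lam O y) (𝒜.m c))) := by
  have h1 := hashScheme_shareState_mul hn B lam O (𝒜.m c)
  rw [← hB] at h1
  change 𝒜.guess O c ((Kraus.pi fun i => (𝒜.party i).run O).apply (Matrix.of fun u v =>
    (hashScheme E k hn).shareState lam O (𝒜.m c) (fun i => (u i).1) (fun i => (v i).1) *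
      𝒜.ξ (fun i => (u i).2) (fun i => (v i).2))) = _
  rw [h1, Kraus.apply_sum, map_sum, avg, card_blocks, Nat.cast_pow, Nat.cast_ofNat,
    Finset.sum_div]
  refine Finset.sum_congr rfl fun y _ => ?_
  rw [Kraus.apply_smul, ← Complex.ofReal_pow, Complex.coe_smul, map_smul, smul_eq_mul,
    one_div_pow, one_div_mul_eq_div]
  exact congrArg (fun τ => 𝒜.guess O c τ / 2 ^ (n * k lam)) (Kraus.apply_comp _ _ _).symm

theorem hashScheme_exists_adversary (hn' : 2 ≤ n) {lam : ℕ}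
    (𝒜 : USSScheme.Adversary (E.msgLen lam) (hashShareLen n (E.ctLen lam) (k lam))
      (hashIn E k n lam) (hashOut E lam)) {q : ℕ} (hq : 𝒜.QueryBound q) :
    ∃ 𝒟 : E.Adversary lam, 𝒟.QueryBound (2 * (n * q) + 2 * q) ∧
      (hashScheme E k hn).winProb lam 𝒜 ≤ 𝒟.winProb +
        ∑ sk, |(E.keyGen lam sk).toReal - 1 / Fintype.card (BitStr (E.keyLen lam))| +
        n * (q * (9 * √((1 / 2) ^ k lam))) := by
  have hin : E.oIn lam ≤ max (E.oIn lam) (n * k lam) := le_max_left _ _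
  have hstr : n * k lam ≤ max (E.oIn lam) (n * k lam) := le_max_right _ _
  have hout : E.oOut lam ≤ hashOut E lam := le_max_left _ _
  have hkey : E.keyLen lam ≤ hashOut E lam := le_max_right _ _
  obtain ⟨B, hB⟩ := posSemidef_exists_eq_conjTranspose_mul_self 𝒜.ξ_isState.1
  let N := max (E.oIn lam) (n * k lam)
  let M := hashOut E lam
  let pt : (Fin n → BitStr (k lam)) → BitStr (N + 1) := hashPoint N
  -- `F` is the real game after resampling the oracle at the point of `y`. In `F'` the shareholders
  -- keep the old oracle value there, which is independent of the key, and only Bob and Charlie see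
  -- the new one.
  let F : (Fin n → BitStr (k lam)) → Oracle (N + 1) M → BitStr M →
      BitStr (E.keyLen lam) → Bool → ℝ := fun y O s sk c =>
    𝒜.guess (Function.update O (pt y) (overwriteBits s sk)) c
      ((𝒜.cloneKraus B (Function.update O (pt y) (overwriteBits s sk)) y).apply
        (E.encState lam (encOracle _ _ O) sk (𝒜.m c)))
  let F' : (Fin n → BitStr (k lam)) → Oracle (N + 1) M → BitStr M →
      BitStr (E.keyLen lam) → Bool → ℝ := fun y O s sk c =>
    𝒜.guess (Function.update O (pt y) (overwriteBits s sk)) c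
      ((𝒜.cloneKraus B O y).apply (E.encState lam (encOracle _ _ O) sk (𝒜.m c)))
  have hF' : ∀ y O s sk c, 0 ≤ F' y O s sk c ∧ F' y O s sk c ≤ 1 := by
    intro y O s sk c
    have h := (𝒜.cloneKraus_isChannel hn hB O y).isState
      (E.isState_encState lam (encOracle _ _ O) sk (𝒜.m c))
    exact ⟨(𝒜.guess_isEffect _ c).nonneg _ h.1, (𝒜.guess_isEffect _ c).le_one h⟩
  have h1 : (hashScheme E k hn).winProb lam 𝒜 =
      avg fun c => avg fun O => avg fun s => avg fun sk => avg fun y => F y O s sk c := by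
    unfold USSScheme.winProb
    simp only [hashScheme_guess_eq hn 𝒜 hB]
    rw [avg_comm]
    congr 1
    funext c
    rw [avg_comm, ← avg_comm₃]
    congr 1
    funext y
    refine (avg_hash y hkey fun O sk => 𝒜.guess O c ((𝒜.cloneKraus B O y).apply
      (E.encState lam (encOracle _ _ O) sk (𝒜.m c)))).trans ?_
    simp only [encOracle_update]
    rfl
  have h2 : (hashScheme E k hn).winProb lam 𝒜 ≤
      (avg fun c => avg fun O => avg fun s => avg fun sk => avg fun y => F' y O s sk c) +
        n * (q * (9 * √((1 / 2) ^ k lam))) := by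
    rw [h1]
    refine (avg_mono fun c => avg_mono fun O => avg_mono fun s => avg_mono fun sk =>
      𝒜.avg_guess_le hn' hstr hq hB O (overwriteBits s sk) c
        (E.isState_encState lam (encOracle _ _ O) sk (𝒜.m c))).trans ?_
    simp only [avg_add, avg_const]
    exact le_rfl
  have h3 : (avg fun c => avg fun O => avg fun s => avg fun sk => avg fun y => F' y O s sk c) =
      avg fun y => avg fun O => avg fun s => avg fun sk => avg fun c => F' y O s sk c := by
    simp only [← avg_comm₃ fun y O s sk => F' y O s sk _]
    rw [avg_comm]
    congr 1
    funext y
    exact avg_comm₃ fun c O s sk => F' y O s sk c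
  -- From here on `y`, the oracle outside `G`, and the surplus bits `s` are fixed to values at least
  -- as good as the average. The oracle `G`, the key and the challenge remain random, as in the
  -- cloning game.
  obtain ⟨y, hy⟩ := exists_avg_le fun y => avg fun O => avg fun s => avg fun sk => avg fun c =>
    F' y O s sk c
  rw [avg_overwriteOracle hin hout] at hy
  obtain ⟨O, hO⟩ := exists_avg_le fun O => avg fun G : Oracle (E.oIn lam) (E.oOut lam) =>
    avg fun s => avg fun sk => avg fun c => F' y (overwriteOracle O G) s sk c
  rw [avg_comm (α := Oracle (E.oIn lam) (E.oOut lam))] at hO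
  obtain ⟨s, hs⟩ := exists_avg_le fun s => avg fun G : Oracle (E.oIn lam) (E.oOut lam) =>
    avg fun sk => avg fun c => F' y (overwriteOracle O G) s sk c
  obtain ⟨𝒟, h𝒟, hwin⟩ := 𝒜.exists_simulation hn hq hB O s y
  refine ⟨𝒟, h𝒟, ?_⟩
  have h4 : (avg fun G : Oracle (E.oIn lam) (E.oOut lam) =>
      avg fun sk => avg fun c => F' y (overwriteOracle O G) s sk c) ≤ 𝒟.winProb +
        ∑ sk, |(E.keyGen lam sk).toReal - 1 / Fintype.card (BitStr (E.keyLen lam))| := by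
    rw [hwin, ← avg_const (α := Oracle (E.oIn lam) (E.oOut lam)) (∑ sk, |_|), ← avg_add]
    refine avg_mono fun G => ?_
    have h5 := (abs_le.mp (abs_sum_mul_sub_avg_le (fun sk => (E.keyGen lam sk).toReal)
      (f := fun sk => avg fun c => F' y (overwriteOracle O G) s sk c)
      (fun sk => avg_nonneg fun c => (hF' y _ s sk c).1)
      (fun sk => avg_le fun c => (hF' y _ s sk c).2))).1
    have h6 : ∀ sk c, F' y (overwriteOracle O G) s sk c =
        𝒜.guess (Function.update (overwriteOracle O G) (hashPoint N y) (overwriteBits s sk)) c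
          ((𝒜.cloneKraus B (overwriteOracle O G) y).apply (E.encState lam G sk (𝒜.m c))) := by
      intro sk c
      simp only [F']
      rw [encOracle_overwriteOracle hin hout]
    simp only [h6] at h5 ⊢
    exact neg_le_sub_iff_le_add.mp h5
  linarith

theorem hashScheme_isUSS (hn' : 2 ≤ n) (hKey : E.HasNearUniformKey) (hSec : E.IsSecure)
    (hk : Negligible fun lam => (1 / 2 : ℝ) ^ k lam) : (hashScheme E k hn).IsUSS 1 := by
  rintro 𝒜 ⟨q, hq, h𝒜⟩ -
  choose 𝒟 h𝒟 hwin using fun lam => hashScheme_exists_adversary hn hn' (𝒜 lam) (h𝒜 lam)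
  obtain ⟨ε, hε, hwin'⟩ := hSec 𝒟 ⟨_, ((hq.const_mul n).const_mul 2).add (hq.const_mul 2), h𝒟⟩
  -- The factor `2` undoes the `1 / 2` in the statistical distance of `HasNearUniformKey`.
  refine ⟨_, (hε.add (hKey.const_mul 2)).add (((hk.sqrt.const_mul 9).polyBounded_mul hq).const_mul
    n), fun lam => ?_⟩
  have h1 := hwin lam
  have h2 := hwin' lam
  linarith

end HashSecurity

end QROM

end

theorem mainTheorem4 (E : QROM.UEScheme) (hEff : E.IsEfficient) (hKey : E.HasNearUniformKey)
    (hCorr : E.IsCorrect) (hSec : E.IsSecure)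
    (k : ℕ → ℕ) (hkPoly : QROM.PolyBounded k) (hk : QROM.Negligible fun lam => (1 / 2 : ℝ) ^ k lam)
    (n : ℕ) (hn : 2 ≤ n) :
    ∃ S : QROM.USSScheme n E.msgLen (fun lam => QROM.hashShareLen n (E.ctLen lam) (k lam))
        (QROM.hashIn E k n) (QROM.hashOut E),
      QROM.IsHashScheme E k n S ∧ S.IsEfficient ∧ S.IsCorrect ∧ S.IsUSS 1 := by
  have hn' : 0 < n := by omega
  exact ⟨QROM.hashScheme E k hn', QROM.hashScheme_isHashScheme hn',
    QROM.hashScheme_isEfficient hn' hEff hkPoly, QROM.hashScheme_isCorrect hn' hKey hCorr,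
    QROM.hashScheme_isUSS hn' hn hKey hSec hk⟩
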